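/- Let $\pi$ be a group. A *Gauss diagram of degree $n$ on $\pi$* is an oriented circle, up to positive homeomorphism, with $2n$ distinct points joined in pairs by $n$ abstract arrows, each with a writhe in $\{\pm1\}$, and with an element of $\pi$ on each of the $2n$ edges (components of the complement of the points); for $n=0$ it is a circle marked by a conjugacy class of $\pi$. An *arrow diagram* is a Gauss diagram whose writhes are forgotten. Removing arrows merges edges, and the markings of merged edges are multiplied in the order of the circle (if no arrow is left, the product is kept up to conjugacy); the result is a *subdiagram*. $\operatorname{Aut}$ denotes the group of rotations preserving a diagram (trivial for $n=0$). Let $\mathfrak G,\mathfrak A$ be the $\mathbb Q$-vector spaces freely generated by Gauss, resp. arrow, diagrams, and $\widehat{\mathfrak G},\widehat{\mathfrak A}$ the spaces of formal series of such diagrams of bounded degree. The pairing $\langle\,,\rangle$ of a series with a finite linear combination is bilinear, with $\langle D,D'\rangle=|\operatorname{Aut}D|$ if $D=D'$ and $0$ otherwise. Let $\operatorname{sign}(G)$ be the product of the writhes of $G$, and $\overline G$ the arrow diagram obtained from $G$ by forgetting the writhes. Set $$T(G)=\operatorname{sign}(G)\,\overline G,\qquad S(A)=\sum_{\overline G=A}\operatorname{sign}(G)\frac{|\operatorname{Aut}A|}{|\operatorname{Aut}G|}\,G,$$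 with $T:\mathfrak G\to\mathfrak A$ extended linearly and $S:\widehat{\mathfrak A}\to\widehat{\mathfrak G}$ componentwise, and let $I(G)$ be the sum of the $2^n$ subdiagrams of $G$. *Signs of edges.* For an edge $e$ bounded by two different arrows, let ${\uparrow}(e)$ be the number of arrowheads at its ends, $\eta(e)=1$ if the two arrows cross (their ends alternate on the circle) and $-1$ otherwise, $\varepsilon(e)=\eta(e)(-1)^{\uparrow(e)}$, and, in a Gauss diagram, $\mathrm w(e)$ the product of the writhes of the two arrows. *$\mathrm R_2$ condition.* $\mathcal A\in\widehat{\mathfrak A}$ satisfies the $\mathrm R_2$ condition if $\langle\mathcal A,A\rangle=0$ for each arrow diagram $A$ containing two different arrows whose heads are consecutive, whose tails are consecutive, and such that the two edges in between are marked by $1$. *$\mathrm R_3$-moves and $A6T$.* Let $G$ be a Gauss diagram with three different arrows whose six ends are the ends of three edges marked by $1$ without common ends, each edge being bounded by a different pair of the three arrows, such that $\mathrm w(e)\varepsilon(e)$ is the same for the three edges and the three numbers ${\uparrow}(e)$ are pairwise different. The $\mathrm R_3$-move replaces $G$ by the diagram $G'$ in which the two ends of each of the three edges are exchanged, the markings of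 all edges being kept. If $G_i$, $G'_i$ are $G$, $G'$ without the $i$-th of the three arrows, the corresponding $A6T$ relator is $T\bigl(\sum_{i=1}^3(G_i-G_i')\bigr)$. *The map $d$ and the triangle relations.* A degenerate arrow diagram is an arrow diagram in which one edge, bounded by two different arrows, has been shrunk to a point (and its marking is dropped). For an arrow diagram $A$, $d(A)$ is the sum, over all edges $e$ of $A$ that are marked by $1$ and bounded by two different arrows, of $\varepsilon(e)$ times the degenerate diagram obtained by shrinking $e$; $d$ is extended componentwise to series. The triangle relations, where everything except the two arrows meeting at the degenerate point is the same in the three diagrams, are $$(t\to x,\ t\to y)=(t\to x\to y)+(t\to y\to x),\qquad (x\to h,\ y\to h)=(x\to y\to h)+(y\to x\to h).$$ A formal series is $0$ modulo these relations if it is a formal, possibly infinite, linear combination of the corresponding relators (each diagram occurs in at most two of them). **Theorem.** Let $\mathcal A\in\widehat{\mathfrak A}$ satisfy the $\mathrm R_2$ condition. Then the following are equivalent: 1. the map $G\mapsto\langle S(\mathcal A),I(G)\rangle$ on Gauss diagrams on $\pi$ is invariant under $\mathrm R_3$-moves; 2. $d(\mathcal A)=0$ modulo the triangle relations; 3. $\mathcal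 A$ is orthogonal, for $\langle\,,\rangle$, to the linear span of the $A6T$ relators. -/

import Mathlib

noncomputable section

/-! ### Oriented circles with finitely many points, the edges marked by elements of a group -/

/-- An oriented circle with a set `P` of distinguished points, up to positive homeomorphism, with an
element of `π` on each edge. `next x` is the point that follows `x`; that every point is reached from
every other one says that `P` is finite and that `next` is one cycle. `mark x` is the marking of the
edge that goes from `x` to `next x`. If there is no point, the circle has a marking up to conjugacy. -/
structure MarkedCircle (π : Type*) [Group π] (P : Type*) where
  next : P → P
  connected : ∀ x y : P, ∃ k : ℕ, next^[k] x = y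
  mark : P → π
  emptyMark : IsEmpty P → ConjClasses π

namespace MarkedCircle

variable {π : Type*} [Group π] {P P' : Type*}

/-- Renaming of the points. -/
def map (C : MarkedCircle π P) (e : P ≃ P') : MarkedCircle π P' where
  next := fun y => e (C.next (e.symm y))
  connected := by
    intro x y
    obtain ⟨k, hk⟩ := C.connected (e.symm x) (e.symm y)
    refine ⟨k, ?_⟩
    have h : ∀ j : ℕ, (fun y => e (C.next (e.symm y)))^[j] x = e (C.next^[j] (e.symm x)) := by
      intro j
      induction j with
      | zero => simp
      | succ j ih => rw [Function.iterate_succ_apply', Function.iterate_succ_apply', ih]; simp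
    rw [h k, hk]
    simp
  mark := fun y => C.mark (e.symm y)
  emptyMark := fun _ => C.emptyMark e.isEmpty

/-- The product of the markings of the `k` edges that follow the point `x`, in the order in which
they are met. -/
def pathMark (C : MarkedCircle π P) (x : P) (k : ℕ) : π :=
  ((List.range k).map fun i => C.mark (C.next^[i] x)).prod

/-- The product of all markings, once around the circle from `x`. -/
def holonomy (C : MarkedCircle π P) (x : P) : π :=
  C.pathMark x (Function.minimalPeriod C.next x)

/-- The number of edges from `x` to `y`, in the positive direction. -/
def dist (C : MarkedCircle π P) (x y : P) : ℕ :=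
  sInf {k : ℕ | C.next^[k] x = y}

theorem exists_return (C : MarkedCircle π P) (Q : Set P) (x : Q) :
    ∃ k : ℕ, 0 < k ∧ C.next^[k] (x : P) ∈ Q := by
  obtain ⟨k, hk⟩ := C.connected (C.next x) x
  refine ⟨k + 1, Nat.succ_pos k, ?_⟩
  rw [Function.iterate_succ_apply, hk]
  exact x.2

/-- The number of edges from a point `x` of `Q` to the next point of `Q`. -/
def returnTime (C : MarkedCircle π P) (Q : Set P) (x : Q) : ℕ :=
  sInf {k : ℕ | 0 < k ∧ C.next^[k] (x : P) ∈ Q}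

theorem returnTime_spec (C : MarkedCircle π P) (Q : Set P) (x : Q) :
    0 < C.returnTime Q x ∧ C.next^[C.returnTime Q x] (x : P) ∈ Q :=
  Nat.sInf_mem (C.exists_return Q x)

theorem returnTime_le (C : MarkedCircle π P) (Q : Set P) (x : Q) (k : ℕ) (hk : 0 < k)
    (h : C.next^[k] (x : P) ∈ Q) : C.returnTime Q x ≤ k :=
  Nat.sInf_le ⟨hk, h⟩

open Classical in
/-- Forgetting the points outside `Q`: edges are merged and their markings multiplied. If no point
is left, the product once around the circle is kept up to conjugacy. -/
def restrict (C : MarkedCircle π P) (Q : Set P) : MarkedCircle π Q where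
  next := fun x => ⟨C.next^[C.returnTime Q x] (x : P), (C.returnTime_spec Q x).2⟩
  connected := by
    intro x y
    obtain ⟨k, hk⟩ := C.connected x y
    induction k using Nat.strong_induction_on generalizing x with
    | _ k ih =>
      rcases Nat.eq_zero_or_pos k with h0 | hpos
      · subst h0
        exact ⟨0, Subtype.ext hk⟩
      · have hle := C.returnTime_le Q x k hpos (by rw [hk]; exact y.2)
        have hrt := (C.returnTime_spec Q x).1
        obtain ⟨j, hj⟩ := ih (k - C.returnTime Q x) (by omega)
          ⟨C.next^[C.returnTime Q x] (x : P), (C.returnTime_spec Q x).2⟩ (by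
            show C.next^[k - C.returnTime Q x] (C.next^[C.returnTime Q x] (x : P)) = y
            rw [← Function.iterate_add_apply, Nat.sub_add_cancel hle, hk])
        exact ⟨j + 1, by rw [Function.iterate_succ_apply]; exact hj⟩
  mark := fun x => C.pathMark x (C.returnTime Q x)
  emptyMark := fun _ =>
    if h : IsEmpty P then C.emptyMark h
    else ConjClasses.mk (C.holonomy (Classical.choice (not_isEmpty_iff.mp h)))

/-- The product once around the circle does not depend, up to conjugacy, on the starting point, so
that the choice made in `restrict` does not matter. -/
theorem holonomy_isConj (C : MarkedCircle π P) (x y : P) :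
    IsConj (C.holonomy x) (C.holonomy y) := by
  have hstep : ∀ z : P, IsConj (C.holonomy z) (C.holonomy (C.next z)) := by
    intro z
    have hper : z ∈ Function.periodicPts C.next := by
      obtain ⟨k, hk⟩ := C.connected (C.next z) z
      exact Function.mk_mem_periodicPts (Nat.succ_pos k)
        (by rw [Function.IsPeriodicPt, Function.IsFixedPt, Function.iterate_succ_apply, hk])
    have hpos := Function.minimalPeriod_pos_of_mem_periodicPts hper
    have heq : Function.minimalPeriod C.next (C.next z) = Function.minimalPeriod C.next z :=
      Function.minimalPeriod_apply hper
    obtain ⟨p, hp⟩ : ∃ p, Function.minimalPeriod C.next z = p + 1 :=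
      ⟨_, (Nat.succ_pred_eq_of_pos hpos).symm⟩
    have hz : C.next^[p] (C.next z) = z := by
      rw [← Function.iterate_succ_apply, ← Nat.succ_eq_add_one] at *
      rw [← hp]
      exact Function.iterate_minimalPeriod
    have h1 : C.holonomy z = C.mark z * C.pathMark (C.next z) p := by
      unfold holonomy pathMark
      rw [hp, List.range_succ_eq_map]
      simp [List.map_map, Function.comp_def]
    have h2 : C.holonomy (C.next z) = C.pathMark (C.next z) p * C.mark z := by
      unfold holonomy pathMark
      rw [heq, hp, List.range_succ]
      simp [hz]
    rw [isConj_iff]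
    refine ⟨(C.mark z)⁻¹, ?_⟩
    rw [h1, h2]
    group
  obtain ⟨k, hk⟩ := C.connected x y
  rw [← hk]
  clear hk
  induction k with
  | zero => exact IsConj.refl _
  | succ k ih => rw [Function.iterate_succ_apply']; exact ih.trans (hstep _)

end MarkedCircle

/-! ### Gauss diagrams and arrow diagrams on a group -/

/-- A diagram on `π` with set of arrows `α`, each arrow being decorated by an element of `σ`. The
point `(a, false)` is the tail of the arrow `a`, and `(a, true)` is its head. -/
structure Diagram (σ : Type*) (π : Type*) [Group π] (α : Type*) where
  circle : MarkedCircle π (α × Bool)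
  deco : α → σ

/-- Gauss diagrams: every arrow has a writhe. -/
abbrev GaussDiagram (π : Type*) [Group π] (α : Type*) := Diagram ℤˣ π α

/-- Arrow diagrams: the writhes are forgotten. -/
abbrev ArrowDiagram (π : Type*) [Group π] (α : Type*) := Diagram Unit π α

namespace Diagram

variable {σ : Type*} {π : Type*} [Group π] {α β : Type*}

/-- Renaming of the arrows. -/
def map (D : Diagram σ π α) (e : α ≃ β) : Diagram σ π β where
  circle := D.circle.map (e.prodCongr (Equiv.refl Bool))
  deco := fun b => D.deco (e.symm b)

theorem map_refl (D : Diagram σ π α) : D.map (Equiv.refl α) = D := rfl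

theorem map_map {γ : Type*} (D : Diagram σ π α) (e : α ≃ β) (f : β ≃ γ) :
    (D.map e).map f = D.map (e.trans f) := rfl

/-- The order of the group of symmetries of a diagram. A rotation that preserves the diagram is
determined by the permutation of the arrows that it induces. -/
def autCard (D : Diagram σ π α) : ℕ := Nat.card {e : Equiv.Perm α // D.map e = D}

/-- The subdiagram with set of arrows `S`: the other arrows are removed. -/
def restrict (D : Diagram σ π α) (S : Set α) : Diagram σ π S where
  circle := (D.circle.restrict {x : α × Bool | x.1 ∈ S}).map Equiv.prodSubtypeFstEquivSubtypeProd
  deco := fun a => D.deco a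

/-- Forgetting the decorations of the arrows. -/
def forget (D : Diagram σ π α) : ArrowDiagram π α where
  circle := D.circle
  deco := fun _ => ()

/-- Two arrows cross if exactly one end of `b` is met on the way from the tail to the head
of `a`. -/
def Crosses (D : Diagram σ π α) (a b : α) : Prop :=
  Xor (D.circle.dist (a, false) (b, false) < D.circle.dist (a, false) (a, true))
    (D.circle.dist (a, false) (b, true) < D.circle.dist (a, false) (a, true))

/-- The number of arrowheads at the boundary of the edge from `p` to `next p`. -/
def headCount (D : Diagram σ π α) (p : α × Bool) : ℕ :=
  p.2.toNat + (D.circle.next p).2.toNat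

open Classical in
/-- `1` if the arrows that bound the edge from `p` to `next p` cross each other, `-1` otherwise. -/
def eta (D : Diagram σ π α) (p : α × Bool) : ℤ :=
  if D.Crosses p.1 (D.circle.next p).1 then 1 else -1

/-- The sign `ε` of the edge from `p` to `next p`. -/
def epsilon (D : Diagram σ π α) (p : α × Bool) : ℤ :=
  D.eta p * (-1) ^ D.headCount p

/-- The edge from `p` to `next p` is marked by `1` and bounded by two different arrows. -/
def IsNice (D : Diagram σ π α) (p : α × Bool) : Prop :=
  D.circle.mark p = 1 ∧ p.1 ≠ (D.circle.next p).1

end Diagram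

/-- Diagrams up to isomorphism, that is up to positive homeomorphism of the circle. -/
instance diagramSetoid (σ : Type*) (π : Type*) [Group π] :
    Setoid (Σ n : ℕ, Diagram σ π (Fin n)) where
  r := fun D D' => ∃ e : Fin D.1 ≃ Fin D'.1, D.2.map e = D'.2
  iseqv :=
    { refl := fun D => ⟨Equiv.refl _, rfl⟩
      symm := by
        rintro D D' ⟨e, he⟩
        refine ⟨e.symm, ?_⟩
        rw [← he, Diagram.map_map, Equiv.self_trans_symm, Diagram.map_refl]
      trans := by
        rintro D D' D'' ⟨e, he⟩ ⟨f, hf⟩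
        exact ⟨e.trans f, by rw [← Diagram.map_map, he, hf]⟩ }

/-- The set of all diagrams, of all degrees. -/
def DiagramClass (σ : Type*) (π : Type*) [Group π] := Quotient (diagramSetoid σ π)

abbrev GaussClass (π : Type*) [Group π] := DiagramClass ℤˣ π

abbrev ArrowClass (π : Type*) [Group π] := DiagramClass Unit π

/-- The class of a diagram with a finite set of arrows. -/
def Diagram.toClass {σ π : Type*} [Group π] {α : Type*} [Finite α] (D : Diagram σ π α) :
    DiagramClass σ π :=
  Quotient.mk (diagramSetoid σ π) ⟨Nat.card α, D.map (Finite.equivFin α)⟩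

namespace DiagramClass

variable {σ π : Type*} [Group π]

/-- The number of arrows. -/
def degree (c : DiagramClass σ π) : ℕ :=
  Quotient.lift (fun D : Σ n : ℕ, Diagram σ π (Fin n) => D.1) (by
    rintro D D' ⟨e, -⟩
    simpa using Fintype.card_congr e) c

/-- The order of the group of symmetries. -/
def autCard (c : DiagramClass σ π) : ℕ :=
  Quotient.lift (fun D : Σ n : ℕ, Diagram σ π (Fin n) => D.2.autCard) (by
    rintro ⟨n, D⟩ ⟨n', D'⟩ ⟨e, he⟩
    dsimp only at e he
    subst he
    refine Nat.card_congr (Equiv.subtypeEquiv e.permCongr fun f => ?_)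
    have h : (D.map e).map (e.permCongr f) = (D.map f).map e := by
      rw [Diagram.map_map, Diagram.map_map]
      congr 1
      ext x
      simp
    rw [h]
    constructor
    · intro hf
      rw [hf]
    · intro hf
      have := congrArg (fun E => E.map e.symm) hf
      simpa only [Diagram.map_map, Equiv.self_trans_symm, Equiv.trans_assoc, Equiv.trans_refl,
        Diagram.map_refl] using this) c

/-- Forgetting the decorations of the arrows. -/
def forget (c : DiagramClass σ π) : ArrowClass π :=
  Quotient.map (fun D : Σ n : ℕ, Diagram σ π (Fin n) =>
    (⟨D.1, D.2.forget⟩ : Σ n : ℕ, Diagram Unit π (Fin n))) (by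
      rintro D D' ⟨e, he⟩
      exact ⟨e, congrArg Diagram.forget he⟩) c

theorem degree_forget (c : DiagramClass σ π) : c.forget.degree = c.degree := by
  induction c using Quotient.inductionOn with
  | _ D => rfl

end DiagramClass

/-- The product of the writhes of all arrows. -/
def GaussClass.sign {π : Type*} [Group π] (c : GaussClass π) : ℤˣ :=
  Quotient.lift (fun D : Σ n : ℕ, Diagram ℤˣ π (Fin n) => ∏ a, D.2.deco a) (by
    rintro ⟨n, D⟩ ⟨n', D'⟩ ⟨e, he⟩
    dsimp only at e he
    subst he
    exact (Equiv.prod_comp e.symm D.deco).symm) c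

/-! ### Series, pairings, and the maps `I`, `S`, `T` -/

/-- Formal series of diagrams, of bounded degree. -/
structure DiagramSeries (σ : Type*) (π : Type*) [Group π] where
  coeff : DiagramClass σ π → ℚ
  bounded : ∃ N : ℕ, ∀ c, N < c.degree → coeff c = 0

/-- The pairing `⟨ , ⟩` of a series with a finite linear combination of diagrams, normalized
by `⟨A, A⟩ = |Aut A|`. -/
def DiagramSeries.pairing {σ π : Type*} [Group π] (𝒜 : DiagramSeries σ π)
    (x : DiagramClass σ π →₀ ℚ) : ℚ :=
  x.sum fun c q => (c.autCard : ℚ) * 𝒜.coeff c * q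

section

variable {π : Type*} [Group π]

/-- The map `S` from arrow diagram series to Gauss series. The coefficient of `G` in `S(A)` is
`sign(G) |Aut A| / |Aut G|` if `A` is `G` without its writhes, and `0` otherwise. -/
def gaussSeries (𝒜 : DiagramSeries Unit π) : DiagramSeries ℤˣ π where
  coeff := fun G =>
    ((GaussClass.sign G : ℤ) : ℚ) * ((G.forget.autCard : ℚ) / (G.autCard : ℚ)) *
      𝒜.coeff G.forget
  bounded := by
    obtain ⟨N, hN⟩ := 𝒜.bounded
    exact ⟨N, fun c hc => by rw [hN c.forget (by rwa [DiagramClass.degree_forget]), mul_zero]⟩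

/-- The map `T` from linear combinations of Gauss diagrams to linear combinations of arrow
diagrams: a diagram `G` is mapped to `sign(G)` times `G` without its writhes. -/
def arrowPart (x : GaussClass π →₀ ℚ) : ArrowClass π →₀ ℚ :=
  x.sum fun G q => Finsupp.single G.forget (((GaussClass.sign G : ℤ) : ℚ) * q)

/-- The map `I`: the formal sum of all subdiagrams. -/
def subdiagramSum {α : Type*} [Fintype α] (G : GaussDiagram π α) : GaussClass π →₀ ℚ :=
  ∑ S : Finset α, Finsupp.single (G.restrict (S : Set α)).toClass 1

/-- The function `G ↦ ⟨S(𝒜), I(G)⟩`. -/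
def diagramInvariant (𝒜 : DiagramSeries Unit π) {α : Type*} [Fintype α]
    (G : GaussDiagram π α) : ℚ :=
  (gaussSeries 𝒜).pairing (subdiagramSum G)

/-! ### The `R₂` condition -/

/-- The ends of type `i` (tails or heads) of two different arrows `a` and `b` are consecutive, and
the edge between them is marked by `1`. -/
def Diagram.EndsAdjacent {σ α : Type*} (D : Diagram σ π α) (a b : α) (i : Bool) : Prop :=
  (D.circle.next (a, i) = (b, i) ∧ D.circle.mark (a, i) = 1) ∨
    (D.circle.next (b, i) = (a, i) ∧ D.circle.mark (b, i) = 1)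

/-- The relators `AP₂^{(n-2),2}`: arrow diagrams with two different arrows whose heads are
consecutive as well as their tails, the two edges in between being marked by `1`. -/
def IsAP2 (r : ArrowClass π →₀ ℚ) : Prop :=
  ∃ (n : ℕ) (A : ArrowDiagram π (Fin n)) (a b : Fin n), a ≠ b ∧
    A.EndsAdjacent a b false ∧ A.EndsAdjacent a b true ∧ r = Finsupp.single A.toClass 1

/-- The `R₂` condition: `𝒜` satisfies all `AP₂^{(n-2),2}` relations. -/
def SatisfiesR2 (𝒜 : DiagramSeries Unit π) : Prop :=
  ∀ r : ArrowClass π →₀ ℚ, IsAP2 r → 𝒜.pairing r = 0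

/-! ### `R₃`-moves and the `A6T` relations -/

/-- The data of an `R₃`-move on `G`: three edges (the `i`-th one goes from `p i` to `next (p i)`) and
three arrows `a 0`, `a 1`, `a 2`. The three edges are marked by `1` and have six distinct ends, which
are the ends of the three arrows; the `i`-th edge is bounded by the two arrows other than `a i`; the
numbers of arrowheads at the three edges are pairwise different; the value of `w(e)ε(e)` is the same
for all three. -/
structure IsR3Site {α : Type*} (G : GaussDiagram π α) (p : Fin 3 → α × Bool) (a : Fin 3 → α) :
    Prop where
  arrows_distinct : Function.Injective a
  ends_distinct : Function.Injective (Sum.elim p fun i => G.circle.next (p i))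
  bounded_by : ∀ i, ({(p i).1, (G.circle.next (p i)).1} : Set α) = {a (i + 1), a (i + 2)}
  marks : ∀ i, G.circle.mark (p i) = 1
  heads : Function.Injective fun i => G.headCount (p i)
  signs : ∀ i j,
    ((G.deco (p i).1 * G.deco (G.circle.next (p i)).1 : ℤˣ) : ℤ) * G.epsilon (p i) =
      ((G.deco (p j).1 * G.deco (G.circle.next (p j)).1 : ℤˣ) : ℤ) * G.epsilon (p j)

open Classical in
/-- The result of an `R₃`-move: the two ends of each of the three edges are exchanged. The markings
of the edges of the circle do not change. -/
def r3Move {α : Type*} (G : GaussDiagram π α) (p : Fin 3 → α × Bool) : GaussDiagram π α where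
  circle := G.circle.map
    (Equiv.swap (p 0) (G.circle.next (p 0)) * Equiv.swap (p 1) (G.circle.next (p 1)) *
      Equiv.swap (p 2) (G.circle.next (p 2)))
  deco := G.deco

/-- Invariance of `G ↦ ⟨S(𝒜), I(G)⟩` under `R₃`-moves. -/
def IsR3Invariant (𝒜 : DiagramSeries Unit π) : Prop :=
  ∀ (n : ℕ) (G : GaussDiagram π (Fin n)) (p : Fin 3 → Fin n × Bool) (a : Fin 3 → Fin n),
    IsR3Site G p a → diagramInvariant 𝒜 G = diagramInvariant 𝒜 (r3Move G p)

/-- The homogeneous relator `G6T` at the site of an `R₃`-move: the sum of the three diagrams that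
are obtained by removing one of the three arrows before the move, minus the sum of the three
diagrams obtained in the same way after the move. -/
def g6t {n : ℕ} (G : GaussDiagram π (Fin n)) (p : Fin 3 → Fin n × Bool) (a : Fin 3 → Fin n) :
    GaussClass π →₀ ℚ :=
  ∑ i, (Finsupp.single (G.restrict {b | b ≠ a i}).toClass 1 -
    Finsupp.single ((r3Move G p).restrict {b | b ≠ a i}).toClass 1)

/-- The `A6T` relators are the images of the `G6T` relators under `T`. -/
def a6tRelators (π : Type*) [Group π] : Set (ArrowClass π →₀ ℚ) :=
  {r | ∃ (n : ℕ) (G : GaussDiagram π (Fin n)) (p : Fin 3 → Fin n × Bool) (a : Fin 3 → Fin n),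
    IsR3Site G p a ∧ r = arrowPart (g6t G p a)}

/-- `𝒜` is orthogonal to the span of the `A6T` relators. -/
def IsOrthogonalToA6T (𝒜 : DiagramSeries Unit π) : Prop :=
  ∀ r ∈ Submodule.span ℚ (a6tRelators π), 𝒜.pairing r = 0

end

/-! ### Degenerate diagrams, the map `d`, and the triangle relations -/

/-- A degenerate arrow diagram on `π` with set of points `P` on the circle and set of arrows `α`:
two ends of two different arrows lie at the same point, and all other ends are distinct. -/
structure DegenerateDiagram (π : Type*) [Group π] (P α : Type*) where
  circle : MarkedCircle π P
  place : α × Bool → P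
  surj : Function.Surjective place
  degenerate : ∃ x y : α × Bool, x.1 ≠ y.1 ∧ place x = place y ∧
    ∀ u v, place u = place v → u = v ∨ (u = x ∧ v = y) ∨ (u = y ∧ v = x)

namespace DegenerateDiagram

variable {π : Type*} [Group π] {P P' P'' α β γ : Type*}

theorem ext_of {D D' : DegenerateDiagram π P α} (h : D.circle = D'.circle)
    (h' : D.place = D'.place) : D = D' := by
  cases D; cases D'; cases h; cases h'; rfl

/-- Renaming of the points and of the arrows. -/
def map (D : DegenerateDiagram π P α) (f : P ≃ P') (e : α ≃ β) : DegenerateDiagram π P' β where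
  circle := D.circle.map f
  place := fun x => f (D.place (e.symm x.1, x.2))
  surj := by
    intro y
    obtain ⟨x, hx⟩ := D.surj (f.symm y)
    exact ⟨(e x.1, x.2), by simp [hx]⟩
  degenerate := by
    obtain ⟨x, y, hne, hxy, huniq⟩ := D.degenerate
    refine ⟨(e x.1, x.2), (e y.1, y.2), by simpa using hne, by simpa using hxy, ?_⟩
    rintro ⟨u, i⟩ ⟨v, j⟩ huv
    have h := huniq (e.symm u, i) (e.symm v, j) (f.injective huv)
    rcases x with ⟨x, k⟩
    rcases y with ⟨y, l⟩
    simpa [Prod.ext_iff, Equiv.symm_apply_eq] using h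

theorem map_refl (D : DegenerateDiagram π P α) : D.map (Equiv.refl P) (Equiv.refl α) = D := rfl

theorem map_map (D : DegenerateDiagram π P α) (f : P ≃ P') (e : α ≃ β) (f' : P' ≃ P'')
    (e' : β ≃ γ) : (D.map f e).map f' e' = D.map (f.trans f') (e.trans e') := rfl

open Classical in
/-- Suppose that ends of the same type `i` of two different arrows `a` and `b` meet at the
degenerate point. Move this end of `b` to the place of the other end of `a`. -/
def slide (D : DegenerateDiagram π P α) (a b : α) (i : Bool) (hab : a ≠ b)
    (h : D.place (a, i) = D.place (b, i)) : DegenerateDiagram π P α where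
  circle := D.circle
  place := Function.update D.place (b, i) (D.place (a, !i))
  surj := by
    intro y
    obtain ⟨x, hx⟩ := D.surj y
    by_cases hxb : x = (b, i)
    · refine ⟨(a, i), ?_⟩
      rw [Function.update_of_ne (by simp [hab]), h, ← hxb, hx]
    · exact ⟨x, by rw [Function.update_of_ne hxb, hx]⟩
  degenerate := by
    obtain ⟨x, y, hne, hxy, huniq⟩ := D.degenerate
    have hpair : ∀ u v, D.place u = D.place v →
        u = v ∨ (u = (a, i) ∧ v = (b, i)) ∨ (u = (b, i) ∧ v = (a, i)) := by
      intro u v huv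
      have h1 := huniq _ _ h
      have h2 := huniq _ _ huv
      have h3 : ((a, i) : α × Bool) ≠ (b, i) := by simp [hab]
      rcases h1 with h1 | ⟨rfl, rfl⟩ | ⟨rfl, rfl⟩
      · exact absurd h1 h3
      · exact h2
      · tauto
    refine ⟨(a, !i), (b, i), hab, ?_, ?_⟩
    · rw [Function.update_self, Function.update_of_ne (by simp)]
    · intro u v huv
      by_cases hu : u = (b, i)
      · by_cases hv : v = (b, i)
        · exact Or.inl (hu.trans hv.symm)
        · rw [hu, Function.update_self, Function.update_of_ne hv] at huv
          rcases hpair _ _ huv with h1 | h1 | h1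
          · exact Or.inr (Or.inr ⟨hu, h1.symm⟩)
          · exact absurd h1.2 hv
          · exact absurd (congrArg Prod.fst h1.1) hab
      · by_cases hv : v = (b, i)
        · rw [hv, Function.update_self, Function.update_of_ne hu] at huv
          rcases hpair _ _ huv with h1 | h1 | h1
          · exact Or.inr (Or.inl ⟨h1, hv⟩)
          · exact absurd (congrArg Prod.fst h1.2) hab
          · exact absurd h1.1 hu
        · rw [Function.update_of_ne hu, Function.update_of_ne hv] at huv
          rcases hpair _ _ huv with h1 | h1 | h1
          · exact Or.inl h1
          · exact absurd h1.2 hv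
          · exact absurd h1.1 hu

end DegenerateDiagram

/-- Degenerate diagrams up to positive homeomorphism of the circle. -/
instance degenerateSetoid (π : Type*) [Group π] :
    Setoid (Σ k : ℕ × ℕ, DegenerateDiagram π (Fin k.1) (Fin k.2)) where
  r := fun D D' => ∃ (f : Fin D.1.1 ≃ Fin D'.1.1) (e : Fin D.1.2 ≃ Fin D'.1.2), D.2.map f e = D'.2
  iseqv :=
    { refl := fun D => ⟨Equiv.refl _, Equiv.refl _, rfl⟩
      symm := by
        rintro D D' ⟨f, e, he⟩
        refine ⟨f.symm, e.symm, ?_⟩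
        rw [← he, DegenerateDiagram.map_map, Equiv.self_trans_symm, Equiv.self_trans_symm,
          DegenerateDiagram.map_refl]
      trans := by
        rintro D D' D'' ⟨f, e, he⟩ ⟨f', e', he'⟩
        exact ⟨f.trans f', e.trans e', by rw [← DegenerateDiagram.map_map, he, he']⟩ }

/-- The set of all degenerate arrow diagrams. -/
def DegenerateClass (π : Type*) [Group π] := Quotient (degenerateSetoid π)

/-- The class of a degenerate diagram with finitely many points and arrows. -/
def DegenerateDiagram.toClass {π : Type*} [Group π] {P α : Type*} [Finite P] [Finite α]
    (D : DegenerateDiagram π P α) : DegenerateClass π :=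
  Quotient.mk (degenerateSetoid π)
    ⟨(Nat.card P, Nat.card α), D.map (Finite.equivFin P) (Finite.equivFin α)⟩

section

variable {π : Type*} [Group π]

open Classical in
/-- Shrinking to a point the edge from `p` to `next p`, bounded by two different arrows. The point
`p` disappears and `next p` becomes the degenerate point. -/
def Diagram.shrink {α : Type*} (A : ArrowDiagram π α) (p : α × Bool)
    (h : p.1 ≠ (A.circle.next p).1) :
    DegenerateDiagram π ({x : α × Bool | x ≠ p} : Set (α × Bool)) α where
  circle := A.circle.restrict {x | x ≠ p}
  place := fun x =>
    if hx : x = p then ⟨A.circle.next p, fun hp => h (congrArg Prod.fst hp).symm⟩ else ⟨x, hx⟩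
  surj := fun y => ⟨y.1, by simp [show (y : α × Bool) ≠ p from y.2]⟩
  degenerate := by
    have hne : A.circle.next p ≠ p := fun hp => h (congrArg Prod.fst hp).symm
    refine ⟨p, A.circle.next p, h, by simp [hne], ?_⟩
    intro u v huv
    by_cases hu : u = p <;> by_cases hv : v = p
    · exact Or.inl (hu.trans hv.symm)
    · simp only [hu, hv, dite_true, dite_false, Subtype.mk.injEq] at huv
      exact Or.inr (Or.inl ⟨hu, huv.symm⟩)
    · simp only [hu, hv, dite_true, dite_false, Subtype.mk.injEq] at huv
      exact Or.inr (Or.inr ⟨huv, hv⟩)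
    · simp only [hu, hv, dite_false, Subtype.mk.injEq] at huv
      exact Or.inl huv

open Classical in
/-- The map `δ` on the diagram `A` based at the edge from `p` to `next p`. -/
def basedDelta {n : ℕ} (A : ArrowDiagram π (Fin n)) (p : Fin n × Bool) : DegenerateClass π →₀ ℚ :=
  if h : A.IsNice p then Finsupp.single (A.shrink p h.2).toClass ((A.epsilon p : ℤ) : ℚ) else 0

/-- The map `d` on one arrow diagram: the sum of `δ` over all choices of a base edge. The result
does not depend on the representative `Quotient.out c` of the class `c`. -/
def diagramD (c : ArrowClass π) : DegenerateClass π →₀ ℚ :=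
  ∑ p : Fin (Quotient.out c).1 × Bool, basedDelta (Quotient.out c).2 p

/-- The map `d`, extended componentwise to series. A degenerate diagram occurs in `d(A)` for at most
two arrow diagrams `A`, so that the sum is finite. -/
def seriesD (𝒜 : DiagramSeries Unit π) : DegenerateClass π → ℚ :=
  fun D => ∑ᶠ A : ArrowClass π, 𝒜.coeff A * diagramD A D

/-- The triangle relators. There is one for each non monotonic degenerate diagram `D`, that is, one
at whose degenerate point two tails or two heads meet, say of `a` and `b`. The relation says
that `D` is the sum of the two diagrams obtained by moving this end of one of the two arrows to the
other end of the other one. With two tails at `t` and heads at `x` and `y`, this is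
`(t → x, t → y) = (t → x → y) + (t → y → x)`; with two heads at `h` and tails at `x` and `y`, it
is `(x → h, y → h) = (x → y → h) + (y → x → h)`. -/
def triangleRelators (π : Type*) [Group π] : Set (DegenerateClass π →₀ ℚ) :=
  {r | ∃ (m n : ℕ) (D : DegenerateDiagram π (Fin m) (Fin n)) (a b : Fin n) (i : Bool)
    (hab : a ≠ b) (h : D.place (a, i) = D.place (b, i)),
    r = Finsupp.single D.toClass 1 - Finsupp.single (D.slide a b i hab h).toClass 1 -
      Finsupp.single (D.slide b a i hab.symm h.symm).toClass 1}

/-- A formal series of degenerate diagrams is `0` modulo the triangle relations if it is a formal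
(possibly infinite) linear combination of triangle relators. Every degenerate diagram occurs in at
most two of these, so that the sum is finite in each component. -/
def IsZeroModTriangle (𝒟 : DegenerateClass π → ℚ) : Prop :=
  ∃ q : triangleRelators π → ℚ, ∀ D : DegenerateClass π,
    𝒟 D = ∑ᶠ r : triangleRelators π, q r * (r : DegenerateClass π →₀ ℚ) D

end

end

noncomputable section

/-! ### Restrictions of marked circles -/

namespace MarkedCircle

variable {π : Type*} [Group π] {P Q R : Type*}

/-! Write v(A) for ⟨𝒜, A⟩. The three conditions are compared with one family of equations,
`SixTermRelations`. Take three arrows of an arrow diagram A whose six ends bound three edges marked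
by 1, with 0, 1 and 2 heads. For an edge e of this triangle let A_e be A without the arrow opposite
to e, and A'_e the same with the two ends of e exchanged. The equation says that the sum of ε(e)
(v(A_e) − v(A'_e)) over the three edges is 0.

A6T relators: without the arrow x, the sign of G is sign(G) w(x). As w(e)ε(e) is constant on the
triangle, this is ε of the edge opposite to x, up to a sign common to the three arrows. Hence a
relator pairs to ± a six term expression, and every triangle occurs, with suitable writhes
(`isOrthogonalToA6T_iff`).

Triangle relations: the coefficient of a degenerate diagram D in d(𝒜) is ε(e) (v(A) − v(A')), where
A and A' are the two ways to resolve the degenerate point (`seriesD_toClass`). A diagram where two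
tails or two heads meet lies in exactly one triangle relator, so its coefficient determines that of
the relator. What remains is one equation for each monotonic D, which lies in the relators of two
diagrams X and Z: the coefficients of X, Z and D add up to 0 (`isZeroModTriangle_iff`). Inserting an
arrow that closes a triangle with the two arrows meeting in D turns these three coefficients into
the three terms of a six term relation (`sixTermRelations_iff`).

From R₃ invariance to six terms: subdiagrams that miss two of the three arrows do not see the move.
By induction on the number of arrows, the total contribution of the subdiagrams that miss at most
one of the three, and no other arrow, is 0. Reversing the three writhes keeps the site and changes
the sign of the top degree part only, so both homogeneous parts vanish
(`IsR3Invariant.sixTermRelations`).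

Conversely, the six term relations take care of the subdiagrams missing one arrow, and there remains
v(A) = v(A') for the full move. This is where the R₂ condition enters: one arrow of the triangle is
doubled, and two six term relations, one for each copy, leave a relation between four values
(`four_term`). Three such relations give the equality (`value_triangleMove`). -/

theorem exists_period (C : MarkedCircle π P) (x : P) : ∃ m, ∀ y, C.next^[m + 1] y = y := by
  obtain ⟨m, hm⟩ := C.connected (C.next x) x
  refine ⟨m, fun y => ?_⟩
  obtain ⟨k, rfl⟩ := C.connected x y
  rw [← Function.iterate_add_apply, add_comm, Function.iterate_add_apply,
    Function.iterate_succ_apply, hm]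

theorem next_injective (C : MarkedCircle π P) : Function.Injective C.next := by
  intro x y h
  obtain ⟨m, hm⟩ := C.exists_period x
  rw [← hm x, ← hm y, Function.iterate_succ_apply, Function.iterate_succ_apply, h]

theorem pathMark_succ (C : MarkedCircle π P) (x : P) (k : ℕ) :
    C.pathMark x (k + 1) = C.mark x * C.pathMark (C.next x) k := by
  unfold pathMark
  rw [List.range_succ_eq_map]
  simp [List.map_map, Function.comp_def]

/-- `C.Run S x g y` says that `y` is the first point of `S` after `x`, and that `g` is the product of
the markings on the way. -/
inductive Run (C : MarkedCircle π P) (S : Set P) : P → π → P → Prop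
  | last {x : P} : C.next x ∈ S → Run C S x (C.mark x) (C.next x)
  | step {x : P} {g : π} {y : P} : C.next x ∉ S → Run C S (C.next x) g y →
      Run C S x (C.mark x * g) y

namespace Run

variable {C : MarkedCircle π P} {S T : Set P} {x y z : P} {g h : π}

theorem unique (H : C.Run S x g y) (H' : C.Run S x h z) : g = h ∧ y = z := by
  induction H generalizing h z with
  | last h =>
    cases H' with
    | last => exact ⟨rfl, rfl⟩
    | step h' => exact absurd h h'
  | step h _ ih =>
    cases H' with
    | last h' => exact absurd h' h
    | step _ h' =>
      obtain ⟨rfl, rfl⟩ := ih h'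
      exact ⟨rfl, rfl⟩

theorem mono (H : C.Run S x g y) (hTS : T ⊆ S) (hy : y ∈ T) : C.Run T x g y := by
  induction H with
  | last _ => exact .last hy
  | step h _ ih => exact .step (fun hT => h (hTS hT)) (ih hy)

theorem trans (H : C.Run S x g y) (hTS : T ⊆ S) (hy : y ∉ T) (H' : C.Run T y h z) :
    C.Run T x (g * h) z := by
  induction H with
  | last _ => exact .step hy H'
  | step hS _ ih =>
    rw [mul_assoc]
    exact .step (fun hT => hS (hTS hT)) (ih hy H')

theorem of_first (k : ℕ) (hk : C.next^[k + 1] x ∈ S)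
    (hlt : ∀ i < k, C.next^[i + 1] x ∉ S) :
    C.Run S x (C.pathMark x (k + 1)) (C.next^[k + 1] x) := by
  induction k generalizing x with
  | zero =>
    have : C.pathMark x 1 = C.mark x := by simp [pathMark]
    rw [this]
    exact .last hk
  | succ k ih =>
    rw [pathMark_succ, Function.iterate_succ_apply]
    refine .step (hlt 0 (Nat.succ_pos k)) (ih hk fun i hi => ?_)
    have := hlt (i + 1) (by omega)
    rwa [Function.iterate_succ_apply] at this

theorem map {P' : Type*} (e : P ≃ P') (H : C.Run S x g y) :
    (C.map e).Run (e '' S) (e x) g (e y) := by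
  have hn : ∀ x, (C.map e).next (e x) = e (C.next x) := fun x => by simp [MarkedCircle.map]
  have hm : ∀ x, (C.map e).mark (e x) = C.mark x := fun x => by simp [MarkedCircle.map]
  induction H with
  | @last x h =>
    rw [← hm x, ← hn x]
    exact .last (by rw [hn]; exact ⟨_, h, rfl⟩)
  | @step x g y h _ ih =>
    rw [← hm x]
    refine .step ?_ ?_
    · rw [hn]
      rintro ⟨w, hw, hwx⟩
      exact h (e.injective hwx ▸ hw)
    · rw [hn]
      exact ih

end Run

theorem run_holonomy (C : MarkedCircle π P) (x : P) : C.Run {x} x (C.holonomy x) x := by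
  obtain ⟨m, hm⟩ := C.exists_period x
  have hpos : 0 < Function.minimalPeriod C.next x :=
    Function.IsPeriodicPt.minimalPeriod_pos (Nat.succ_pos m) (hm x)
  obtain ⟨p, hp⟩ : ∃ p, Function.minimalPeriod C.next x = p + 1 :=
    ⟨_, (Nat.succ_pred_eq_of_pos hpos).symm⟩
  have hx : C.next^[p + 1] x = x := by
    rw [← hp]
    exact Function.iterate_minimalPeriod
  have := Run.of_first (C := C) (S := {x}) (x := x) p hx fun i hi h => by
    have := Function.IsPeriodicPt.minimalPeriod_le (Nat.succ_pos i) h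
    omega
  rwa [hx, ← hp] at this

open Classical in
/-- The product of all markings, up to conjugacy. -/
def total (C : MarkedCircle π P) : ConjClasses π :=
  if h : IsEmpty P then C.emptyMark h
  else ConjClasses.mk (C.holonomy (Classical.choice (not_isEmpty_iff.mp h)))

theorem total_eq {C : MarkedCircle π P} {x : P} {g : π} (H : C.Run {x} x g x) :
    C.total = ConjClasses.mk g := by
  have : ¬ IsEmpty P := fun h => h.elim x
  rw [total, dif_neg this, ConjClasses.mk_eq_mk_iff_isConj]
  rw [(H.unique (C.run_holonomy x)).1]
  exact C.holonomy_isConj _ _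

/-- `total` makes sense with or without points and equals `emptyMark` when there is none, so
comparing totals avoids a case distinction in the uniqueness arguments. -/
theorem ext_total {C C' : MarkedCircle π P} (hn : ∀ x, C.next x = C'.next x)
    (hm : ∀ x, C.mark x = C'.mark x) (ht : C.total = C'.total) : C = C' := by
  have he : C.emptyMark = C'.emptyMark := by
    funext h
    simpa only [total, dif_pos h] using ht
  cases C
  cases C'
  obtain rfl := funext hn
  obtain rfl := funext hm
  obtain rfl := he
  rfl

/-- `C'` is obtained from `C` by forgetting the points that are not in the range of the injective
map `j`. -/
structure Sub (C' : MarkedCircle π Q) (C : MarkedCircle π P) (j : Q → P) : Prop where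
  injective : Function.Injective j
  run : ∀ q, C.Run (Set.range j) (j q) (C'.mark q) (j (C'.next q))
  total : C'.total = C.total

namespace Sub

variable {C : MarkedCircle π P} {C' : MarkedCircle π Q} {C'' : MarkedCircle π R} {j : Q → P}

theorem run_range (inj : Function.Injective j)
    (hr : ∀ q, C.Run (Set.range j) (j q) (C'.mark q) (j (C'.next q)))
    {T : Set Q} {q q' : Q} {g : π} (H : C'.Run T q g q') : C.Run (j '' T) (j q) g (j q') := by
  have hT : j '' T ⊆ Set.range j := Set.image_subset_range j T
  induction H with
  | last h => exact (hr _).mono hT ⟨_, h, rfl⟩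
  | step h _ ih =>
    refine (hr _).trans hT ?_ ih
    rintro ⟨w, hw, hwx⟩
    exact h (inj hwx ▸ hw)

/-- As soon as one point is left, the totals agree for free: a full turn of `C'` from `q` follows a
full turn of `C` from `j q`. -/
theorem of_run [Nonempty Q] (inj : Function.Injective j)
    (hr : ∀ q, C.Run (Set.range j) (j q) (C'.mark q) (j (C'.next q))) : C'.Sub C j := by
  refine ⟨inj, hr, ?_⟩
  obtain ⟨q⟩ := ‹Nonempty Q›
  have h := C'.run_holonomy q
  rw [total_eq h]
  have h' := run_range inj hr h
  rw [Set.image_singleton] at h'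
  rw [total_eq h']

theorem trans {j' : R → Q} (H' : C''.Sub C' j') (H : C'.Sub C j) : C''.Sub C (j ∘ j') := by
  refine ⟨H.injective.comp H'.injective, fun q => ?_, H'.total.trans H.total⟩
  rw [Set.range_comp]
  exact run_range H.injective H.run (H'.run q)

/-- The tool behind most equalities of diagrams: two circles coincide once both are seen inside a
third one through the same map. It replaces computations with iterates and return times. -/
theorem unique {C₁ C₂ : MarkedCircle π Q} (H₁ : C₁.Sub C j) (H₂ : C₂.Sub C j) : C₁ = C₂ :=
  ext_total (fun q => H₁.injective ((H₁.run q).unique (H₂.run q)).2)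
    (fun q => ((H₁.run q).unique (H₂.run q)).1) (H₁.total.trans H₂.total.symm)

end Sub

theorem sub_restrict (C : MarkedCircle π P) (S : Set P) :
    (C.restrict S).Sub C (Subtype.val : S → P) := by
  have hr : ∀ q : S, C.Run (Set.range (Subtype.val : S → P)) q ((C.restrict S).mark q)
      ((C.restrict S).next q) := by
    intro q
    rw [Subtype.range_coe]
    have h := C.returnTime_spec S q
    obtain ⟨k, hk⟩ : ∃ k, C.returnTime S q = k + 1 := ⟨_, (Nat.succ_pred_eq_of_pos h.1).symm⟩
    show C.Run S q (C.pathMark q (C.returnTime S q)) (C.next^[C.returnTime S q] (q : P))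
    rw [hk] at h ⊢
    refine Run.of_first k h.2 fun i hi hS => ?_
    have := C.returnTime_le S q (i + 1) (Nat.succ_pos i) hS
    omega
  rcases isEmpty_or_nonempty S with hS | hS
  · refine ⟨Subtype.val_injective, hr, ?_⟩
    rw [total, dif_pos hS]
    rfl
  · exact Sub.of_run Subtype.val_injective hr

theorem total_of_isEmpty (C : MarkedCircle π P) (h : IsEmpty P) : C.total = C.emptyMark h :=
  dif_pos h

theorem sub_map (C : MarkedCircle π P) (e : P ≃ Q) : C.Sub (C.map e) e := by
  have hr : ∀ q, (C.map e).Run (Set.range e) (e q) (C.mark q) (e (C.next q)) := by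
    intro q
    have : C.Run Set.univ q (C.mark q) (C.next q) := .last trivial
    simpa using this.map e
  rcases isEmpty_or_nonempty P with h | h
  · refine ⟨e.injective, hr, ?_⟩
    rw [total_of_isEmpty _ h, total_of_isEmpty _ (e.symm.isEmpty)]
    rfl
  · exact Sub.of_run e.injective hr

theorem map_map (C : MarkedCircle π P) (e : P ≃ Q) (f : Q ≃ R) :
    (C.map e).map f = C.map (e.trans f) := rfl

theorem map_refl (C : MarkedCircle π P) : C.map (Equiv.refl P) = C := rfl

theorem sub_map_symm (C : MarkedCircle π P) (e : P ≃ Q) : (C.map e).Sub C e.symm := by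
  have := (C.map e).sub_map e.symm
  rwa [map_map, Equiv.self_trans_symm, map_refl] at this

namespace Sub

variable {C : MarkedCircle π P} {C' : MarkedCircle π Q} {C'' : MarkedCircle π R} {j : Q → P}

/-- The circle obtained from `C` by forgetting points. -/
theorem exists_sub (C : MarkedCircle π P) (hj : Function.Injective j) :
    ∃ C' : MarkedCircle π Q, C'.Sub C j :=
  ⟨_, ((C.restrict (Set.range j)).sub_map_symm (Equiv.ofInjective j hj).symm).trans
    (C.sub_restrict (Set.range j))⟩

theorem cancel {j' : R → Q} (H : C'.Sub C j) (hj' : Function.Injective j')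
    (H' : C''.Sub C (j ∘ j')) : C''.Sub C' j' := by
  obtain ⟨B, hB⟩ := exists_sub C' hj'
  rwa [H'.unique (hB.trans H)]

theorem map_left (H : C'.Sub C j) (e : Q ≃ R) : (C'.map e).Sub C (j ∘ e.symm) :=
  (C'.sub_map_symm e).trans H

theorem map_right (H : C'.Sub C j) (e : P ≃ R) : C'.Sub (C.map e) (e ∘ j) :=
  H.trans (C.sub_map e)

theorem map_both (H : C'.Sub C j) (e : Equiv.Perm Q) (f : Equiv.Perm P)
    (h : ∀ q, f (j q) = j (e q)) : (C'.map e).Sub (C.map f) j := by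
  have h1 := (H.map_left e).map_right f
  convert h1 using 1
  funext q
  simp [h]

end Sub

/-- The points `u` and `v` are consecutive, in one order or the other, and the edge between them is
marked by `1`. -/
def Adj (C : MarkedCircle π P) (u v : P) : Prop :=
  (C.next u = v ∧ C.mark u = 1) ∨ (C.next v = u ∧ C.mark v = 1)

theorem Adj.symm {C : MarkedCircle π P} {u v : P} (h : C.Adj u v) : C.Adj v u := Or.symm h

theorem adj_map {C : MarkedCircle π P} {e : P ≃ Q} {u v : Q} :
    (C.map e).Adj u v ↔ C.Adj (e.symm u) (e.symm v) := by
  simp [Adj, map, Equiv.eq_symm_apply]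

theorem Sub.adj {C : MarkedCircle π P} {C' : MarkedCircle π Q} {j : Q → P} (H : C'.Sub C j)
    {u v : Q} (h : C.Adj (j u) (j v)) : C'.Adj u v := by
  have key : ∀ {u v : Q}, C.next (j u) = j v → C.mark (j u) = 1 → C'.next u = v ∧ C'.mark u = 1 := by
    intro u v h1 h2
    have : C.Run (Set.range j) (j u) (C.mark (j u)) (C.next (j u)) := .last ⟨v, h1.symm⟩
    obtain ⟨h3, h4⟩ := (H.run u).unique this
    rw [h1] at h4
    exact ⟨H.injective h4, h3.trans h2⟩
  rcases h with h | h
  · exact Or.inl (key h.1 h.2)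
  · exact Or.inr (key h.1 h.2)

/-- The edge from `p` to `C.next p` is marked by 1, so sliding the retained point `p` along it, onto
a forgotten point, changes no product. A run that started at `p` now starts at `C.next p`; the
others keep their starting point. -/
theorem Run.shift [DecidableEq P] {C : MarkedCircle π P} {S : Set P} {p : P} (hp : C.mark p = 1)
    (hpS : p ∈ S) (hS : C.next p ∉ S) {x y : P} {g : π} (H : C.Run S x g y) :
    C.Run (Equiv.swap p (C.next p) '' S) (if x = p then C.next p else x) g
      (Equiv.swap p (C.next p) y) := by
  have hT : ∀ w, w ∈ Equiv.swap p (C.next p) '' S ↔ Equiv.swap p (C.next p) w ∈ S := by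
    intro w
    rw [Set.mem_image_equiv]
    simp
  induction H with
  | @last x h =>
    have hx : x ≠ p := by
      rintro rfl
      exact hS h
    rw [if_neg hx]
    by_cases hxp : C.next x = p
    · have h1 : C.Run (Equiv.swap p (C.next p) '' S) p (C.mark p) (C.next p) :=
        .last ((hT _).2 (by simpa using hpS))
      rw [hxp, Equiv.swap_apply_left, ← mul_one (C.mark x), ← hp]
      refine .step (fun h2 => ?_) (by rwa [hxp])
      rw [hT, hxp, Equiv.swap_apply_left] at h2
      exact hS h2
    · have h1 : Equiv.swap p (C.next p) (C.next x) = C.next x :=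
        Equiv.swap_apply_of_ne_of_ne hxp fun h => hx (C.next_injective h)
      rw [h1]
      exact .last ((hT _).2 (by rwa [h1]))
  | @step x g y h _ ih =>
    have hxp : C.next x ≠ p := by
      rintro h'
      exact h (h' ▸ hpS)
    rw [if_neg hxp] at ih
    by_cases hx : x = p
    · rw [if_pos hx, hx, hp, one_mul, ← hx]
      rw [hx] at ih ⊢
      exact ih
    · rw [if_neg hx]
      refine .step (fun h2 => h ?_) ih
      rwa [hT, Equiv.swap_apply_of_ne_of_ne hxp fun h => hx (C.next_injective h)] at h2

/-- One may replace a point by an adjacent one that was forgotten. -/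
theorem Sub.swap [DecidableEq P] {C : MarkedCircle π P} {C' : MarkedCircle π Q} {j : Q → P} (H : C'.Sub C j)
    {u v : P} (huv : C.Adj u v) (h : u ∉ Set.range j ∨ v ∉ Set.range j) :
    C'.Sub C (Equiv.swap u v ∘ j) := by
  have key : ∀ {B : MarkedCircle π Q} {j : Q → P} {p : P}, B.Sub C j → C.mark p = 1 →
      C.next p ∉ Set.range j → B.Sub C (Equiv.swap p (C.next p) ∘ j) := by
    intro B j p H hp hj
    by_cases hpj : p ∈ Set.range j
    · refine ⟨(Equiv.injective _).comp H.injective, fun q => ?_, H.total⟩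
      have := (H.run q).shift hp hpj hj
      rw [Set.range_comp]
      have hq : (Equiv.swap p (C.next p) ∘ j) q = if j q = p then C.next p else j q := by
        by_cases hqp : j q = p
        · simp [hqp]
        · rw [if_neg hqp]
          exact Equiv.swap_apply_of_ne_of_ne hqp fun h => hj ⟨q, h⟩
      rw [hq]
      exact this
    · convert H using 1
      funext q
      exact Equiv.swap_apply_of_ne_of_ne (fun h => hpj ⟨q, h⟩) fun h => hj ⟨q, h⟩
  -- When `p` is the forgotten point, slide back: apply `key` to the circle seen through the
  -- exchanged map. The exchange is an involution, so uniqueness identifies that circle with `B`.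
  have key' : ∀ {B : MarkedCircle π Q} {j : Q → P} {p : P}, B.Sub C j → C.mark p = 1 →
      p ∉ Set.range j → B.Sub C (Equiv.swap p (C.next p) ∘ j) := by
    intro B j p H hp hj
    obtain ⟨B', hB'⟩ := exists_sub C ((Equiv.injective (Equiv.swap p (C.next p))).comp H.injective)
    have h1 := key hB' hp (by
      rintro ⟨q, hq⟩
      exact hj ⟨q, by simpa [Equiv.swap_apply_eq_iff] using hq⟩)
    have h2 : Equiv.swap p (C.next p) ∘ Equiv.swap p (C.next p) ∘ j = j := by
      funext q
      simp
    rw [h2] at h1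
    rwa [H.unique h1]
  rcases huv with ⟨rfl, hm⟩ | ⟨rfl, hm⟩ <;> rcases h with h | h
  · exact key' H hm h
  · exact key H hm h
  · rw [Equiv.swap_comm]
    exact key H hm h
  · rw [Equiv.swap_comm]
    exact key' H hm h

/-- Exchanging the two points in `C` relabels the map `j`, and sliding the retained point along the
edge undoes the relabelling. -/
theorem Sub.of_map_swap [DecidableEq P] {C : MarkedCircle π P} {C' : MarkedCircle π Q} {j : Q → P}
    (H : C'.Sub C j) {u v : P} (huv : C.Adj u v) (h : u ∉ Set.range j ∨ v ∉ Set.range j) :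
    C'.Sub (C.map (Equiv.swap u v)) j := by
  have := (H.swap huv h).map_right (Equiv.swap u v)
  convert this using 1
  funext q
  simp

end MarkedCircle

/-! ### Distances and crossings -/

namespace MarkedCircle

variable {π : Type*} [Group π] {P Q : Type*}

theorem iterate_dist (C : MarkedCircle π P) (x y : P) : C.next^[C.dist x y] x = y :=
  Nat.sInf_mem (s := {k : ℕ | C.next^[k] x = y}) (C.connected x y)

theorem dist_le (C : MarkedCircle π P) {x y : P} {k : ℕ} (h : C.next^[k] x = y) :
    C.dist x y ≤ k :=
  Nat.sInf_le h

theorem dist_injective (C : MarkedCircle π P) (x : P) : Function.Injective (C.dist x) := by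
  intro y z h
  rw [← C.iterate_dist x y, h, C.iterate_dist]

theorem dist_self (C : MarkedCircle π P) (x : P) : C.dist x x = 0 :=
  Nat.le_zero.1 (C.dist_le rfl)

theorem dist_next (C : MarkedCircle π P) {x : P} (h : C.next x ≠ x) : C.dist x (C.next x) = 1 := by
  have h1 := C.dist_le (x := x) (y := C.next x) (k := 1) rfl
  have h2 : C.dist x (C.next x) ≠ 0 := by
    intro h0
    rw [← C.dist_self x] at h0
    exact h (C.dist_injective x h0)
  omega

/-- Distances in terms of the distances from a base point. -/
theorem exists_dist_eq (C : MarkedCircle π P) (o : P) :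
    ∃ N : ℕ, (∀ x, C.dist o x < N) ∧ ∀ x y,
      (C.dist o x ≤ C.dist o y ∧ C.dist x y + C.dist o x = C.dist o y) ∨
        (C.dist o y < C.dist o x ∧ C.dist x y + C.dist o x = C.dist o y + N) := by
  obtain ⟨m, hm⟩ := C.exists_period o
  have hN : 0 < Function.minimalPeriod C.next o :=
    Function.IsPeriodicPt.minimalPeriod_pos (Nat.succ_pos m) (hm o)
  set N := Function.minimalPeriod C.next o with hNdef
  have hper : ∀ k, C.next^[k + N] o = C.next^[k] o := fun k => by
    rw [Function.iterate_add_apply, Function.iterate_minimalPeriod]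
  have hinj : ∀ {k l}, k < N → l < N → C.next^[k] o = C.next^[l] o → k = l := fun hk hl h =>
    Function.iterate_injOn_Iio_minimalPeriod hk hl h
  have hlt : ∀ x, C.dist o x < N := by
    intro x
    have : C.next^[C.dist o x % N] o = x := by
      rw [Function.iterate_mod_minimalPeriod_eq, C.iterate_dist]
    exact (C.dist_le this).trans_lt (Nat.mod_lt _ hN)
  refine ⟨N, hlt, fun x y => ?_⟩
  have hx := C.iterate_dist o x
  have hy := C.iterate_dist o y
  have hd : C.next^[C.dist x y + C.dist o x] o = y := by
    rw [Function.iterate_add_apply, hx, C.iterate_dist]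
  have hxN := hlt x
  have hyN := hlt y
  rcases Nat.lt_or_ge (C.dist o y) (C.dist o x) with h | h
  · refine Or.inr ⟨h, ?_⟩
    have h1 : C.dist x y ≤ C.dist o y + N - C.dist o x := by
      refine C.dist_le ?_
      have h2 : C.next^[C.dist o y + N - C.dist o x] (C.next^[C.dist o x] o) = y := by
        rw [← Function.iterate_add_apply, Nat.sub_add_cancel (by omega), hper, hy]
      rwa [hx] at h2
    rcases Nat.lt_or_ge (C.dist x y + C.dist o x) N with h2 | h2
    · have := hinj h2 hyN (hd.trans hy.symm)
      omega
    · have h3 : C.next^[C.dist x y + C.dist o x - N] o = C.next^[C.dist o y] o := by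
        rw [← hper, Nat.sub_add_cancel h2, hd, hy]
      have := hinj (by omega) hyN h3
      omega
  · refine Or.inl ⟨h, ?_⟩
    have h1 : C.dist x y ≤ C.dist o y - C.dist o x := by
      refine C.dist_le ?_
      have h2 : C.next^[C.dist o y - C.dist o x] (C.next^[C.dist o x] o) = y := by
        rw [← Function.iterate_add_apply, Nat.sub_add_cancel h, hy]
      rwa [hx] at h2
    exact hinj (by omega) hyN (hd.trans hy.symm)

theorem iterate_map (C : MarkedCircle π P) (e : P ≃ Q) (k : ℕ) (x : Q) :
    (C.map e).next^[k] x = e (C.next^[k] (e.symm x)) := by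
  induction k with
  | zero => simp
  | succ k ih => rw [Function.iterate_succ_apply', Function.iterate_succ_apply', ih]; simp [map]

theorem dist_map (C : MarkedCircle π P) (e : P ≃ Q) (x y : Q) :
    (C.map e).dist x y = C.dist (e.symm x) (e.symm y) := by
  simp [dist, iterate_map, ← Equiv.eq_symm_apply]

/-- `C.Avoid z x y` says that `y` is met before `z` on the way that starts at `x`. -/
inductive Avoid (C : MarkedCircle π P) (z : P) : P → P → Prop
  | refl {x : P} : x ≠ z → Avoid C z x x
  | step {x y : P} : x ≠ z → Avoid C z (C.next x) y → Avoid C z x y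

theorem avoid_iff (C : MarkedCircle π P) {x y z : P} :
    C.Avoid z x y ↔ C.dist x y < C.dist x z := by
  have h1 : C.Avoid z x y → ∃ k, C.next^[k] x = y ∧ ∀ i ≤ k, C.next^[i] x ≠ z := by
    intro H
    induction H with
    | refl h => exact ⟨0, rfl, fun i hi => by rwa [Nat.le_zero.1 hi]⟩
    | step h _ ih =>
      obtain ⟨k, hk, hi⟩ := ih
      refine ⟨k + 1, hk, fun i hik => ?_⟩
      cases i with
      | zero => exact h
      | succ i => exact hi i (by omega)
  have h2 : ∀ k x, C.next^[k] x = y → (∀ i ≤ k, C.next^[i] x ≠ z) → C.Avoid z x y := by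
    intro k
    induction k with
    | zero =>
      rintro x rfl h
      exact .refl (h 0 le_rfl)
    | succ k ih =>
      intro x hx h
      exact .step (h 0 (Nat.zero_le _)) (ih _ hx fun i hi => h (i + 1) (by omega))
  constructor
  · intro H
    obtain ⟨k, hk, hi⟩ := h1 H
    by_contra hlt
    have h3 := C.dist_le hk
    exact hi _ (by omega) (C.iterate_dist x z)
  · intro hlt
    refine h2 _ x (C.iterate_dist x y) fun i hi h => ?_
    have := C.dist_le h
    omega

theorem Run.avoid {C : MarkedCircle π P} {S : Set P} {x y z w : P} {g : π} (H : C.Run S x g y)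
    (hz : z ∈ S) (hx : x ≠ z) (h : C.Avoid z y w) : C.Avoid z x w := by
  induction H with
  | last _ => exact .step hx h
  | step hS _ ih => exact .step hx (ih (fun h => hS (h ▸ hz)) h)

/-- Forgetting points changes distances, but not which of two points is met first. This is all that
crossings depend on. -/
theorem Sub.dist_lt_iff {C : MarkedCircle π P} {C' : MarkedCircle π Q} {j : Q → P}
    (H : C'.Sub C j) (x y z : Q) :
    C.dist (j x) (j y) < C.dist (j x) (j z) ↔ C'.dist x y < C'.dist x z := by
  have key : ∀ {x y z : Q}, C'.dist x y < C'.dist x z →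
      C.dist (j x) (j y) < C.dist (j x) (j z) := by
    intro x y z h
    rw [← avoid_iff] at h ⊢
    induction h with
    | refl h => exact .refl (H.injective.ne h)
    | @step x y h _ ih => exact (H.run x).avoid ⟨z, rfl⟩ (H.injective.ne h) ih
  refine ⟨fun h => ?_, key⟩
  -- Distances from a fixed point separate points, so the converse follows from `key` by trichotomy.
  by_contra h1
  rcases (Nat.le_of_not_lt h1).lt_or_eq with h2 | h2
  · exact absurd (key h2) (by omega)
  · rw [C'.dist_injective x h2] at h
    exact lt_irrefl _ h

/-- The chord from `t` to `h` and the chord from `t'` to `h'` cross. -/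
def Cross (C : MarkedCircle π P) (t h t' h' : P) : Prop :=
  Xor (C.dist t t' < C.dist t h) (C.dist t h' < C.dist t h)

theorem Sub.cross {C : MarkedCircle π P} {C' : MarkedCircle π Q} {j : Q → P}
    (H : C'.Sub C j) (t h t' h' : Q) : C.Cross (j t) (j h) (j t') (j h') ↔ C'.Cross t h t' h' := by
  simp only [Cross, H.dist_lt_iff]

variable {C : MarkedCircle π P} {t h t' h' : P}

theorem cross_swap_right : C.Cross t h t' h' ↔ C.Cross t h h' t' := by
  simp only [Cross, xor_comm]

/-- Here and in the next two lemmas, all distances are expressed through those from the single point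
`t`, modulo the length of the circle; a statement about the cyclic order of four points is then
linear arithmetic. -/
theorem cross_swap_left (h1 : t ≠ h) (h2 : t' ≠ h') (h3 : t ≠ t') (h4 : t ≠ h') (h5 : h ≠ t')
    (h6 : h ≠ h') : C.Cross t h t' h' ↔ C.Cross h t t' h' := by
  obtain ⟨N, hN, hd⟩ := C.exists_dist_eq t
  have e1 := hd h t'
  have e2 := hd h h'
  have e3 := hd h t
  have a1 := hN h
  have a2 := hN t'
  have a3 := hN h'
  have b1 := (C.dist_injective t).ne h1
  have b2 := (C.dist_injective t).ne h2
  have b3 := (C.dist_injective t).ne h3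
  have b4 := (C.dist_injective t).ne h4
  have b5 := (C.dist_injective t).ne h5
  have b6 := (C.dist_injective t).ne h6
  rw [C.dist_self] at *
  simp only [Cross, xor_def]
  omega

theorem cross_comm (h1 : t ≠ h) (h2 : t' ≠ h') (h3 : t ≠ t') (h4 : t ≠ h') (h5 : h ≠ t')
    (h6 : h ≠ h') : C.Cross t h t' h' ↔ C.Cross t' h' t h := by
  obtain ⟨N, hN, hd⟩ := C.exists_dist_eq t
  have e1 := hd t' t
  have e2 := hd t' h'
  have e3 := hd t' h
  have a1 := hN h
  have a2 := hN t'
  have a3 := hN h'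
  have b1 := (C.dist_injective t).ne h1
  have b2 := (C.dist_injective t).ne h2
  have b3 := (C.dist_injective t).ne h3
  have b4 := (C.dist_injective t).ne h4
  have b5 := (C.dist_injective t).ne h5
  have b6 := (C.dist_injective t).ne h6
  rw [C.dist_self] at *
  simp only [Cross, xor_def]
  omega

/-- Exchanging two consecutive ends of two chords. -/
theorem cross_exchange (h1 : t ≠ h) (h2 : t' ≠ h') (h3 : t ≠ t') (h4 : t ≠ h') (h5 : h ≠ t')
    (h6 : h ≠ h') (hn : C.next t = t') : C.Cross t' h t h' ↔ ¬ C.Cross t h t' h' := by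
  obtain ⟨N, hN, hd⟩ := C.exists_dist_eq t
  have e1 := hd t' t
  have e2 := hd t' h'
  have e3 := hd t' h
  have e4 : C.dist t t' = 1 := by
    rw [← hn]
    exact C.dist_next (by rw [hn]; exact h3.symm)
  have a1 := hN h
  have a2 := hN t'
  have a3 := hN h'
  have b1 := (C.dist_injective t).ne h1
  have b2 := (C.dist_injective t).ne h2
  have b3 := (C.dist_injective t).ne h3
  have b4 := (C.dist_injective t).ne h4
  have b5 := (C.dist_injective t).ne h5
  have b6 := (C.dist_injective t).ne h6
  rw [C.dist_self] at *
  simp only [Cross, xor_def]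
  omega

theorem cross_exchange_of_adj (h1 : t ≠ h) (h2 : t' ≠ h') (h3 : t ≠ t') (h4 : t ≠ h')
    (h5 : h ≠ t') (h6 : h ≠ h') (hn : C.Adj t t') :
    C.Cross t' h t h' ↔ ¬ C.Cross t h t' h' := by
  rcases hn with hn | hn
  · exact cross_exchange h1 h2 h3 h4 h5 h6 hn.1
  · rw [cross_exchange h5.symm h4 h3.symm h2 h1.symm h6 hn.1, not_not]

end MarkedCircle

/-! ### Subdiagrams and values of series on diagrams -/

theorem MarkedCircle.cross_map {π : Type*} [Group π] {P Q : Type*} {C : MarkedCircle π P}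
    {e : P ≃ Q} {t h t' h' : Q} :
    (C.map e).Cross t h t' h' ↔ C.Cross (e.symm t) (e.symm h) (e.symm t') (e.symm h') := by
  simp only [Cross, dist_map]

namespace Diagram

variable {σ π : Type*} [Group π] {α β γ : Type*}

theorem ext_of {D D' : Diagram σ π α} (h : D.circle = D'.circle)
    (h' : ∀ a, D.deco a = D'.deco a) : D = D' := by
  cases D
  cases D'
  obtain rfl := h
  obtain rfl := funext h'
  rfl

/-- `D'` is the subdiagram of `D` given by the injective map `j` on arrows. -/
structure Sub (D' : Diagram σ π β) (D : Diagram σ π α) (j : β → α) : Prop where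
  circle : D'.circle.Sub D.circle (Prod.map j id)
  deco : ∀ b, D'.deco b = D.deco (j b)

namespace Sub

variable {D : Diagram σ π α} {D' : Diagram σ π β} {D'' : Diagram σ π γ} {j : β → α}

theorem injective (H : D'.Sub D j) : Function.Injective j := fun a b h =>
  congrArg Prod.fst (H.circle.injective (a₁ := (a, true)) (a₂ := (b, true)) (by simp [h]))

theorem trans {j' : γ → β} (H' : D''.Sub D' j') (H : D'.Sub D j) : D''.Sub D (j ∘ j') :=
  ⟨H'.circle.trans H.circle, fun c => (H'.deco c).trans (H.deco _)⟩

theorem unique {D₁ D₂ : Diagram σ π β} (H₁ : D₁.Sub D j) (H₂ : D₂.Sub D j) : D₁ = D₂ :=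
  ext_of (H₁.circle.unique H₂.circle) fun a => (H₁.deco a).trans (H₂.deco a).symm

theorem adj (H : D'.Sub D j) {a b : β} {i k : Bool} (h : D.circle.Adj (j a, i) (j b, k)) :
    D'.circle.Adj (a, i) (b, k) :=
  H.circle.adj h

theorem crosses (H : D'.Sub D j) (a b : β) : D.Crosses (j a) (j b) ↔ D'.Crosses a b :=
  H.circle.cross (a, false) (a, true) (b, false) (b, true)

end Sub

theorem sub_restrict (D : Diagram σ π α) (S : Set α) :
    (D.restrict S).Sub D (Subtype.val : S → α) := by
  refine ⟨?_, fun _ => rfl⟩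
  have := (D.circle.sub_restrict {x : α × Bool | x.1 ∈ S}).map_left
    (Equiv.prodSubtypeFstEquivSubtypeProd (α := α) (β := Bool) (p := (· ∈ S)))
  exact this

theorem sub_map (D : Diagram σ π α) (e : α ≃ β) : D.Sub (D.map e) e :=
  ⟨D.circle.sub_map _, fun a => by simp [map]⟩

theorem sub_map_symm (D : Diagram σ π α) (e : α ≃ β) : (D.map e).Sub D e.symm :=
  ⟨D.circle.sub_map_symm _, fun _ => rfl⟩

/-- Permuting the ends of the arrows. -/
def permute (D : Diagram σ π α) (s : Equiv.Perm (α × Bool)) : Diagram σ π α where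
  circle := D.circle.map s
  deco := D.deco

theorem permute_permute (D : Diagram σ π α) (s t : Equiv.Perm (α × Bool)) :
    (D.permute s).permute t = D.permute (t * s) := rfl

theorem permute_one (D : Diagram σ π α) : D.permute 1 = D := rfl

theorem adj_permute {D : Diagram σ π α} {s : Equiv.Perm (α × Bool)} {u v : α × Bool} :
    (D.permute s).circle.Adj u v ↔ D.circle.Adj (s.symm u) (s.symm v) :=
  MarkedCircle.adj_map

section Swap

open Classical

/-- Exchanging two ends. -/
def flip (D : Diagram σ π α) (u v : α × Bool) : Diagram σ π α := D.permute (Equiv.swap u v)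

theorem flip_comm (D : Diagram σ π α) (u v : α × Bool) : D.flip u v = D.flip v u := by
  rw [flip, flip, Equiv.swap_comm]

theorem flip_flip (D : Diagram σ π α) (u v : α × Bool) : (D.flip u v).flip u v = D := by
  rw [flip, flip, permute_permute, Equiv.swap_mul_self, permute_one]

theorem forget_flip (D : Diagram σ π α) (u v : α × Bool) :
    (D.flip u v).forget = D.forget.flip u v := rfl

theorem adj_flip {D : Diagram σ π α} {x y u v : α × Bool} :
    (D.flip x y).circle.Adj u v ↔ D.circle.Adj (Equiv.swap x y u) (Equiv.swap x y v) :=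
  adj_permute

theorem adj_flip_of_ne {D : Diagram σ π α} {x y u v : α × Bool} (h : D.circle.Adj u v)
    (h1 : u ≠ x) (h2 : u ≠ y) (h3 : v ≠ x) (h4 : v ≠ y) : (D.flip x y).circle.Adj u v := by
  rwa [adj_flip, Equiv.swap_apply_of_ne_of_ne h1 h2, Equiv.swap_apply_of_ne_of_ne h3 h4]

theorem adj_flip_left {D : Diagram σ π α} {u v w : α × Bool} (h1 : w ≠ u) (h2 : w ≠ v) :
    (D.flip u v).circle.Adj u w ↔ D.circle.Adj v w := by
  rw [adj_flip, Equiv.swap_apply_left, Equiv.swap_apply_of_ne_of_ne h1 h2]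

theorem adj_flip_right {D : Diagram σ π α} {u v w : α × Bool} (h1 : w ≠ u) (h2 : w ≠ v) :
    (D.flip u v).circle.Adj v w ↔ D.circle.Adj u w := by
  rw [adj_flip, Equiv.swap_apply_right, Equiv.swap_apply_of_ne_of_ne h1 h2]

theorem adj_flip_self {D : Diagram σ π α} {u v : α × Bool} (h : D.circle.Adj u v) :
    (D.flip u v).circle.Adj u v := by
  rw [adj_flip, Equiv.swap_apply_left, Equiv.swap_apply_right]
  exact h.symm

/-- Exchanging two adjacent ends does not affect the subdiagrams that do not contain both. -/
theorem Sub.flip_of_not_mem {D : Diagram σ π α} {D' : Diagram σ π β} {j : β → α}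
    (H : D'.Sub D j) {u v : α × Bool} (huv : D.circle.Adj u v)
    (h : u.1 ∉ Set.range j ∨ v.1 ∉ Set.range j) : D'.Sub (D.flip u v) j := by
  have key : ∀ u : α × Bool, u.1 ∉ Set.range j → u ∉ Set.range (Prod.map j (id : Bool → Bool)) := by
    rintro _ hu ⟨w, rfl⟩
    exact hu ⟨w.1, rfl⟩
  exact ⟨H.circle.of_map_swap huv (h.imp (key u) (key v)), H.deco⟩

theorem Sub.flip {D : Diagram σ π α} {D' : Diagram σ π β} {j : β → α} (H : D'.Sub D j)
    (u v : β × Bool) : (D'.flip u v).Sub (D.flip (Prod.map j id u) (Prod.map j id v)) j :=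
  ⟨H.circle.map_both _ _ fun _ => (H.circle.injective.map_swap _ _ _).symm, H.deco⟩

theorem restrict_flip_of_not_mem {D : Diagram σ π α} {S : Set α} {u v : α × Bool}
    (huv : D.circle.Adj u v) (h : u.1 ∉ S ∨ v.1 ∉ S) : (D.flip u v).restrict S = D.restrict S :=
  ((D.flip u v).sub_restrict S).unique
    ((D.sub_restrict S).flip_of_not_mem huv (by rwa [Subtype.range_coe]))

/-- Without decorations an arrow is just its pair of ends, so renaming two arrows amounts to
exchanging their tails and their heads. -/
theorem map_swap_eq [inst : DecidableEq α] {D : Diagram Unit π α} (a b : α) :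
    D.map (Equiv.swap a b) = (D.flip (a, false) (b, false)).flip (a, true) (b, true) := by
  obtain rfl : inst = fun a b => Classical.propDecidable (a = b) := Subsingleton.elim _ _
  suffices h : (Equiv.swap a b).prodCongr (Equiv.refl Bool) =
      (Equiv.swap (a, false) (b, false)).trans (Equiv.swap (a, true) (b, true)) from
    ext_of (congrArg D.circle.map h) fun _ => rfl
  ext ⟨x, i⟩ : 1
  simp only [Equiv.prodCongr_apply, Prod.map_apply, Equiv.refl_apply, Equiv.trans_apply]
  by_cases h1 : x = a
  · subst h1
    by_cases h2 : x = b
    · subst h2; simp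
    · cases i
      · simp [Equiv.swap_apply_def]
      · simp [Equiv.swap_apply_def]
  · by_cases h2 : x = b
    · subst h2
      cases i
      · simp [Equiv.swap_apply_def]
      · simp [Equiv.swap_apply_def]
    · simp [Equiv.swap_apply_def, h1, h2]

theorem crosses_comm (D : Diagram σ π α) {a b : α} (h : a ≠ b) : D.Crosses a b ↔ D.Crosses b a :=
  MarkedCircle.cross_comm (by simp) (by simp) (by simp [h]) (by simp [h]) (by simp [h])
    (by simp [h])

/-- Whether `a` and `b` cross is visible in the subdiagram on these two arrows, and this one does
not contain both ends that are exchanged. -/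
theorem crosses_flip_of_ne {D : Diagram σ π α} {u v : α × Bool} (huv : D.circle.Adj u v) {a b : α}
    (h : (u.1 ≠ a ∧ u.1 ≠ b) ∨ (v.1 ≠ a ∧ v.1 ≠ b)) :
    (D.flip u v).Crosses a b ↔ D.Crosses a b := by
  have h1 := (D.sub_restrict {a, b}).crosses ⟨a, by simp⟩ ⟨b, by simp⟩
  have h2 := ((D.flip u v).sub_restrict {a, b}).crosses ⟨a, by simp⟩ ⟨b, by simp⟩
  rw [restrict_flip_of_not_mem huv (by simpa using h)] at h2
  exact h2.trans h1.symm

theorem crosses_flip {D : Diagram σ π α} {u v : α × Bool} (huv : D.circle.Adj u v)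
    (h : u.1 ≠ v.1) : (D.flip u v).Crosses u.1 v.1 ↔ ¬ D.Crosses u.1 v.1 := by
  have key : ∀ (a b : α) (i k : Bool), a ≠ b → D.circle.Adj (a, i) (b, k) →
      (D.circle.Cross (b, k) (a, !i) (a, i) (b, !k) ↔
        ¬ D.circle.Cross (a, i) (a, !i) (b, k) (b, !k)) := fun a b i k hab hadj =>
    MarkedCircle.cross_exchange_of_adj (by simp) (by simp) (by simp [hab]) (by simp [hab])
      (by simp [hab]) (by simp [hab]) hadj
  -- Crossing does not depend on the directions of the arrows, so each chord may be started at the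
  -- end that is exchanged.
  have norm : ∀ (E : Diagram σ π α) (a b : α) (i k : Bool), a ≠ b →
      (E.Crosses a b ↔ E.circle.Cross (a, i) (a, !i) (b, k) (b, !k)) := by
    intro E a b i k hab
    have hsw : ∀ k', E.circle.Cross (a, k') (a, !k') (b, false) (b, true) ↔
        E.circle.Cross (a, k') (a, !k') (b, k) (b, !k) := by
      intro k'
      cases k
      · rfl
      · exact MarkedCircle.cross_swap_right
    rw [← hsw]
    cases i
    · rfl
    · exact MarkedCircle.cross_swap_left (by simp) (by simp) (by simp [hab]) (by simp [hab])
        (by simp [hab]) (by simp [hab])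
  obtain ⟨a, i⟩ := u
  obtain ⟨b, k⟩ := v
  have hab : a ≠ b := h
  rw [norm _ a b i k hab, norm D a b i k hab, ← key a b i k hab huv]
  show (D.circle.map _).Cross _ _ _ _ ↔ _
  rw [MarkedCircle.cross_map, Equiv.symm_swap, Equiv.swap_apply_left, Equiv.swap_apply_right,
    Equiv.swap_apply_of_ne_of_ne (by simp) (by simp [hab]),
    Equiv.swap_apply_of_ne_of_ne (by simp [hab.symm]) (by simp)]

/-- The sign `ε` of an edge in terms of the two ends `u` and `v`. -/
def edgeSign (D : Diagram σ π α) (u v : α × Bool) : ℤ :=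
  (if D.Crosses u.1 v.1 then 1 else -1) * (-1) ^ (u.2.toNat + v.2.toNat)

theorem epsilon_eq (D : Diagram σ π α) (p : α × Bool) :
    D.epsilon p = D.edgeSign p (D.circle.next p) := rfl

theorem edgeSign_comm (D : Diagram σ π α) {u v : α × Bool} (h : u.1 ≠ v.1) :
    D.edgeSign u v = D.edgeSign v u := by
  simp only [edgeSign, D.crosses_comm h, add_comm]

theorem edgeSign_flip {D : Diagram σ π α} {u v : α × Bool} (huv : D.circle.Adj u v)
    (h : u.1 ≠ v.1) : (D.flip u v).edgeSign u v = -D.edgeSign u v := by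
  by_cases hc : D.Crosses u.1 v.1 <;> simp [edgeSign, crosses_flip huv h, hc]

theorem edgeSign_flip_of_ne {D : Diagram σ π α} {x y u v : α × Bool} (hxy : D.circle.Adj x y)
    (h : (x.1 ≠ u.1 ∧ x.1 ≠ v.1) ∨ (y.1 ≠ u.1 ∧ y.1 ≠ v.1)) :
    (D.flip x y).edgeSign u v = D.edgeSign u v := by
  simp only [edgeSign, crosses_flip_of_ne hxy h]

theorem Sub.edgeSign {D : Diagram σ π α} {D' : Diagram σ π β} {j : β → α} (H : D'.Sub D j)
    (a b : β) (i k : Bool) : D.edgeSign (j a, i) (j b, k) = D'.edgeSign (a, i) (b, k) := by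
  simp only [Diagram.edgeSign, H.crosses]

theorem edgeSign_eq_or (D : Diagram σ π α) (u v : α × Bool) :
    D.edgeSign u v = 1 ∨ D.edgeSign u v = -1 := by
  rw [edgeSign]
  rcases neg_one_pow_eq_or ℤ (u.2.toNat + v.2.toNat) with h | h <;> rw [h] <;> split_ifs <;> simp

end Swap

theorem toClass_eq_iff [Finite α] [Finite β] {D : Diagram σ π α} {D' : Diagram σ π β} :
    D.toClass = D'.toClass ↔ ∃ e : α ≃ β, D.map e = D' := by
  refine Quotient.eq.trans ?_
  constructor
  · rintro ⟨e, he⟩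
    refine ⟨(Finite.equivFin α).trans (e.trans (Finite.equivFin β).symm), ?_⟩
    rw [← map_map, ← map_map, he, map_map, Equiv.self_trans_symm, map_refl]
  · rintro ⟨e, rfl⟩
    refine ⟨(Finite.equivFin α).symm.trans (e.trans (Finite.equivFin β)), ?_⟩
    rw [map_map, map_map]
    congr 1
    ext x
    simp

theorem toClass_map [Finite α] [Finite β] (D : Diagram σ π α) (e : α ≃ β) :
    (D.map e).toClass = D.toClass :=
  (toClass_eq_iff.2 ⟨e, rfl⟩).symm

theorem toClass_forget [Finite α] (D : Diagram σ π α) : D.toClass.forget = D.forget.toClass := rfl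

theorem sign_toClass [Fintype α] (D : GaussDiagram π α) :
    GaussClass.sign D.toClass = ∏ a, D.deco a :=
  Equiv.prod_comp (Finite.equivFin α).symm D.deco

end Diagram

theorem DiagramClass.autCard_ne_zero {σ π : Type*} [Group π] (c : DiagramClass σ π) :
    c.autCard ≠ 0 := by
  induction c using Quotient.inductionOn with
  | _ D =>
    have : Nonempty {e : Equiv.Perm (Fin D.1) // D.2.map e = D.2} := ⟨⟨Equiv.refl _, rfl⟩⟩
    exact Nat.card_pos.ne'

namespace DiagramSeries

variable {σ π : Type*} [Group π] {α β γ : Type*}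

/-- The pairing of a series with one diagram. -/
def value (𝒮 : DiagramSeries σ π) [Finite α] (D : Diagram σ π α) : ℚ :=
  𝒮.pairing (Finsupp.single D.toClass 1)

theorem pairing_single (𝒮 : DiagramSeries σ π) (c : DiagramClass σ π) (q : ℚ) :
    𝒮.pairing (Finsupp.single c q) = c.autCard * 𝒮.coeff c * q :=
  Finsupp.sum_single_index (by simp)

theorem pairing_add (𝒮 : DiagramSeries σ π) (x y : DiagramClass σ π →₀ ℚ) :
    𝒮.pairing (x + y) = 𝒮.pairing x + 𝒮.pairing y :=
  Finsupp.sum_add_index' (by simp) (by intros; ring)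

theorem pairing_smul (𝒮 : DiagramSeries σ π) (q : ℚ) (x : DiagramClass σ π →₀ ℚ) :
    𝒮.pairing (q • x) = q * 𝒮.pairing x := by
  rw [pairing, Finsupp.sum_smul_index' (by simp), pairing, Finsupp.sum, Finsupp.sum,
    Finset.mul_sum]
  exact Finset.sum_congr rfl fun c _ => by rw [smul_eq_mul]; ring

/-- The pairing as a linear form. -/
def pairingLinear (𝒮 : DiagramSeries σ π) : (DiagramClass σ π →₀ ℚ) →ₗ[ℚ] ℚ where
  toFun := 𝒮.pairing
  map_add' := 𝒮.pairing_add
  map_smul' := 𝒮.pairing_smul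

theorem value_eq (𝒮 : DiagramSeries σ π) [Finite α] (D : Diagram σ π α) :
    𝒮.value D = D.toClass.autCard * 𝒮.coeff D.toClass := by
  rw [value, pairing_single, mul_one]

theorem value_map (𝒮 : DiagramSeries σ π) [Finite α] [Finite β] (D : Diagram σ π α) (e : α ≃ β) :
    𝒮.value (D.map e) = 𝒮.value D := by
  rw [value, value, D.toClass_map]

/-- Both are the subdiagram of `D` on the same set of arrows, so they agree after renaming, and
values do not depend on names. -/
theorem value_eq_of_sub (𝒮 : DiagramSeries σ π) [Finite β] [Finite γ] {D : Diagram σ π α}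
    {D₁ : Diagram σ π β} {D₂ : Diagram σ π γ} {j₁ : β → α} {j₂ : γ → α} (H₁ : D₁.Sub D j₁)
    (H₂ : D₂.Sub D j₂) (h : Set.range j₁ = Set.range j₂) : 𝒮.value D₁ = 𝒮.value D₂ := by
  set e : β ≃ γ := (Equiv.ofInjective j₁ H₁.injective).trans
    ((Equiv.setCongr h).trans (Equiv.ofInjective j₂ H₂.injective).symm) with he
  have hj : j₁ ∘ e.symm = j₂ := by
    funext c
    have : (Equiv.ofInjective j₁ H₁.injective (e.symm c) : α) = j₂ c := by simp [he]
    exact this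
  have h1 := (D₁.sub_map_symm e).trans H₁
  rw [hj] at h1
  rw [← 𝒮.value_map D₁ e, h1.unique H₂]

theorem value_restrict (𝒮 : DiagramSeries σ π) [Finite α] [Finite β] {D : Diagram σ π α}
    {D' : Diagram σ π β} {j : β → α} (H : D'.Sub D j) {S : Set α} (h : Set.range j = S) :
    𝒮.value (D.restrict S) = 𝒮.value D' :=
  𝒮.value_eq_of_sub (D.sub_restrict S) H (by rw [h, Subtype.range_coe])

/-- The quotient |Aut A| / |Aut G| in the definition of S trades the |Aut G| of the pairing of Gauss
diagrams for the |Aut A| of the pairing of arrow diagrams. -/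
theorem value_gaussSeries (𝒜 : DiagramSeries Unit π) [Fintype α] (G : GaussDiagram π α) :
    (gaussSeries 𝒜).value G = ((∏ a, G.deco a : ℤˣ) : ℤ) * 𝒜.value G.forget := by
  have h : (G.toClass.autCard : ℚ) ≠ 0 := Nat.cast_ne_zero.2 G.toClass.autCard_ne_zero
  rw [value_eq, value_eq, ← G.sign_toClass, ← G.toClass_forget]
  show _ * (_ * (_ / _) * _) = _
  field_simp

end DiagramSeries

/-! ### Splitting points and inserting arrows -/

namespace MarkedCircle

variable {π : Type*} [Group π] {P P' : Type*}

/-- Suppose that `pl` identifies two adjacent points `x` and `y` of `C'`. If `C` is the restriction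
of `C'` to one set of representatives, then also to any other. -/
theorem Sub.of_section {C : MarkedCircle π P} {C' : MarkedCircle π P'} {pl : P' → P} {x y : P'}
    (huniq : ∀ u v, pl u = pl v → u = v ∨ (u = x ∧ v = y) ∨ (u = y ∧ v = x)) (hadj : C'.Adj x y)
    {s t : P → P'} (H : C.Sub C' s) (hs : ∀ q, pl (s q) = q) (ht : ∀ q, pl (t q) = q) :
    C.Sub C' t := by
  classical
  have hst := fun q => huniq (s q) (t q) ((hs q).trans (ht q).symm)
  by_cases h : ∀ q, s q = t q
  · rwa [← funext h]
  push Not at h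
  obtain ⟨q₀, hq₀⟩ := h
  have hmiss : t q₀ ∉ Set.range s := by
    rintro ⟨q, hq⟩
    have : q = q₀ := by rw [← hs q, hq, ht]
    exact hq₀ (this ▸ hq)
  have hpair : (s q₀ = x ∧ t q₀ = y) ∨ (s q₀ = y ∧ t q₀ = x) := (hst q₀).resolve_left hq₀
  have hadj' : C'.Adj (s q₀) (t q₀) := by
    rcases hpair with ⟨h1, h2⟩ | ⟨h1, h2⟩ <;> rw [h1, h2]
    exacts [hadj, hadj.symm]
  convert H.swap hadj' (Or.inr hmiss) using 1
  funext q
  by_cases hq : q = q₀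
  · simp [hq]
  · have h1 : s q ≠ s q₀ := fun h => hq (H.injective h)
    have h2 : s q ≠ t q₀ := fun h => hmiss ⟨q, h⟩
    rw [Function.comp_apply, Equiv.swap_apply_of_ne_of_ne h1 h2]
    rcases hst q with h | h | h
    · exact h.symm
    all_goals
      exfalso
      rcases hpair with h3 | h3
      · first | exact h1 (h.1.trans h3.1.symm) | exact h2 (h.1.trans h3.2.symm)
      · first | exact h1 (h.1.trans h3.1.symm) | exact h2 (h.1.trans h3.2.symm)

/-- A point of a circle can be split into two points `x` and `y`, in this order, with the edge in
between marked by `1`. -/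
theorem exists_split (C : MarkedCircle π P) (pl : P' → P) (hpl : Function.Surjective pl) {x y : P'}
    (hne : x ≠ y) (hxy : pl x = pl y)
    (huniq : ∀ u v, pl u = pl v → u = v ∨ (u = x ∧ v = y) ∨ (u = y ∧ v = x)) :
    ∃ C' : MarkedCircle π P', C'.next x = y ∧ C'.mark x = 1 ∧
      (∀ u v, u ≠ x → v ≠ y → C.next (pl u) = pl v → C'.next u = v) ∧
      (∀ u, u ≠ x → C'.mark u = C.mark (pl u)) ∧
      ∀ s : P → P', (∀ q, pl (s q) = q) → C.Sub C' s := by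
  classical
  -- The section `r` avoids `y`: an edge that ended at the split point has to end at `x`, the first
  -- of the two new points, and `y` is reached only from `x`.
  have hex : ∀ p, ∃ u, pl u = p ∧ u ≠ y := by
    intro p
    obtain ⟨u, rfl⟩ := hpl p
    by_cases hu : u = y
    · exact ⟨x, by rw [hu, hxy], hne⟩
    · exact ⟨u, rfl, hu⟩
  choose r hr hry using hex
  have hrpl : ∀ u, u ≠ y → r (pl u) = u := by
    intro u hu
    rcases huniq (r (pl u)) u (hr _) with h | h | h
    · exact h
    · exact absurd h.2 hu
    · exact absurd h.1 (hry _)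
  set nx : P' → P' := fun u => if u = x then y else r (C.next (pl u)) with hnx
  have h0 : ∀ u, ∃ k', nx^[k'] u = r (C.next (pl u)) := by
    intro u
    by_cases hu : u = x
    · refine ⟨2, ?_⟩
      rw [Function.iterate_succ_apply, Function.iterate_one]
      simp [hnx, hu, hne.symm, hxy]
    · exact ⟨1, by simp [hnx, hu]⟩
  have h1 : ∀ k u, ∃ k', nx^[k'] u = r (C.next^[k + 1] (pl u)) := by
    intro k
    induction k with
    | zero => exact h0
    | succ k ih =>
      intro u
      obtain ⟨k₁, hk₁⟩ := ih u
      obtain ⟨k₂, hk₂⟩ := h0 (nx^[k₁] u)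
      refine ⟨k₂ + k₁, ?_⟩
      rw [Function.iterate_add_apply, hk₂, hk₁, hr, ← Function.iterate_succ_apply' C.next]
  have hconn : ∀ u v, ∃ k, nx^[k] u = v := by
    intro u v
    obtain ⟨k, hk⟩ := C.connected (C.next (pl u)) (pl v)
    obtain ⟨k', hk'⟩ := h1 k u
    rw [Function.iterate_succ_apply, hk] at hk'
    by_cases hv : v = y
    · refine ⟨k' + 1, ?_⟩
      rw [Function.iterate_succ_apply', hk', hv, ← hxy, hrpl x hne]
      simp [hnx]
    · exact ⟨k', by rw [hk', hrpl v hv]⟩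
  let C' : MarkedCircle π P' :=
    { next := nx
      connected := hconn
      mark := fun u => if u = x then 1 else C.mark (pl u)
      emptyMark := fun h => (h.false x).elim }
  have hnext : ∀ u, u ≠ x → C'.next u = r (C.next (pl u)) := fun u hu => if_neg hu
  have hmark : ∀ u, u ≠ x → C'.mark u = C.mark (pl u) := fun u hu => if_neg hu
  have hx : C'.next x = y := if_pos rfl
  have hmx : C'.mark x = 1 := if_pos rfl
  have hsub : C.Sub C' r := by
    have : Nonempty P := ⟨pl x⟩
    refine Sub.of_run (fun p q h => by rw [← hr p, h, hr]) fun q => ?_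
    by_cases hq : r q = x
    · have hyr : y ∉ Set.range r := fun ⟨q, hq⟩ => hry q hq
      have hqx : q = pl y := by rw [← hxy, ← hq, hr]
      have h2 : C'.Run (Set.range r) y (C'.mark y) (C'.next y) := by
        refine .last ?_
        rw [hnext y hne.symm]
        exact ⟨_, rfl⟩
      have h3 : C'.Run (Set.range r) x (C'.mark x * C'.mark y) (C'.next y) :=
        .step (by rwa [hx]) (by rwa [hx])
      rwa [hmx, one_mul, hnext y hne.symm, hmark y hne.symm, ← hqx, ← hq] at h3
    · have h2 : C'.Run (Set.range r) (r q) (C'.mark (r q)) (C'.next (r q)) := by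
        refine .last ?_
        rw [hnext _ hq]
        exact ⟨_, rfl⟩
      rwa [hnext _ hq, hmark _ hq, hr] at h2
  refine ⟨C', hx, hmx, fun u v hu hv huv => ?_, hmark, fun s hs => ?_⟩
  · rw [hnext u hu, huv, hrpl v hv]
  · exact hsub.of_section huniq (Or.inl ⟨hx, hmx⟩) hr hs

/-- A new point can be inserted next to a given one. -/
theorem exists_insert (C : MarkedCircle π P) (p w : P) :
    ∃ C' : MarkedCircle π (Option P), C.Sub C' some ∧ C'.Adj (some p) none ∧
      (C.Adj p w → C'.Adj none (some w)) ∧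
      ∀ u v, u ≠ p → v ≠ p → C.Adj u v → C'.Adj (some u) (some v) := by
  set pl : Option P → P := fun u => u.getD p with hpl
  have hs : Function.Surjective pl := fun q => ⟨some q, rfl⟩
  have huniq : ∀ u v, pl u = pl v → u = v ∨ (u = some p ∧ v = none) ∨ (u = none ∧ v = some p) := by
    rintro (_ | u) (_ | v) h <;> simp_all [eq_comm]
  -- The new point must lie between `p` and `w`: it is put before `p` if `w` precedes `p` along an
  -- edge marked by 1, and after `p` otherwise.
  by_cases hw : C.next w = p ∧ C.mark w = 1
  · obtain ⟨C', h1, h2, h3, h4, h5⟩ := C.exists_split pl hs (x := none) (y := some p) (by simp) rfl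
      fun u v h => (huniq u v h).imp_right Or.symm
    refine ⟨C', h5 some fun _ => rfl, Or.inr ⟨h1, h2⟩, fun _ => Or.inr ⟨?_, ?_⟩, ?_⟩
    · exact h3 _ _ (by simp) (by simp) hw.1
    · rw [h4 _ (by simp)]
      exact hw.2
    · intro u v hu hv h
      refine h.imp (fun h => ⟨?_, ?_⟩) (fun h => ⟨?_, ?_⟩)
      · exact h3 _ _ (by simp) (by simpa using hv) h.1
      · rw [h4 _ (by simp)]
        exact h.2
      · exact h3 _ _ (by simp) (by simpa using hu) h.1
      · rw [h4 _ (by simp)]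
        exact h.2
  · obtain ⟨C', h1, h2, h3, h4, h5⟩ := C.exists_split pl hs (x := some p) (y := none) (by simp) rfl
      huniq
    refine ⟨C', h5 some fun _ => rfl, Or.inl ⟨h1, h2⟩, fun h => Or.inl ⟨?_, ?_⟩, ?_⟩
    · rcases h with h | h
      · exact h3 _ _ (by simp) (by simp) h.1
      · exact absurd h hw
    · rw [h4 _ (by simp)]
      rcases h with h | h
      · exact h.2
      · exact absurd h hw
    · intro u v hu hv h
      refine h.imp (fun h => ⟨?_, ?_⟩) (fun h => ⟨?_, ?_⟩)
      · exact h3 _ _ (by simpa using hu) (by simp) h.1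
      · rw [h4 _ (by simpa using hu)]
        exact h.2
      · exact h3 _ _ (by simpa using hv) (by simp) h.1
      · rw [h4 _ (by simpa using hv)]
        exact h.2

end MarkedCircle

/-- The ends of the arrows, when an arrow `none` is added. -/
def optionEnds (α : Type*) (β : Bool) : Option (Option (α × Bool)) ≃ Option α × Bool where
  toFun
    | none => (none, !β)
    | some none => (none, β)
    | some (some x) => (some x.1, x.2)
  invFun
    | (none, i) => if i = β then some none else none
    | (some x, i) => some (some (x, i))
  left_inv := by rintro (_ | _ | x) <;> simp
  right_inv := by
    rintro ⟨_ | x, i⟩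
    · by_cases h : i = β
      · simp [h]
      · simp [h, ← Bool.eq_not.2 h]
    · simp

/-- A new arrow can be inserted with ends next to two given points. -/
theorem ArrowDiagram.exists_insert {π α : Type*} [Group π] (A : ArrowDiagram π α) (β : Bool)
    (p q w z : α × Bool) (hpq : p ≠ q) (hw : w ≠ q) (hz : z ≠ p) :
    ∃ E : ArrowDiagram π (Option α), Diagram.Sub A E some ∧
      E.circle.Adj (some p.1, p.2) (none, β) ∧ E.circle.Adj (some q.1, q.2) (none, !β) ∧
      (A.circle.Adj p w → E.circle.Adj (none, β) (some w.1, w.2)) ∧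
      (A.circle.Adj q z → E.circle.Adj (none, !β) (some z.1, z.2)) ∧
      ∀ u v : α × Bool, u ≠ p → u ≠ q → v ≠ p → v ≠ q → A.circle.Adj u v →
        E.circle.Adj (some u.1, u.2) (some v.1, v.2) := by
  obtain ⟨C₁, s1, a1, b1, c1⟩ := A.circle.exists_insert p w
  obtain ⟨C₂, s2, a2, b2, c2⟩ := C₁.exists_insert (some q) (some z)
  have key : ∀ u v, C₂.Adj u v →
      (C₂.map (optionEnds α β)).Adj (optionEnds α β u) (optionEnds α β v) := by
    intro u v h
    rw [MarkedCircle.adj_map]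
    simpa using h
  refine ⟨⟨C₂.map (optionEnds α β), fun _ => ()⟩, ⟨?_, fun _ => rfl⟩, ?_, ?_, ?_, ?_, ?_⟩
  · exact (s1.trans s2).map_right (optionEnds α β)
  · exact key _ _ (c2 _ _ (by simpa using hpq) (by simp) a1)
  · exact key _ _ a2
  · exact fun h => key _ _ (c2 _ _ (by simp) (by simpa using hw) (b1 h))
  · exact fun h => key _ _ (b2 (c1 _ _ hpq.symm hz h))
  · exact fun u v h1 h2 h3 h4 h => key _ _ (c2 _ _ (by simpa using h2) (by simpa using h4)
      (c1 _ _ h1 h3 h))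

/-! ### Triangles and the six term relation -/

namespace Diagram

variable {σ π : Type*} [Group π] {α β : Type*}

/-- Three arrows `a`, `b`, `c` whose six ends form three edges marked by `1`, each edge being bounded by
a different pair of arrows. -/
structure Triangle (D : Diagram σ π α) (a b c : α) (i j k : Bool) : Prop where
  ne_ab : a ≠ b
  ne_bc : b ≠ c
  ne_ca : c ≠ a
  adj_bc : D.circle.Adj (b, !k) (c, !j)
  adj_ca : D.circle.Adj (c, j) (a, i)
  adj_ab : D.circle.Adj (a, !i) (b, k)

/-- `i` is the type of the end of `a` next to `c`, `j` that of the end of `c` next to `a`, and `k`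
that of the end of `b` next to `a`. After rotation these roles are played by the end of `b` next to
`a`, the end of `a` next to `b`, and the end of `c` next to `b`. -/
theorem Triangle.rotate {D : Diagram σ π α} {a b c : α} {i j k : Bool}
    (h : D.Triangle a b c i j k) : D.Triangle b c a k (!i) (!j) :=
  ⟨h.ne_bc, h.ne_ca, h.ne_ab, by simpa using h.adj_ca, h.adj_ab, by simpa using h.adj_bc⟩

theorem Triangle.forget {D : Diagram σ π α} {a b c : α} {i j k : Bool}
    (h : D.Triangle a b c i j k) : D.forget.Triangle a b c i j k :=
  ⟨h.ne_ab, h.ne_bc, h.ne_ca, h.adj_bc, h.adj_ca, h.adj_ab⟩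

theorem Sub.triangle {D : Diagram σ π α} {D' : Diagram σ π β} {f : β → α} (H : D'.Sub D f)
    {a b c : β} {i j k : Bool} (h : D.Triangle (f a) (f b) (f c) i j k) :
    D'.Triangle a b c i j k :=
  ⟨fun e => h.ne_ab (congrArg f e), fun e => h.ne_bc (congrArg f e),
    fun e => h.ne_ca (congrArg f e), H.adj h.adj_bc, H.adj h.adj_ca, H.adj h.adj_ab⟩

/-- The numbers of arrowheads at the three edges of a triangle are pairwise different. -/
def DistinctHeads (i j k : Bool) : Prop :=
  (!k).toNat + (!j).toNat ≠ j.toNat + i.toNat ∧ j.toNat + i.toNat ≠ (!i).toNat + k.toNat ∧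
    (!i).toNat + k.toNat ≠ (!k).toNat + (!j).toNat

theorem DistinctHeads.rotate {i j k : Bool} (h : DistinctHeads i j k) :
    DistinctHeads k (!i) (!j) := by
  revert h
  unfold DistinctHeads
  revert i j k
  decide

/-- Exchanging the two ends of each of the three edges of a triangle. -/
def triangleMove (D : Diagram σ π α) (a b c : α) (i j k : Bool) : Diagram σ π α :=
  ((D.flip (b, !k) (c, !j)).flip (c, j) (a, i)).flip (a, !i) (b, k)

theorem flip_flip_comm (D : Diagram σ π α) {x y z w : α × Bool} (h1 : x ≠ z) (h2 : x ≠ w)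
    (h3 : y ≠ z) (h4 : y ≠ w) : (D.flip x y).flip z w = (D.flip z w).flip x y := by
  classical
  rcases eq_or_ne x y with rfl | h5
  · simp only [flip, permute_permute, Equiv.swap_self]
    rfl
  rcases eq_or_ne z w with rfl | h6
  · simp only [flip, permute_permute, Equiv.swap_self]
    rfl
  rw [flip, flip, flip, flip, permute_permute, permute_permute]
  congr 1
  refine Equiv.Perm.Disjoint.commute ?_
  intro u
  by_cases h : u = z ∨ u = w
  · right
    rcases h with rfl | rfl
    · exact Equiv.swap_apply_of_ne_of_ne h1.symm h3.symm
    · exact Equiv.swap_apply_of_ne_of_ne h2.symm h4.symm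
  · left
    push Not at h
    exact Equiv.swap_apply_of_ne_of_ne h.1 h.2

theorem Triangle.move_rotate {D : Diagram σ π α} {a b c : α} {i j k : Bool}
    (h : D.Triangle a b c i j k) :
    D.triangleMove b c a k (!i) (!j) = D.triangleMove a b c i j k := by
  have h1 := h.ne_ab
  have h2 := h.ne_bc
  have h3 := h.ne_ca
  simp only [triangleMove, Bool.not_not]
  rw [flip_flip_comm (D.flip (c, j) (a, i)) (x := (a, !i)) (y := (b, k))]
  · rw [flip_flip_comm D] <;> simp [h1, h2.symm, h3.symm]
  all_goals simp [h1, h2, h3.symm]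

end Diagram

namespace DiagramSeries

open Diagram

variable {π : Type*} [Group π] {α : Type*}

/-- The contribution of the edge with ends `u` and `v` to the six term relation, in the diagram
without the arrow `x`. -/
def edgeTerm (𝒜 : DiagramSeries Unit π) [Finite α] (A : ArrowDiagram π α) (x : α)
    (u v : α × Bool) : ℚ :=
  A.edgeSign u v * (𝒜.value (A.restrict {y | y ≠ x}) - 𝒜.value ((A.flip u v).restrict {y | y ≠ x}))

/-- The six term relation at a triangle. -/
def sixTerm (𝒜 : DiagramSeries Unit π) [Finite α] (A : ArrowDiagram π α) (a b c : α)
    (i j k : Bool) : ℚ :=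
  𝒜.edgeTerm A a (b, !k) (c, !j) + 𝒜.edgeTerm A b (c, j) (a, i) + 𝒜.edgeTerm A c (a, !i) (b, k)

/-- All six term relations hold. -/
def SixTermRelations (𝒜 : DiagramSeries Unit π) : Prop :=
  ∀ {α : Type} [Finite α] (A : ArrowDiagram π α) (a b c : α) (i j k : Bool), DistinctHeads i j k →
    A.Triangle a b c i j k → 𝒜.sixTerm A a b c i j k = 0

theorem _root_.SatisfiesR2.value_eq_zero {𝒜 : DiagramSeries Unit π} (h : SatisfiesR2 𝒜) [Finite α]
    (A : ArrowDiagram π α) {a b : α} (hab : a ≠ b) (hadj : ∀ i, A.circle.Adj (a, i) (b, i)) :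
    𝒜.value A = 0 := by
  set e := Finite.equivFin α
  have hs := A.sub_map_symm e
  refine h _ ⟨_, A.map e, e a, e b, by simpa using hab, hs.adj (by simpa using hadj _),
    hs.adj (by simpa using hadj _), ?_⟩
  rw [toClass_map]

theorem _root_.SatisfiesR2.value_restrict_eq_zero {𝒜 : DiagramSeries Unit π} (h : SatisfiesR2 𝒜)
    [Finite α] (A : ArrowDiagram π α) {a b : α} (hab : a ≠ b)
    (hadj : ∀ i, A.circle.Adj (a, i) (b, i)) {S : Set α} (ha : a ∈ S) (hb : b ∈ S) :
    𝒜.value (A.restrict S) = 0 :=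
  h.value_eq_zero _ (a := ⟨a, ha⟩) (b := ⟨b, hb⟩) (by simpa using hab) fun i =>
    (A.sub_restrict S).adj (hadj i)

/-! ### Parallel arrows and the R₂ condition -/

section Parallel

variable {𝒜 : DiagramSeries Unit π} {E : ArrowDiagram π α} {a b c d : α} {i j k : Bool}

/-- Exchanging the names of two parallel arrows amounts to exchanging adjacent ends, and neither
exchange affects whether `c` and `a` cross. -/
theorem crosses_of_parallel (hab : a ≠ d) (hac : a ≠ c) (hdc : d ≠ c)
    (had : ∀ i, E.circle.Adj (a, i) (d, i)) : E.Crosses c a ↔ E.Crosses c d := by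
  classical
  have h1 := (E.sub_map (Equiv.swap a d)).crosses c d
  rw [Equiv.swap_apply_of_ne_of_ne hac.symm hdc.symm, Equiv.swap_apply_right, map_swap_eq] at h1
  rw [← h1, crosses_flip_of_ne, crosses_flip_of_ne (had false)]
  · exact Or.inr ⟨hdc, hab.symm⟩
  · exact adj_flip_of_ne (had true) (by simp) (by simp) (by simp) (by simp)
  · exact Or.inr ⟨hdc, hab.symm⟩

/-- In a diagram with two parallel arrows `a` and `d`, the ends of `d` are exchanged with an end of
`c` and an end of `b`. -/
theorem parallel_terms [Finite α] (hR2 : SatisfiesR2 𝒜) (hda : a ≠ d) (hac : a ≠ c) (hdc : d ≠ c)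
    (hab : a ≠ b) (hdb : d ≠ b) (hbc : b ≠ c)
    (had : ∀ i, E.circle.Adj (a, i) (d, i)) (hc : E.circle.Adj (c, j) (d, i))
    (hb : E.circle.Adj (b, k) (d, !i)) :
    𝒜.edgeTerm E b (c, j) (d, i) +
      𝒜.edgeTerm ((E.flip (c, j) (d, i)).flip (b, k) (d, !i)) b (c, j) (a, i) = 0 := by
  classical
  set E₁ := E.flip (c, j) (d, i) with hE₁
  have hb₁ : E₁.circle.Adj (b, k) (d, !i) :=
    adj_flip_of_ne hb (by simp [hbc]) (by simp [hdb.symm]) (by simp [hdc]) (by simp)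
  have hca₁ : (E₁.flip (b, k) (d, !i)).circle.Adj (c, j) (a, i) := by
    refine adj_flip_of_ne ?_ (by simp [hbc.symm]) (by simp [hdc.symm]) (by simp [hab])
      (by simp [hda])
    rw [hE₁, adj_flip_left (by simp [hac]) (by simp [hda])]
    exact (had i).symm
  have hsign : (E₁.flip (b, k) (d, !i)).edgeSign (c, j) (a, i) = E.edgeSign (c, j) (d, i) := by
    rw [edgeSign_flip_of_ne hb₁ (Or.inr ⟨hdc, hda.symm⟩),
      edgeSign_flip_of_ne hc (Or.inr ⟨hdc, hda.symm⟩)]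
    simp only [edgeSign, crosses_of_parallel hda hac hdc had]
  -- The end of `c` passes first `d`, then `a`. Before and after both passages `a` and `d` are
  -- parallel, so the two extreme diagrams have value 0; the diagram in the middle occurs twice,
  -- with opposite signs.
  have hzero : 𝒜.value (E.restrict {y | y ≠ b}) = 0 :=
    hR2.value_restrict_eq_zero E hda had hab hdb
  have hone : (E₁.flip (b, k) (d, !i)).restrict {y | y ≠ b} = E₁.restrict {y | y ≠ b} :=
    restrict_flip_of_not_mem hb₁ (Or.inl (by simp))
  have hlast : 𝒜.value (((E₁.flip (b, k) (d, !i)).flip (c, j) (a, i)).restrict {y | y ≠ b}) = 0 := by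
    rw [flip_flip_comm _ (by simp [hbc]) (by simp [hab.symm]) (by simp [hdc]) (by simp [hda.symm]),
      restrict_flip_of_not_mem (adj_flip_of_ne hb₁ (by simp [hbc]) (by simp [hab.symm])
        (by simp [hdc]) (by simp [hda.symm])) (Or.inl (by simp))]
    refine hR2.value_restrict_eq_zero _ hda (fun i' => ?_) hab hdb
    by_cases hi : i' = i
    · subst hi
      rw [adj_flip_right (by simp [hdc]) (by simp [hda.symm]), hE₁]
      exact adj_flip_self hc
    · refine adj_flip_of_ne (adj_flip_of_ne (had i') ?_ ?_ ?_ ?_) ?_ ?_ ?_ ?_ <;>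
        simp [hac, hda, hdc, hi, hda.symm]
  rw [edgeTerm, edgeTerm, hsign, hone, hlast, hzero]
  ring

end Parallel

/-- Double `a` by a parallel arrow `none`, placed so that it forms the triangle with `b` and `c`. In
`E` apply the six term relation to this copy; in `E₂`, where the copy has passed `b` and `c`, apply
it to `a` itself. In the sum, the terms that contain both copies cancel by `parallel_terms`. The
remaining terms, at the edge between `b` and `c`, contain one copy each: they give `A` from `E`, and
`A` with two edges exchanged from `E₂`. -/
theorem SixTermRelations.four_term {𝒜 : DiagramSeries Unit π} (h6 : 𝒜.SixTermRelations)
    (hR2 : SatisfiesR2 𝒜) {α : Type} [Finite α] {A : ArrowDiagram π α} {a b c : α} {i j k : Bool}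
    (hd : DistinctHeads i j k) (hA : A.Triangle a b c i j k) :
    𝒜.value A - 𝒜.value (A.flip (b, !k) (c, !j)) +
      𝒜.value ((A.flip (c, j) (a, i)).flip (a, !i) (b, k)) -
      𝒜.value (((A.flip (c, j) (a, i)).flip (a, !i) (b, k)).flip (b, !k) (c, !j)) = 0 := by
  classical
  have hab := hA.ne_ab
  have hbc := hA.ne_bc
  have hca := hA.ne_ca
  obtain ⟨E, hE, e1, e2, e3, e4, e5⟩ := ArrowDiagram.exists_insert A i (a, i) (a, !i) (c, j) (b, k)
    (by simp) (by simp [hca]) (by simp [hab.symm])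
  replace e3 := e3 hA.adj_ca.symm
  replace e4 := e4 hA.adj_ab
  have e6 : E.circle.Adj (some b, !k) (some c, !j) :=
    e5 (b, !k) (c, !j) (by simp [hab.symm]) (by simp [hab.symm]) (by simp [hca]) (by simp [hca])
      hA.adj_bc
  have had : ∀ i', E.circle.Adj (some a, i') (none, i') := by
    intro i'
    by_cases hi : i' = i
    · rw [hi]
      exact e1
    · rw [Bool.eq_not.2 hi]
      exact e2
  have hT : E.Triangle none (some b) (some c) i j k :=
    ⟨by simp, by simp [hbc], by simp, e6, e3.symm, e4⟩
  set E₁ := E.flip (some c, j) (none, i) with hE₁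
  set E₂ := E₁.flip (some b, k) (none, !i) with hE₂
  have hE₂' : E₂ = (E.flip (some b, k) (none, !i)).flip (some c, j) (none, i) :=
    flip_flip_comm E (by simp [hbc.symm]) (by simp) (by simp) (by simp)
  have e4' : E₁.circle.Adj (some b, k) (none, !i) :=
    adj_flip_of_ne e4.symm (by simp [hbc]) (by simp) (by simp) (by simp)
  have hT₂ : E₂.Triangle (some a) (some b) (some c) i j k := by
    refine ⟨by simp [hab], by simp [hbc], by simp [hca], ?_, ?_, ?_⟩
    · refine adj_flip_of_ne (adj_flip_of_ne e6 ?_ ?_ ?_ ?_) ?_ ?_ ?_ ?_ <;>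
        simp [hbc, hbc.symm]
    · refine adj_flip_of_ne ?_ (by simp [hbc.symm]) (by simp) (by simp [hab]) (by simp)
      rw [hE₁, adj_flip_left (by simp [hca.symm]) (by simp)]
      exact e1.symm
    · rw [hE₂']
      refine adj_flip_of_ne ?_ (by simp [hca.symm]) (by simp) (by simp [hbc]) (by simp)
      refine MarkedCircle.Adj.symm ?_
      rw [adj_flip_left (by simp [hab]) (by simp)]
      exact e2.symm
  have h1 := h6 E none (some b) (some c) i j k hd hT
  have h2 := h6 E₂ (some a) (some b) (some c) i j k hd hT₂
  have h3 := parallel_terms hR2 (E := E) (a := some a) (d := none) (b := some b) (c := some c)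
    (i := i) (j := j) (k := k) (by simp) (by simp [hca.symm]) (by simp) (by simp [hab]) (by simp)
    (by simp [hbc]) had e3.symm e4.symm
  have h4 := parallel_terms hR2 (E := E) (a := some a) (d := none) (b := some c) (c := some b)
    (i := !i) (j := k) (k := j) (by simp) (by simp [hab]) (by simp) (by simp [hca.symm]) (by simp)
    (by simp [hbc.symm]) had e4.symm (by simpa using e3.symm)
  rw [← hE₁, ← hE₂] at h3
  rw [Bool.not_not, ← hE₂'] at h4
  have hcomm : ∀ (D : ArrowDiagram π (Option α)) (x : Option α) (u v : Option α × Bool),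
      u.1 ≠ v.1 → 𝒜.edgeTerm D x u v = 𝒜.edgeTerm D x v u := by
    intro D x u v huv
    rw [edgeTerm, edgeTerm, edgeSign_comm D huv, flip_comm]
  rw [sixTerm, hcomm E _ (none, !i) _ (by simp)] at h1
  rw [sixTerm, hcomm E₂ _ (some a, !i) _ (by simp [hab])] at h2
  have h5 : 𝒜.edgeTerm E none (some b, !k) (some c, !j) +
      𝒜.edgeTerm E₂ (some a) (some b, !k) (some c, !j) = 0 := by linarith
  have hsign : E₂.edgeSign (some b, !k) (some c, !j) = E.edgeSign (some b, !k) (some c, !j) := by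
    rw [hE₂, edgeSign_flip_of_ne e4' (Or.inr (by simp)),
      hE₁, edgeSign_flip_of_ne e3.symm (Or.inr (by simp))]
  have hr0 : Set.range (some : α → Option α) = {y | y ≠ none} := by
    ext x
    simp [Option.ne_none_iff_exists', eq_comm]
  have hv1 := 𝒜.value_restrict hE hr0
  have hv2 := 𝒜.value_restrict (hE.flip (b, !k) (c, !j)) hr0
  -- The second embedding of `A` in `E`, in which the copy `none` plays the role of `a`. It exists
  -- because the two arrows are parallel, and it follows the copy when its ends are moved.
  set f : α → Option α := Equiv.swap (some a) none ∘ some with hf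
  have hfE : Diagram.Sub A E f := by
    have h := hE.flip_of_not_mem (had false) (Or.inr (by simp))
    have h' := h.flip_of_not_mem (u := (some a, true)) (v := (none, true))
      (adj_flip_of_ne (had true) (by simp) (by simp) (by simp) (by simp)) (Or.inr (by simp))
    rw [← map_swap_eq] at h'
    have := h'.trans ((E.map (Equiv.swap (some a) none)).sub_map (Equiv.swap (some a) none))
    rwa [map_map, Equiv.swap_swap, map_refl] at this
  have hfa : f a = none := by simp [hf]
  have hfb : f b = some b := Equiv.swap_apply_of_ne_of_ne (by simp [hab.symm]) (by simp)
  have hfc : f c = some c := Equiv.swap_apply_of_ne_of_ne (by simp [hca]) (by simp)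
  have hrf : Set.range f = {y | y ≠ some a} := by
    rw [hf, Set.range_comp, hr0]
    ext x
    rw [Set.mem_image_equiv, Equiv.symm_swap, Set.mem_ofPred_eq, Set.mem_ofPred_eq, ne_eq,
      Equiv.swap_apply_eq_iff, Equiv.swap_apply_right]
  have hf2 : Diagram.Sub ((A.flip (c, j) (a, i)).flip (a, !i) (b, k)) E₂ f := by
    have := (hfE.flip (c, j) (a, i)).flip (a, !i) (b, k)
    simp only [Prod.map_apply, hfa, hfb, hfc, id] at this
    rwa [flip_comm _ (none, !i)] at this
  have hv3 := 𝒜.value_restrict hf2 hrf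
  have hf3 := hf2.flip (b, !k) (c, !j)
  simp only [Prod.map_apply, hfb, hfc, id] at hf3
  have hv4 := 𝒜.value_restrict hf3 hrf
  rw [edgeTerm, edgeTerm, hsign, hv1, hv3, hv4] at h5
  simp only [Prod.map_apply, id] at hv2
  rw [hv2, ← mul_add] at h5
  have hne : (E.edgeSign (some b, !k) (some c, !j) : ℚ) ≠ 0 := by
    rcases E.edgeSign_eq_or (some b, !k) (some c, !j) with h | h <;> rw [h] <;> norm_num
  have := (mul_eq_zero.1 h5).resolve_left hne
  linarith

/-- The eight ways of exchanging ends at the three edges are the vertices of a cube, with values f.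
If x, y, z stand for the edges bc, ca, ab, the relations used are f(∅) − f(y) + f(xz) − f(xyz) = 0,
f(∅) − f(z) + f(xy) − f(xyz) = 0 and, starting from y, f(y) − f(xy) + f(z) − f(xz) = 0. Their sum is
2 (f(∅) − f(xyz)) = 0. -/
theorem SixTermRelations.value_triangleMove {𝒜 : DiagramSeries Unit π} (h6 : 𝒜.SixTermRelations)
    (hR2 : SatisfiesR2 𝒜) {α : Type} [Finite α] {A : ArrowDiagram π α} {a b c : α} {i j k : Bool}
    (hd : DistinctHeads i j k) (hA : A.Triangle a b c i j k) :
    𝒜.value (A.triangleMove a b c i j k) = 𝒜.value A := by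
  have hab := hA.ne_ab
  have hbc := hA.ne_bc
  have hca := hA.ne_ca
  have comm₁ : ∀ D : ArrowDiagram π α, (D.flip (b, !k) (c, !j)).flip (c, j) (a, i) =
      (D.flip (c, j) (a, i)).flip (b, !k) (c, !j) := fun D => by
    apply flip_flip_comm <;> simp [hbc, hab.symm, hca]
  have comm₂ : ∀ D : ArrowDiagram π α, (D.flip (c, j) (a, i)).flip (a, !i) (b, k) =
      (D.flip (a, !i) (b, k)).flip (c, j) (a, i) := fun D => by
    apply flip_flip_comm <;> simp [hbc.symm, hca, hab]
  have comm₃ : ∀ D : ArrowDiagram π α, (D.flip (b, !k) (c, !j)).flip (a, !i) (b, k) =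
      (D.flip (a, !i) (b, k)).flip (b, !k) (c, !j) := fun D => by
    apply flip_flip_comm <;> simp [hbc.symm, hca, hab.symm]
  have hB : (A.flip (c, j) (a, i)).Triangle a b c i j k := by
    refine ⟨hab, hbc, hca, ?_, adj_flip_self hA.adj_ca, ?_⟩
    · apply adj_flip_of_ne hA.adj_bc <;> simp [hbc, hca, hab.symm]
    · apply adj_flip_of_ne hA.adj_ab <;> simp [hbc, hca.symm, hab.symm]
  have r1 := h6.four_term hR2 hd.rotate hA.rotate
  have r2 := h6.four_term hR2 hd.rotate.rotate hA.rotate.rotate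
  have r3 := h6.four_term hR2 hd hB
  simp only [Bool.not_not] at r1 r2
  simp only [triangleMove]
  simp only [comm₁, comm₂, comm₃, Diagram.flip_flip] at r1 r2 r3 ⊢
  linarith

end DiagramSeries

/-! ### Sites of `R₃`-moves and the `A6T` relations -/

namespace Diagram

variable {σ π : Type*} [Group π] {α β : Type*}

/-- Two of the three exchanges involve an end of `a`, so they leave no trace once `a` is removed. -/
theorem restrict_triangleMove {D : Diagram σ π α} {a b c : α} {i j k : Bool}
    (h : D.Triangle a b c i j k) {S : Set α} (ha : a ∉ S) :
    (D.triangleMove a b c i j k).restrict S = (D.flip (b, !k) (c, !j)).restrict S := by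
  have hab := h.ne_ab
  have hbc := h.ne_bc
  have hca := h.ne_ca
  have h1 : (D.flip (b, !k) (c, !j)).circle.Adj (c, j) (a, i) := by
    apply adj_flip_of_ne h.adj_ca <;> simp [hbc.symm, hab, hca.symm]
  have h2 : ((D.flip (b, !k) (c, !j)).flip (c, j) (a, i)).circle.Adj (a, !i) (b, k) := by
    apply adj_flip_of_ne (adj_flip_of_ne h.adj_ab _ _ _ _) <;> simp [hab, hca.symm, hbc, hab.symm]
  rw [triangleMove, restrict_flip_of_not_mem h2 (Or.inl ha),
    restrict_flip_of_not_mem h1 (Or.inr ha)]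

theorem restrict_triangleMove_of_not_mem {D : Diagram σ π α} {a b c : α} {i j k : Bool}
    (h : D.Triangle a b c i j k) {S : Set α} (ha : a ∉ S) (hb : b ∉ S ∨ c ∉ S) :
    (D.triangleMove a b c i j k).restrict S = D.restrict S := by
  rw [restrict_triangleMove h ha, restrict_flip_of_not_mem h.adj_bc hb]

theorem Triangle.triangleMove_eq {D : Diagram σ π α} {a b c : α} {i j k : Bool}
    (h : D.Triangle a b c i j k) :
    D.triangleMove a b c i j k = ((D.flip (a, !i) (b, k)).flip (c, j) (a, i)).flip (b, !k) (c, !j) := by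
  have hab := h.ne_ab
  have hbc := h.ne_bc
  have hca := h.ne_ca
  rw [triangleMove, flip_flip_comm (D.flip (b, !k) (c, !j)) (x := (c, j)) (y := (a, i)),
    flip_flip_comm D (x := (b, !k)) (y := (c, !j)), flip_flip_comm _ (x := (b, !k)) (y := (c, !j))]
  all_goals simp [hab, hbc, hca, hab.symm, hbc.symm]

/-- A triangle at which an `R₃`-move can be performed. -/
structure SignedTriangle (G : GaussDiagram π α) (a b c : α) (i j k : Bool) : Prop
    extends G.Triangle a b c i j k where
  heads : DistinctHeads i j k
  sign_ca : ((G.deco c * G.deco a : ℤˣ) : ℤ) * G.edgeSign (c, j) (a, i) =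
    ((G.deco b * G.deco c : ℤˣ) : ℤ) * G.edgeSign (b, !k) (c, !j)
  sign_ab : ((G.deco a * G.deco b : ℤˣ) : ℤ) * G.edgeSign (a, !i) (b, k) =
    ((G.deco b * G.deco c : ℤˣ) : ℤ) * G.edgeSign (b, !k) (c, !j)

theorem Sub.signedTriangle {G : GaussDiagram π α} {G' : GaussDiagram π β} {f : β → α}
    (H : G'.Sub G f) {a b c : β} {i j k : Bool} (h : G.SignedTriangle (f a) (f b) (f c) i j k) :
    G'.SignedTriangle a b c i j k :=
  ⟨H.triangle h.toTriangle, h.heads, by simpa only [H.edgeSign, H.deco] using h.sign_ca,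
    by simpa only [H.edgeSign, H.deco] using h.sign_ab⟩

/-- The edge that starts at `p` has ends `u` and `v`. -/
def HasEnds (D : Diagram σ π α) (p u v : α × Bool) : Prop :=
  (p = u ∧ D.circle.next p = v) ∨ (p = v ∧ D.circle.next p = u)

namespace HasEnds

variable {D : Diagram σ π α} {p u v : α × Bool}

theorem adj (h : D.HasEnds p u v) (hm : D.circle.mark p = 1) : D.circle.Adj u v := by
  rcases h with ⟨rfl, h⟩ | ⟨rfl, h⟩
  · exact Or.inl ⟨h, hm⟩
  · exact Or.inr ⟨h, hm⟩

theorem of_adj (h : D.circle.Adj u v) : ∃ p, D.circle.mark p = 1 ∧ D.HasEnds p u v := by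
  rcases h with h | h
  · exact ⟨u, h.2, Or.inl ⟨rfl, h.1⟩⟩
  · exact ⟨v, h.2, Or.inr ⟨rfl, h.1⟩⟩

theorem headCount (h : D.HasEnds p u v) : D.headCount p = u.2.toNat + v.2.toNat := by
  rcases h with ⟨rfl, rfl⟩ | ⟨rfl, rfl⟩
  · rfl
  · exact add_comm _ _

theorem epsilon (h : D.HasEnds p u v) (huv : u.1 ≠ v.1) : D.epsilon p = D.edgeSign u v := by
  rcases h with ⟨rfl, rfl⟩ | ⟨rfl, rfl⟩
  · rfl
  · exact edgeSign_comm D huv.symm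

theorem deco {D : GaussDiagram π α} (h : D.HasEnds p u v) :
    D.deco p.1 * D.deco (D.circle.next p).1 = D.deco u.1 * D.deco v.1 := by
  rcases h with ⟨rfl, rfl⟩ | ⟨rfl, rfl⟩
  · rfl
  · exact mul_comm _ _

theorem pair (h : D.HasEnds p u v) : ({p.1, (D.circle.next p).1} : Set α) = {u.1, v.1} := by
  rcases h with ⟨rfl, rfl⟩ | ⟨rfl, rfl⟩
  · rfl
  · exact Set.pair_comm _ _

theorem flip_eq (h : D.HasEnds p u v) (E : Diagram σ π α) :
    E.flip p (D.circle.next p) = E.flip u v := by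
  rcases h with ⟨rfl, rfl⟩ | ⟨rfl, rfl⟩
  · rfl
  · exact flip_comm _ _ _

theorem exists_of_pair {x y : α} (h : ({p.1, (D.circle.next p).1} : Set α) = {x, y}) (hxy : x ≠ y) :
    ∃ s t, D.HasEnds p (x, s) (y, t) := by
  have hx : x ∈ ({p.1, (D.circle.next p).1} : Set α) := by simp [h]
  have hy : y ∈ ({p.1, (D.circle.next p).1} : Set α) := by simp [h]
  rcases hx with rfl | hx
  · rcases hy with rfl | hy
    · exact absurd rfl hxy
    · obtain rfl := hy
      exact ⟨_, _, Or.inl ⟨rfl, rfl⟩⟩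
  · obtain rfl := hx
    rcases hy with rfl | hy
    · exact ⟨_, _, Or.inr ⟨rfl, rfl⟩⟩
    · exact absurd hy.symm hxy

end HasEnds

theorem r3Move_eq (G : GaussDiagram π α) (p : Fin 3 → α × Bool) : r3Move G p =
    ((G.flip (p 2) (G.circle.next (p 2))).flip (p 1) (G.circle.next (p 1))).flip (p 0)
      (G.circle.next (p 0)) := rfl

theorem exists_signedTriangle {G : GaussDiagram π α} {p : Fin 3 → α × Bool} {a : Fin 3 → α}
    (h : IsR3Site G p a) : ∃ i j k, G.SignedTriangle (a 0) (a 1) (a 2) i j k ∧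
      r3Move G p = G.triangleMove (a 0) (a 1) (a 2) i j k := by
  have hab : a 0 ≠ a 1 := h.arrows_distinct.ne (by decide)
  have hbc : a 1 ≠ a 2 := h.arrows_distinct.ne (by decide)
  have hca : a 2 ≠ a 0 := h.arrows_distinct.ne (by decide)
  obtain ⟨k', j', h0⟩ := HasEnds.exists_of_pair (D := G) (h.bounded_by 0) hbc
  obtain ⟨j, i, h1⟩ := HasEnds.exists_of_pair (D := G) (h.bounded_by 1) hca
  obtain ⟨i', k, h2⟩ := HasEnds.exists_of_pair (D := G) (h.bounded_by 2) hab
  -- The six ends are distinct, so no end bounds two of the edges. Each arrow thus uses its two ends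
  -- for its two edges, which forces the negations in `Triangle`.
  have hdist : ∀ {m n : Fin 3} {u v w : α × Bool}, m ≠ n → (G.HasEnds (p m) u v ∨ G.HasEnds (p m) v u) →
      (G.HasEnds (p n) u w ∨ G.HasEnds (p n) w u) → False := by
    intro m n u v w hmn hm hn
    have e1 := h.ends_distinct.ne (a₁ := Sum.inl m) (a₂ := Sum.inl n) (by simpa using hmn)
    have e2 := h.ends_distinct.ne (a₁ := Sum.inl m) (a₂ := Sum.inr n) (by simp)
    have e3 := h.ends_distinct.ne (a₁ := Sum.inr m) (a₂ := Sum.inl n) (by simp)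
    have e4 := h.ends_distinct.ne (a₁ := Sum.inr m) (a₂ := Sum.inr n) (by simpa using hmn)
    simp only [Sum.elim_inl, Sum.elim_inr] at e1 e2 e3 e4
    have hu : ∀ {l : Fin 3} {u v : α × Bool}, (G.HasEnds (p l) u v ∨ G.HasEnds (p l) v u) →
        p l = u ∨ G.circle.next (p l) = u := by
      unfold HasEnds
      tauto
    rcases hu hm with hm | hm <;> rcases hu hn with hn | hn
    exacts [e1 (hm.trans hn.symm), e2 (hm.trans hn.symm), e3 (hm.trans hn.symm),
      e4 (hm.trans hn.symm)]
  have hi : i' = !i := by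
    by_contra hne
    obtain rfl : i' = i := by simpa using hne
    exact hdist (m := 2) (n := 1) (by decide) (Or.inl h2) (Or.inr h1)
  have hj : j' = !j := by
    by_contra hne
    obtain rfl : j' = j := by simpa using hne
    exact hdist (m := 0) (n := 1) (by decide) (Or.inr h0) (Or.inl h1)
  have hk : k' = !k := by
    by_contra hne
    obtain rfl : k' = k := by simpa using hne
    exact hdist (m := 0) (n := 2) (by decide) (Or.inl h0) (Or.inr h2)
  subst hi hj hk
  have hT : G.Triangle (a 0) (a 1) (a 2) i j k :=
    ⟨hab, hbc, hca, h0.adj (h.marks 0), h1.adj (h.marks 1), h2.adj (h.marks 2)⟩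
  refine ⟨i, j, k, ⟨hT, ⟨?_, ?_, ?_⟩, ?_, ?_⟩, ?_⟩
  · have := h.heads.ne (a₁ := 0) (a₂ := 1) (by decide)
    rwa [h0.headCount, h1.headCount] at this
  · have := h.heads.ne (a₁ := 1) (a₂ := 2) (by decide)
    rwa [h1.headCount, h2.headCount] at this
  · have := h.heads.ne (a₁ := 2) (a₂ := 0) (by decide)
    rwa [h2.headCount, h0.headCount] at this
  · have := h.signs 1 0
    rwa [h0.epsilon hbc, h1.epsilon hca, h0.deco, h1.deco] at this
  · have := h.signs 2 0
    rwa [h0.epsilon hbc, h2.epsilon hab, h0.deco, h2.deco] at this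
  · rw [r3Move_eq, h0.flip_eq, h1.flip_eq, h2.flip_eq, hT.triangleMove_eq]
    rfl

theorem SignedTriangle.exists_site {G : GaussDiagram π α} {a b c : α} {i j k : Bool}
    (h : G.SignedTriangle a b c i j k) : ∃ p, IsR3Site G p ![a, b, c] ∧
      r3Move G p = G.triangleMove a b c i j k := by
  have hab := h.ne_ab
  have hbc := h.ne_bc
  have hca := h.ne_ca
  obtain ⟨p0, m0, h0⟩ := HasEnds.of_adj h.adj_bc
  obtain ⟨p1, m1, h1⟩ := HasEnds.of_adj h.adj_ca
  obtain ⟨p2, m2, h2⟩ := HasEnds.of_adj h.adj_ab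
  have e : ∀ n, G.HasEnds (![p0, p1, p2] n) (![(b, !k), (c, j), (a, !i)] n)
      (![(c, !j), (a, i), (b, k)] n) := by
    intro n
    fin_cases n
    exacts [h0, h1, h2]
  have hs : ∀ n, ((G.deco (![p0, p1, p2] n).1 * G.deco (G.circle.next (![p0, p1, p2] n)).1 : ℤˣ) : ℤ) *
      G.epsilon (![p0, p1, p2] n) =
        ((G.deco b * G.deco c : ℤˣ) : ℤ) * G.edgeSign (b, !k) (c, !j) := by
    intro n
    fin_cases n
    · show ((G.deco p0.1 * G.deco (G.circle.next p0).1 : ℤˣ) : ℤ) * G.epsilon p0 = _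
      rw [h0.deco, h0.epsilon hbc]
    · show ((G.deco p1.1 * G.deco (G.circle.next p1).1 : ℤˣ) : ℤ) * G.epsilon p1 = _
      rw [h1.deco, h1.epsilon hca, h.sign_ca]
    · show ((G.deco p2.1 * G.deco (G.circle.next p2).1 : ℤˣ) : ℤ) * G.epsilon p2 = _
      rw [h2.deco, h2.epsilon hab, h.sign_ab]
  have hU : ∀ m n : Fin 3, m ≠ n →
      ![(b, !k), (c, j), (a, !i)] m ≠ ![(b, !k), (c, j), (a, !i)] n ∧
      ![(b, !k), (c, j), (a, !i)] m ≠ ![(c, !j), (a, i), (b, k)] n ∧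
      ![(c, !j), (a, i), (b, k)] m ≠ ![(b, !k), (c, j), (a, !i)] n ∧
      ![(c, !j), (a, i), (b, k)] m ≠ ![(c, !j), (a, i), (b, k)] n := by
    intro m n hmn
    fin_cases m <;> fin_cases n <;>
      simp [hab, hbc, hca, hab.symm, hbc.symm, hca.symm] at hmn ⊢
  have hUV : ∀ m : Fin 3, ![(b, !k), (c, j), (a, !i)] m ≠ ![(c, !j), (a, i), (b, k)] m := by
    intro m
    fin_cases m <;> simp [hab, hbc, hca]
  refine ⟨![p0, p1, p2], ⟨?_, ?_, ?_, ?_, ?_, fun m n => (hs m).trans (hs n).symm⟩, ?_⟩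
  · intro m n
    fin_cases m <;> fin_cases n <;> simp [hab, hbc, hca, hab.symm, hbc.symm, hca.symm]
  · have hne : ∀ m, ![p0, p1, p2] m ≠ G.circle.next (![p0, p1, p2] m) := by
      intro m hm
      rcases e m with ⟨e1, e2⟩ | ⟨e1, e2⟩
      · exact hUV m (by rw [← e1, ← e2, ← hm])
      · exact hUV m (by rw [← e1, ← e2, ← hm])
    have hmem : ∀ m, (![p0, p1, p2] m = ![(b, !k), (c, j), (a, !i)] m ∨
        ![p0, p1, p2] m = ![(c, !j), (a, i), (b, k)] m) ∧
        (G.circle.next (![p0, p1, p2] m) = ![(b, !k), (c, j), (a, !i)] m ∨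
        G.circle.next (![p0, p1, p2] m) = ![(c, !j), (a, i), (b, k)] m) := by
      intro m
      rcases e m with ⟨e1, e2⟩ | ⟨e1, e2⟩
      · exact ⟨Or.inl e1, Or.inr e2⟩
      · exact ⟨Or.inr e1, Or.inl e2⟩
    have hdis : ∀ {m n : Fin 3} {x y : α × Bool}, m ≠ n →
        (x = ![(b, !k), (c, j), (a, !i)] m ∨ x = ![(c, !j), (a, i), (b, k)] m) →
        (y = ![(b, !k), (c, j), (a, !i)] n ∨ y = ![(c, !j), (a, i), (b, k)] n) → x ≠ y := by
      rintro m n x y hmn (rfl | rfl) (rfl | rfl)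
      exacts [(hU m n hmn).1, (hU m n hmn).2.1, (hU m n hmn).2.2.1, (hU m n hmn).2.2.2]
    rintro (m | m) (n | n) hmn <;> by_cases hn : m = n <;>
      simp only [Sum.elim_inl, Sum.elim_inr] at hmn
    · rw [hn]
    · exact absurd hmn (hdis hn (hmem m).1 (hmem n).1)
    · rw [← hn] at hmn
      exact absurd hmn (hne m)
    · exact absurd hmn (hdis hn (hmem m).1 (hmem n).2)
    · rw [← hn] at hmn
      exact absurd hmn.symm (hne m)
    · exact absurd hmn (hdis hn (hmem m).2 (hmem n).1)
    · rw [hn]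
    · exact absurd hmn (hdis hn (hmem m).2 (hmem n).2)
  · intro n
    fin_cases n
    exacts [h0.pair, h1.pair, h2.pair]
  · intro n
    fin_cases n
    exacts [m0, m1, m2]
  · have hh := h.heads
    intro m n hmn
    dsimp only at hmn
    rw [(e m).headCount, (e n).headCount] at hmn
    unfold DistinctHeads at hh
    fin_cases m <;> fin_cases n <;> simp at hmn ⊢ <;> omega
  · rw [r3Move_eq]
    show ((G.flip p2 (G.circle.next p2)).flip p1 (G.circle.next p1)).flip p0 (G.circle.next p0) = _
    rw [h0.flip_eq, h1.flip_eq, h2.flip_eq, h.toTriangle.triangleMove_eq]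

/-- Every triangle with distinct numbers of heads is the site of an `R₃`-move, for suitable
writhes. -/
theorem Triangle.exists_signedTriangle {A : ArrowDiagram π α} {a b c : α} {i j k : Bool}
    (h : A.Triangle a b c i j k) (hd : DistinctHeads i j k) :
    ∃ G : GaussDiagram π α, G.forget = A ∧ G.SignedTriangle a b c i j k := by
  classical
  have hu : ∀ u v, ∃ e : ℤˣ, (e : ℤ) = A.edgeSign u v := by
    intro u v
    rcases A.edgeSign_eq_or u v with h | h <;> rw [h]
    exacts [⟨1, rfl⟩, ⟨-1, rfl⟩]
  obtain ⟨ea, ha⟩ := hu (b, !k) (c, !j)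
  obtain ⟨eb, hb⟩ := hu (c, j) (a, i)
  obtain ⟨ec, hc⟩ := hu (a, !i) (b, k)
  -- The writhe of each of the three arrows is ε of the opposite edge; then w(e)ε(e) is the product
  -- of the three signs ε, whatever the edge. The writhes of the other arrows do not matter.
  let G : GaussDiagram π α :=
    ⟨A.circle, fun x => if x = a then ea else if x = b then eb else ec⟩
  have hGa : G.deco a = ea := if_pos rfl
  have hGb : G.deco b = eb := (if_neg h.ne_ab.symm).trans (if_pos rfl)
  have hGc : G.deco c = ec := (if_neg h.ne_ca).trans (if_neg h.ne_bc.symm)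
  have hsign : ∀ u v, G.edgeSign u v = A.edgeSign u v := fun _ _ => rfl
  refine ⟨G, rfl, ⟨h.ne_ab, h.ne_bc, h.ne_ca, h.adj_bc, h.adj_ca, h.adj_ab⟩, hd, ?_, ?_⟩
  · rw [hsign, hsign, ← ha, ← hb, hGa, hGb, hGc]
    push_cast
    ring
  · rw [hsign, hsign, ← ha, ← hc, hGa, hGb, hGc]
    push_cast
    ring

end Diagram

/-! ### Orthogonality to the `A6T` relators and invariance under `R₃`-moves -/

open Diagram

theorem Diagram.Sub.triangleMove {σ π : Type*} [Group π] {α β : Type*} {D : Diagram σ π α}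
    {D' : Diagram σ π β} {f : β → α} (H : D'.Sub D f) (a b c : β) (i j k : Bool) :
    (D'.triangleMove a b c i j k).Sub (D.triangleMove (f a) (f b) (f c) i j k) f :=
  ((H.flip (b, !k) (c, !j)).flip (c, j) (a, i)).flip (a, !i) (b, k)

/-- A unit of ℤ is its own inverse, so a factor is removed by multiplying by it once more. -/
theorem Fintype.prod_units_ne {α : Type*} [Fintype α] (f : α → ℤˣ) (x : α)
    [Fintype {y | y ≠ x}] : ∏ y : {y | y ≠ x}, f y = (∏ y, f y) * f x := by
  classical
  rw [← Finset.mul_prod_erase Finset.univ f (Finset.mem_univ x), mul_right_comm,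
    Int.units_mul_self, one_mul]
  exact (Finset.prod_subtype (Finset.univ.erase x) (by simp) f).symm

namespace DiagramSeries

variable {π : Type*} [Group π] {α β : Type*}

/-- S and T are adjoint: the ratio of automorphism numbers in S compensates the two normalizations
of the pairing. -/
theorem pairing_arrowPart (𝒜 : DiagramSeries Unit π) (x : GaussClass π →₀ ℚ) :
    𝒜.pairing (arrowPart x) = (gaussSeries 𝒜).pairing x := by
  have h0 : ∀ x y : GaussClass π →₀ ℚ, arrowPart (x + y) = arrowPart x + arrowPart y :=
    fun x y => Finsupp.sum_add_index' (by simp) (by intros; rw [mul_add, Finsupp.single_add])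
  induction x using Finsupp.induction_linear with
  | zero => simp [arrowPart, pairing]
  | add x y hx hy => rw [h0, pairing_add, pairing_add, hx, hy]
  | single G q =>
    have h : (G.autCard : ℚ) ≠ 0 := Nat.cast_ne_zero.2 G.autCard_ne_zero
    rw [arrowPart, Finsupp.sum_single_index (by simp), pairing_single, pairing_single]
    show _ = _ * (_ * (_ / _) * _) * _
    field_simp

theorem pairing_sum {σ : Type*} (𝒮 : DiagramSeries σ π) {ι : Type*} (s : Finset ι)
    (f : ι → DiagramClass σ π →₀ ℚ) : 𝒮.pairing (∑ n ∈ s, f n) = ∑ n ∈ s, 𝒮.pairing (f n) :=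
  map_sum 𝒮.pairingLinear f s

theorem pairing_sub {σ : Type*} (𝒮 : DiagramSeries σ π) (x y : DiagramClass σ π →₀ ℚ) :
    𝒮.pairing (x - y) = 𝒮.pairing x - 𝒮.pairing y :=
  map_sub 𝒮.pairingLinear x y

/-- The change of the value of a series on a diagram without the arrow `x`, in a move. -/
def changeWithout {σ : Type*} (𝒮 : DiagramSeries σ π) [Finite α] (D D' : Diagram σ π α) (x : α) : ℚ :=
  𝒮.value (D.restrict {y | y ≠ x}) - 𝒮.value (D'.restrict {y | y ≠ x})

theorem value_gaussSeries_without (𝒜 : DiagramSeries Unit π) [Fintype α] (G : GaussDiagram π α)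
    (x : α) : (gaussSeries 𝒜).value (G.restrict {y | y ≠ x}) =
      (((∏ y, G.deco y) * G.deco x : ℤˣ) : ℤ) * 𝒜.value (G.forget.restrict {y | y ≠ x}) := by
  have := Fintype.ofFinite {y | y ≠ x}
  rw [value_gaussSeries, ← Fintype.prod_units_ne]
  rfl

theorem changeWithout_eq (𝒜 : DiagramSeries Unit π) [Fintype α] {G : GaussDiagram π α} {a b c : α}
    {i j k : Bool} (h : G.Triangle a b c i j k) :
    (gaussSeries 𝒜).changeWithout G (G.triangleMove a b c i j k) a =
      ((((∏ y, G.deco y) * G.deco a : ℤˣ) : ℤ) * G.edgeSign (b, !k) (c, !j) : ℤ) *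
        𝒜.edgeTerm G.forget a (b, !k) (c, !j) := by
  have h1 : (G.edgeSign (b, !k) (c, !j) : ℚ) * G.edgeSign (b, !k) (c, !j) = 1 := by
    rcases G.edgeSign_eq_or (b, !k) (c, !j) with h | h <;> rw [h] <;> norm_num
  have h2 : G.forget.edgeSign (b, !k) (c, !j) = G.edgeSign (b, !k) (c, !j) := rfl
  rw [changeWithout, restrict_triangleMove h (by simp), value_gaussSeries_without,
    value_gaussSeries_without, edgeTerm, h2, forget_flip]
  have h3 : (G.flip (b, !k) (c, !j)).deco = G.deco := rfl
  rw [h3, Int.cast_mul]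
  linear_combination -((((∏ y, G.deco y) * G.deco a : ℤˣ) : ℤ) : ℚ) *
    (𝒜.value (G.forget.restrict {y | y ≠ a}) -
      𝒜.value ((G.forget.flip (b, !k) (c, !j)).restrict {y | y ≠ a})) * h1

/-- The sum of the changes of the values without one of the three arrows. -/
def changeWithoutOne {σ : Type*} (𝒮 : DiagramSeries σ π) [Finite α] (D D' : Diagram σ π α) (a b c : α) :
    ℚ :=
  𝒮.changeWithout D D' a + 𝒮.changeWithout D D' b + 𝒮.changeWithout D D' c

/-- The sign in front of the term without x is sign(G) w(x) times ε of the edge opposite to x. It is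
the same for the three arrows precisely because w(e)ε(e) is constant on the triangle. -/
theorem changeWithoutOne_eq (𝒜 : DiagramSeries Unit π) [Fintype α] {G : GaussDiagram π α}
    {a b c : α} {i j k : Bool} (h : G.SignedTriangle a b c i j k) :
    (gaussSeries 𝒜).changeWithoutOne G (G.triangleMove a b c i j k) a b c =
      ((((∏ y, G.deco y) * G.deco a : ℤˣ) : ℤ) * G.edgeSign (b, !k) (c, !j) : ℤ) *
        𝒜.sixTerm G.forget a b c i j k := by
  have ha := 𝒜.changeWithout_eq h.toTriangle
  have hb := 𝒜.changeWithout_eq h.rotate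
  have hc := 𝒜.changeWithout_eq h.rotate.rotate
  rw [h.rotate.move_rotate] at hc
  rw [h.move_rotate] at hb hc
  simp only [Bool.not_not] at hb hc
  have sq : ∀ x, ((G.deco x : ℤˣ) : ℤ) * (G.deco x : ℤˣ) = 1 := fun x => by
    rw [← Units.val_mul, Int.units_mul_self, Units.val_one]
  have hca := h.sign_ca
  have hab := h.sign_ab
  rw [Units.val_mul, Units.val_mul] at hca hab
  have eb : ((((∏ y, G.deco y) * G.deco b : ℤˣ) : ℤ) * G.edgeSign (c, j) (a, i) : ℤ) =
      ((((∏ y, G.deco y) * G.deco a : ℤˣ) : ℤ) * G.edgeSign (b, !k) (c, !j) : ℤ) := by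
    rw [Units.val_mul, Units.val_mul]
    have s1 := sq a
    have s2 := sq b
    have s3 := sq c
    generalize (G.deco a : ℤ) = x at *
    generalize (G.deco b : ℤ) = y at *
    generalize (G.deco c : ℤ) = z at *
    generalize G.edgeSign (c, j) (a, i) = e at *
    generalize G.edgeSign (b, !k) (c, !j) = e' at *
    -- Multiply the equality z x e = y z e' by x y z and drop the squares of writhes.
    have : y * e = x * e' := by
      linear_combination (x * y * z) * hca - y * e * x * x * s3 - y * e * s1 +
        x * e' * z * z * s2 + x * e' * s3
    rw [mul_assoc, this, mul_assoc]
  have ec : ((((∏ y, G.deco y) * G.deco c : ℤˣ) : ℤ) * G.edgeSign (a, !i) (b, k) : ℤ) =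
      ((((∏ y, G.deco y) * G.deco a : ℤˣ) : ℤ) * G.edgeSign (b, !k) (c, !j) : ℤ) := by
    rw [Units.val_mul, Units.val_mul]
    have s1 := sq a
    have s2 := sq b
    have s3 := sq c
    generalize (G.deco a : ℤ) = x at *
    generalize (G.deco b : ℤ) = y at *
    generalize (G.deco c : ℤ) = z at *
    generalize G.edgeSign (a, !i) (b, k) = e at *
    generalize G.edgeSign (b, !k) (c, !j) = e' at *
    have : z * e = x * e' := by
      linear_combination (x * y * z) * hab - z * e * x * x * s2 - z * e * s1 +
        x * e' * z * z * s2 + x * e' * s3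
    rw [mul_assoc, this, mul_assoc]
  rw [changeWithoutOne, ha, hb, hc, sixTerm, eb, ec]
  ring

theorem coe_sign_ne_zero {σ : Type*} (D : Diagram σ π α) (e : ℤˣ) (u v : α × Bool) :
    (((e : ℤ) * D.edgeSign u v : ℤ) : ℚ) ≠ 0 := by
  rw [Int.cast_ne_zero]
  refine mul_ne_zero e.ne_zero ?_
  rcases D.edgeSign_eq_or u v with h | h <;> rw [h] <;> decide

theorem edgeTerm_eq_of_sub (𝒜 : DiagramSeries Unit π) [Finite α] [Finite β] {A : ArrowDiagram π α}
    {B : ArrowDiagram π β} {e : α ≃ β} (H : Diagram.Sub A B e) (x y z : α) (i j : Bool) :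
    𝒜.edgeTerm B (e x) (e y, i) (e z, j) = 𝒜.edgeTerm A x (y, i) (z, j) := by
  have hr : Set.range (e ∘ (Subtype.val : {y | y ≠ x} → α)) = {y | y ≠ e x} := by
    rw [Set.range_comp, Subtype.range_coe]
    ext w
    simp [Set.mem_image_equiv, Equiv.symm_apply_eq]
  have hf := 𝒜.value_restrict
    (((A.flip (y, i) (z, j)).sub_restrict _).trans (H.flip (y, i) (z, j))) hr
  simp only [Prod.map_apply, id] at hf
  rw [edgeTerm, edgeTerm, H.edgeSign, 𝒜.value_restrict ((A.sub_restrict _).trans H) hr, hf]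

/-- Each relator pairs with 𝒜 to a nonzero sign times a six term expression. Conversely, any
triangle with distinct numbers of heads carries writhes that make it the site of a move, after its
arrows are numbered. -/
theorem isOrthogonalToA6T_iff (𝒜 : DiagramSeries Unit π) :
    IsOrthogonalToA6T 𝒜 ↔ 𝒜.SixTermRelations := by
  have hrel : ∀ {n : ℕ} (G : GaussDiagram π (Fin n)) (p : Fin 3 → Fin n × Bool) (a : Fin 3 → Fin n),
      𝒜.pairing (arrowPart (g6t G p a)) =
        (gaussSeries 𝒜).changeWithoutOne G (r3Move G p) (a 0) (a 1) (a 2) := by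
    intro n G p a
    rw [pairing_arrowPart, g6t, pairing_sum, Fin.sum_univ_three]
    simp only [pairing_sub]
    rfl
  constructor
  · intro h α _ A a b c i j k hd hT
    set e := Finite.equivFin α
    have hT' : (A.map e).Triangle (e a) (e b) (e c) i j k :=
      (A.sub_map_symm e).triangle (by simpa using hT)
    obtain ⟨G, hG, hS⟩ := hT'.exists_signedTriangle hd
    obtain ⟨p, hp, hm⟩ := hS.exists_site
    have h1 := h _ (Submodule.subset_span ⟨_, G, p, _, hp, rfl⟩)
    rw [hrel, hm] at h1
    simp only [Matrix.cons_val] at h1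
    rw [𝒜.changeWithoutOne_eq hS, hG] at h1
    have h2 := (mul_eq_zero.1 h1).resolve_left (coe_sign_ne_zero _ _ _ _)
    simp only [sixTerm, 𝒜.edgeTerm_eq_of_sub (A.sub_map e)] at h2
    exact h2
  · intro h r hr
    have : Submodule.span ℚ (a6tRelators π) ≤ LinearMap.ker 𝒜.pairingLinear := by
      rw [Submodule.span_le]
      rintro _ ⟨n, G, p, a, hp, rfl⟩
      obtain ⟨i, j, k, hS, hm⟩ := exists_signedTriangle hp
      show 𝒜.pairing _ = 0
      rw [hrel, hm, 𝒜.changeWithoutOne_eq hS, h _ _ _ _ _ _ _ hS.heads hS.toTriangle.forget,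
        mul_zero]
    exact this hr

/-- The contribution to an `R₃`-move of the subdiagrams that contain all arrows except possibly one
of `a`, `b`, `c`. -/
def mainChange {σ : Type*} (𝒮 : DiagramSeries σ π) [Finite α] (D D' : Diagram σ π α) (a b c : α) : ℚ :=
  𝒮.value D - 𝒮.value D' + 𝒮.changeWithoutOne D D' a b c

/-- Regroups four terms of a sum over the subsets of arrows of a large diagram into the main change
of one subdiagram. The sets are free variables so that coercions of finite sets can be inserted. -/
theorem mainChange_eq_of_sub {σ : Type*} (𝒮 : DiagramSeries σ π) [Finite α] [Finite β]
    {D E : Diagram σ π α} {D' E' : Diagram σ π β} {f : β → α} (H : D'.Sub D f) (K : E'.Sub E f)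
    {S Sa Sb Sc : Set α} (a b c : β) (hS : Set.range f = S)
    (ha : Sa = S \ {f a}) (hb : Sb = S \ {f b}) (hc : Sc = S \ {f c}) :
    (𝒮.value (D.restrict S) - 𝒮.value (E.restrict S)) +
      (𝒮.value (D.restrict Sa) - 𝒮.value (E.restrict Sa)) +
      (𝒮.value (D.restrict Sb) - 𝒮.value (E.restrict Sb)) +
      (𝒮.value (D.restrict Sc) - 𝒮.value (E.restrict Sc)) = 𝒮.mainChange D' E' a b c := by
  have hr : ∀ x, Set.range (f ∘ (Subtype.val : {y | y ≠ x} → β)) = S \ {f x} := by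
    intro x
    rw [Set.range_comp, Subtype.range_coe, ← hS]
    ext w
    constructor
    · rintro ⟨y, hy, rfl⟩
      exact ⟨⟨y, rfl⟩, fun h => hy (H.injective h)⟩
    · rintro ⟨⟨y, rfl⟩, hy⟩
      exact ⟨y, fun h => hy (congrArg f h), rfl⟩
  have hD : ∀ x, 𝒮.value (D.restrict (S \ {f x})) = 𝒮.value (D'.restrict {y | y ≠ x}) := fun x =>
    𝒮.value_restrict ((D'.sub_restrict _).trans H) (hr x)
  have hE : ∀ x, 𝒮.value (E.restrict (S \ {f x})) = 𝒮.value (E'.restrict {y | y ≠ x}) := fun x =>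
    𝒮.value_restrict ((E'.sub_restrict _).trans K) (hr x)
  rw [ha, hb, hc, hD, hD, hD, hE, hE, hE, 𝒮.value_restrict H hS, 𝒮.value_restrict K hS,
    mainChange, changeWithoutOne, changeWithout, changeWithout, changeWithout]
  ring

end DiagramSeries

/-- A set containing at least two of the three elements is obtained in exactly one way from a set
`U` containing all three, by removing nothing or one of them. -/
theorem Finset.sum_powerset_eq_of_three {α : Type*} [Fintype α] [DecidableEq α] {a b c : α}
    (hab : a ≠ b) (hbc : b ≠ c) (hca : c ≠ a) (f : Finset α → ℚ)
    (hf : ∀ S, (a ∉ S ∧ b ∉ S) ∨ (b ∉ S ∧ c ∉ S) ∨ (c ∉ S ∧ a ∉ S) → f S = 0) :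
    ∑ S, f S = ∑ U : Finset α with a ∈ U ∧ b ∈ U ∧ c ∈ U,
      (f U + f (U.erase a) + f (U.erase b) + f (U.erase c)) := by
  have key : ∀ {x y z : α}, x ≠ y → x ≠ z → ∑ U : Finset α with x ∈ U ∧ y ∈ U ∧ z ∈ U, f (U.erase x) =
      ∑ S : Finset α with x ∉ S ∧ y ∈ S ∧ z ∈ S, f S := by
    intro x y z hxy hxz
    refine Finset.sum_nbij' (fun U => U.erase x) (fun S => insert x S) ?_ ?_ ?_ ?_ ?_
    · intro U hU
      simp_all [hxy.symm, hxz.symm]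
    · intro S hS
      simp_all
    · intro U hU
      simp only [mem_filter] at hU
      exact insert_erase hU.2.1
    · intro S hS
      simp only [mem_filter] at hS
      exact erase_insert hS.2.1
    · intro U hU
      rfl
  have e1 : (univ.filter fun U : Finset α => a ∈ U ∧ b ∈ U ∧ c ∈ U) =
      univ.filter fun U : Finset α => b ∈ U ∧ c ∈ U ∧ a ∈ U := by
    ext U; simp only [mem_filter]; tauto
  have e2 : (univ.filter fun U : Finset α => a ∈ U ∧ b ∈ U ∧ c ∈ U) =
      univ.filter fun U : Finset α => c ∈ U ∧ a ∈ U ∧ b ∈ U := by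
    ext U; simp only [mem_filter]; tauto
  rw [sum_add_distrib, sum_add_distrib, sum_add_distrib, key hab hca.symm]
  rw [show (∑ U : Finset α with a ∈ U ∧ b ∈ U ∧ c ∈ U, f (U.erase b)) = _ from by rw [e1, key hbc hab.symm]]
  rw [show (∑ U : Finset α with a ∈ U ∧ b ∈ U ∧ c ∈ U, f (U.erase c)) = _ from by rw [e2, key hca hbc.symm]]
  simp only [sum_filter]
  rw [← sum_add_distrib, ← sum_add_distrib, ← sum_add_distrib]
  refine sum_congr rfl fun S _ => ?_
  have := hf S
  by_cases ha : a ∈ S <;> by_cases hb : b ∈ S <;> by_cases hc : c ∈ S <;> simp_all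

namespace DiagramSeries

variable {π : Type*} [Group π] {α β : Type*}

theorem diagramInvariant_eq (𝒜 : DiagramSeries Unit π) [Fintype α] (G : GaussDiagram π α) :
    diagramInvariant 𝒜 G = ∑ S : Finset α, (gaussSeries 𝒜).value (G.restrict (S : Set α)) := by
  rw [diagramInvariant, subdiagramSum, pairing_sum]
  rfl

theorem diagramInvariant_eq_of_sub (𝒜 : DiagramSeries Unit π) [Fintype α] [Fintype β]
    {G : GaussDiagram π α} {G' : GaussDiagram π β} {e : α ≃ β} (H : G.Sub G' e) :
    diagramInvariant 𝒜 G' = diagramInvariant 𝒜 G := by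
  rw [diagramInvariant_eq, diagramInvariant_eq]
  refine (Fintype.sum_equiv e.finsetCongr _ _ fun S => ?_).symm
  refine ((gaussSeries 𝒜).value_restrict ((G.sub_restrict (S : Set α)).trans H) ?_).symm
  rw [Set.range_comp, Subtype.range_coe]
  ext
  simp

/-- A subdiagram that misses two of the three arrows is unchanged by the move, since every exchange
involves one of these two. The other subdiagrams are grouped by `U`; the inner `if` only supplies
the membership proofs. -/
theorem diagramInvariant_sub (𝒜 : DiagramSeries Unit π) [Fintype α] [DecidableEq α]
    {G : GaussDiagram π α} {a b c : α} {i j k : Bool} (h : G.Triangle a b c i j k) :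
    diagramInvariant 𝒜 G - diagramInvariant 𝒜 (G.triangleMove a b c i j k) =
      ∑ U : Finset α with a ∈ U ∧ b ∈ U ∧ c ∈ U,
        if hU : a ∈ U ∧ b ∈ U ∧ c ∈ U then
          (gaussSeries 𝒜).mainChange (G.restrict (U : Set α))
            ((G.restrict (U : Set α)).triangleMove ⟨a, hU.1⟩ ⟨b, hU.2.1⟩ ⟨c, hU.2.2⟩ i j k)
            ⟨a, hU.1⟩ ⟨b, hU.2.1⟩ ⟨c, hU.2.2⟩ else 0 := by
  set G' := G.triangleMove a b c i j k with hG'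
  rw [diagramInvariant_eq, diagramInvariant_eq, ← Finset.sum_sub_distrib,
    Finset.sum_powerset_eq_of_three h.ne_ab h.ne_bc h.ne_ca]
  · refine Finset.sum_congr rfl fun U hU => ?_
    simp only [Finset.mem_filter, Finset.mem_univ, true_and] at hU
    rw [dif_pos hU]
    have hs := G.sub_restrict (U : Set α)
    exact (gaussSeries 𝒜).mainChange_eq_of_sub hs (hs.triangleMove ⟨a, hU.1⟩ ⟨b, hU.2.1⟩ ⟨c, hU.2.2⟩ i j k)
      ⟨a, hU.1⟩ ⟨b, hU.2.1⟩ ⟨c, hU.2.2⟩ Subtype.range_coe (Finset.coe_erase _ _)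
      (Finset.coe_erase _ _) (Finset.coe_erase _ _)
  · intro S hS
    rw [sub_eq_zero, hG']
    rcases hS with hS | hS | hS
    · rw [restrict_triangleMove_of_not_mem h (by simpa using hS.1) (Or.inl (by simpa using hS.2))]
    · rw [← h.move_rotate, restrict_triangleMove_of_not_mem h.rotate (by simpa using hS.1)
        (Or.inl (by simpa using hS.2))]
    · rw [restrict_triangleMove_of_not_mem h (by simpa using hS.2) (Or.inr (by simpa using hS.1))]

theorem mainChange_eq (𝒜 : DiagramSeries Unit π) [Fintype α] {G : GaussDiagram π α}
    {a b c : α} {i j k : Bool} (h : G.SignedTriangle a b c i j k) :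
    (gaussSeries 𝒜).mainChange G (G.triangleMove a b c i j k) a b c =
      ((∏ y, G.deco y : ℤˣ) : ℤ) *
        (𝒜.value G.forget - 𝒜.value (G.forget.triangleMove a b c i j k)) +
      ((((∏ y, G.deco y) * G.deco a : ℤˣ) : ℤ) * G.edgeSign (b, !k) (c, !j) : ℤ) *
        𝒜.sixTerm G.forget a b c i j k := by
  rw [mainChange, 𝒜.changeWithoutOne_eq h, value_gaussSeries, value_gaussSeries, mul_sub]
  rfl

theorem SixTermRelations.isR3Invariant {𝒜 : DiagramSeries Unit π} (h6 : 𝒜.SixTermRelations)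
    (hR2 : SatisfiesR2 𝒜) : IsR3Invariant 𝒜 := by
  classical
  intro n G p a hp
  obtain ⟨i, j, k, hS, hm⟩ := exists_signedTriangle hp
  rw [hm, ← sub_eq_zero, diagramInvariant_sub 𝒜 hS.toTriangle]
  refine Finset.sum_eq_zero fun U hU => ?_
  simp only [Finset.mem_filter, Finset.mem_univ, true_and] at hU
  rw [dif_pos hU]
  have hS' : (G.restrict (U : Set (Fin n))).SignedTriangle ⟨a 0, hU.1⟩ ⟨a 1, hU.2.1⟩
      ⟨a 2, hU.2.2⟩ i j k := (G.sub_restrict _).signedTriangle hS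
  have := Fintype.ofFinite (U : Set (Fin n))
  rw [mainChange_eq 𝒜 hS', h6.value_triangleMove hR2 hS'.heads hS'.toTriangle.forget,
    h6 _ _ _ _ _ _ _ hS'.heads hS'.toTriangle.forget]
  ring

theorem _root_.IsR3Invariant.diagramInvariant_eq {𝒜 : DiagramSeries Unit π} (h : IsR3Invariant 𝒜)
    [Fintype α] {G : GaussDiagram π α} {a b c : α} {i j k : Bool}
    (hS : G.SignedTriangle a b c i j k) :
    diagramInvariant 𝒜 G = diagramInvariant 𝒜 (G.triangleMove a b c i j k) := by
  set e := Finite.equivFin α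
  have hS' : (G.map e).SignedTriangle (e a) (e b) (e c) i j k :=
    (G.sub_map_symm e).signedTriangle (by simpa using hS)
  obtain ⟨p, hp, hm⟩ := hS'.exists_site
  have h1 := h _ _ _ _ hp
  rw [hm, 𝒜.diagramInvariant_eq_of_sub (G.sub_map e),
    𝒜.diagramInvariant_eq_of_sub ((G.sub_map e).triangleMove a b c i j k)] at h1
  exact h1

/-- In the total change, the terms with `U` a proper subset are main changes at smaller sites of the
same kind and vanish by induction. Only the term of the whole diagram is left. -/
theorem _root_.IsR3Invariant.mainChange_eq_zero {𝒜 : DiagramSeries Unit π} (h : IsR3Invariant 𝒜)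
    (n : ℕ) : ∀ {α : Type} [Fintype α], Fintype.card α = n → ∀ {G : GaussDiagram π α} {a b c : α}
      {i j k : Bool}, G.SignedTriangle a b c i j k →
      (gaussSeries 𝒜).mainChange G (G.triangleMove a b c i j k) a b c = 0 := by
  classical
  induction n using Nat.strong_induction_on with
  | _ n ih =>
    intro α _ hα G a b c i j k hS
    have h1 := diagramInvariant_sub 𝒜 hS.toTriangle
    rw [← h.diagramInvariant_eq hS, sub_self, Finset.sum_eq_single Finset.univ] at h1
    · rw [dif_pos (by simp)] at h1
      rw [h1]
      have hs := G.sub_restrict ((Finset.univ : Finset α) : Set α)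
      -- The subdiagram on all arrows is `G` only up to renaming; both main changes are computed
      -- inside `G`.
      have hid : G.Sub G id := G.sub_map (Equiv.refl α)
      have hid' := hid.triangleMove a b c i j k
      rw [← (gaussSeries 𝒜).mainChange_eq_of_sub hid hid' a b c Set.range_id rfl rfl rfl]
      exact (gaussSeries 𝒜).mainChange_eq_of_sub hs (hs.triangleMove ⟨a, by simp⟩ ⟨b, by simp⟩ ⟨c, by simp⟩ i j k)
        ⟨a, by simp⟩ ⟨b, by simp⟩ ⟨c, by simp⟩ (by simp) rfl rfl rfl
    · intro U hU hne
      simp only [Finset.mem_filter, Finset.mem_univ, true_and] at hU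
      rw [dif_pos hU]
      have := Fintype.ofFinite (U : Set α)
      refine ih _ ?_ rfl ((G.sub_restrict _).signedTriangle hS)
      rw [← hα]
      have h2 : Fintype.card (U : Set α) = U.card := by
        rw [← Nat.card_eq_fintype_card]
        simp
      rw [h2]
      exact (Finset.card_lt_iff_ne_univ U).2 hne
    · simp

/-- Reverse the writhes of `a`, `b`, `c`. Products over pairs of these arrows do not change, so the
site remains; the sign of the whole diagram is multiplied by (−1)³ and that of a diagram without one
of the three by (−1)². Adding the two vanishing main changes isolates the six term expression. -/
theorem _root_.IsR3Invariant.sixTermRelations {𝒜 : DiagramSeries Unit π} (h : IsR3Invariant 𝒜) :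
    𝒜.SixTermRelations := by
  classical
  intro α _ A a b c i j k hd hT
  have := Fintype.ofFinite α
  obtain ⟨G, rfl, hS⟩ := hT.exists_signedTriangle hd
  let s : α → ℤˣ := fun x => if x ∈ ({a, b, c} : Finset α) then -1 else 1
  have hs : ∏ x, s x = -1 := by
    rw [Finset.prod_ite_mem, Finset.univ_inter, Finset.prod_const,
      Finset.card_eq_three.2 ⟨a, b, c, hT.ne_ab, hT.ne_ca.symm, hT.ne_bc, rfl⟩]
    rfl
  have sa : s a = -1 := if_pos (by simp)
  have sb : s b = -1 := if_pos (by simp)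
  have sc : s c = -1 := if_pos (by simp)
  let G' : GaussDiagram π α := ⟨G.circle, fun x => s x * G.deco x⟩
  have hG' : ∀ x, G'.deco x = s x * G.deco x := fun _ => rfl
  have hP : ∏ x, G'.deco x = -∏ x, G.deco x := by
    simp only [hG', Finset.prod_mul_distrib, hs, neg_one_mul]
  have hsign : ∀ u v, G'.edgeSign u v = G.edgeSign u v := fun _ _ => rfl
  have hS' : G'.SignedTriangle a b c i j k := by
    refine ⟨⟨hT.ne_ab, hT.ne_bc, hT.ne_ca, hT.adj_bc, hT.adj_ca, hT.adj_ab⟩, hd, ?_, ?_⟩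
    · simpa [hsign, hG', sa, sb, sc] using hS.sign_ca
    · simpa [hsign, hG', sa, sb, sc] using hS.sign_ab
  have h1 := h.mainChange_eq_zero _ rfl hS
  have h2 := h.mainChange_eq_zero _ rfl hS'
  rw [mainChange_eq 𝒜 hS] at h1
  rw [mainChange_eq 𝒜 hS', hP, hG', sa, hsign] at h2
  have h3 : G'.forget = G.forget := rfl
  rw [h3] at h2
  have h4 := coe_sign_ne_zero G ((∏ y, G.deco y) * G.deco a) (b, !k) (c, !j)
  refine (mul_eq_zero.1 ?_).resolve_left h4
  simp only [one_mul, Units.val_neg, Int.cast_neg, neg_mul, mul_neg, neg_neg] at h2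
  linarith

end DiagramSeries

/-! ### Resolutions of degenerate diagrams -/

namespace DegenerateDiagram

variable {π : Type*} [Group π] {P P' α β : Type*}

/-- Only one pair of ends coincides, so any coinciding pair may serve as the degenerate one. -/
theorem eq_or_of_place_eq (D : DegenerateDiagram π P α) {u v : α × Bool} (huv : u ≠ v)
    (h : D.place u = D.place v) (w z : α × Bool) (hwz : D.place w = D.place z) :
    w = z ∨ (w = u ∧ z = v) ∨ (w = v ∧ z = u) := by
  obtain ⟨x, y, -, -, huniq⟩ := D.degenerate
  have h1 := huniq _ _ h
  have h2 := huniq _ _ hwz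
  grind

theorem place_map (D : DegenerateDiagram π P α) (f : P ≃ P') (e : α ≃ β) (x : α) (i : Bool) :
    (D.map f e).place (e x, i) = f (D.place (x, i)) := by
  simp [map]

theorem next_map (D : DegenerateDiagram π P α) (f : P ≃ P') (e : α ≃ β) (q : P) :
    (D.map f e).circle.next (f q) = f (D.circle.next q) := by
  simp [map, MarkedCircle.map]

/-- A degenerate diagram has no symmetry. -/
theorem eq_refl_of_map_eq {D : DegenerateDiagram π P α} {f : P ≃ P} {e : α ≃ α}
    (h : D.map f e = D) : f = Equiv.refl P ∧ e = Equiv.refl α := by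
  obtain ⟨x, y, hxy, hp, -⟩ := D.degenerate
  have hne : x ≠ y := fun h => hxy (congrArg Prod.fst h)
  have hu := D.eq_or_of_place_eq hne hp
  have hplace : ∀ x i, D.place (e x, i) = f (D.place (x, i)) := by
    intro x i
    rw [← D.place_map f e, h]
  have hnext : ∀ q, D.circle.next (f q) = f (D.circle.next q) := by
    intro q
    rw [← D.next_map f e, h]
  have hfx : f (D.place x) = D.place x := by
    have h1 := hplace x.1 x.2
    have h2 := hplace y.1 y.2
    rw [Prod.mk.eta] at h1 h2
    rcases hu (e x.1, x.2) (e y.1, y.2) (by rw [h1, h2, hp]) with h3 | h3 | h3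
    · exact absurd (e.injective (congrArg Prod.fst h3)) hxy
    · rw [← h1, h3.1]
    · rw [← h1, h3.1, hp]
  have hf : ∀ q, f q = q := by
    intro q
    obtain ⟨k, rfl⟩ := D.circle.connected (D.place x) q
    induction k with
    | zero => exact hfx
    | succ k ih => rw [Function.iterate_succ_apply', ← hnext, ih]
  refine ⟨Equiv.ext hf, Equiv.ext fun z => ?_⟩
  -- If `z` were moved, its head would meet the head of its image and its tail the tail of its
  -- image: two different coinciding pairs.
  have h1 : ∀ i, D.place (e z, i) = D.place (z, i) := fun i => (hplace z i).trans (hf _)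
  by_contra hez
  have h2 := fun i => (hu _ _ (h1 i)).resolve_left fun h => hez (congrArg Prod.fst h)
  have h3 := h2 true
  have h4 := h2 false
  grind

theorem toClass_eq_iff [Finite P] [Finite α] [Finite P'] [Finite β] {D : DegenerateDiagram π P α}
    {D' : DegenerateDiagram π P' β} :
    D.toClass = D'.toClass ↔ ∃ (f : P ≃ P') (e : α ≃ β), D.map f e = D' := by
  refine Quotient.eq.trans ?_
  constructor
  · rintro ⟨f, e, he⟩
    refine ⟨(Finite.equivFin P).trans (f.trans (Finite.equivFin P').symm),
      (Finite.equivFin α).trans (e.trans (Finite.equivFin β).symm), ?_⟩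
    rw [← map_map, ← map_map, he, map_map, Equiv.self_trans_symm, Equiv.self_trans_symm, map_refl]
  · rintro ⟨f, e, rfl⟩
    refine ⟨(Finite.equivFin P).symm.trans (f.trans (Finite.equivFin P')),
      (Finite.equivFin α).symm.trans (e.trans (Finite.equivFin β)), ?_⟩
    rw [map_map, map_map]
    congr 1 <;> ext x <;> simp

end DegenerateDiagram

namespace Diagram

variable {π : Type*} [Group π] {P P' α β : Type*}

/-- The degenerate diagram `D` is obtained from `A` by shrinking the edge with ends `u` and `v`. -/
structure IsCollapse (A : ArrowDiagram π α) (u v : α × Bool) (D : DegenerateDiagram π P α) :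
    Prop where
  ne : u.1 ≠ v.1
  adj : A.circle.Adj u v
  place : D.place u = D.place v
  sub : ∀ s : P → α × Bool, (∀ q, D.place (s q) = q) → D.circle.Sub A.circle s

namespace IsCollapse

variable {A B : ArrowDiagram π α} {u v : α × Bool} {D : DegenerateDiagram π P α}
  {D' : DegenerateDiagram π P' α}

theorem ne' (h : A.IsCollapse u v D) : u ≠ v := fun e => h.ne (congrArg Prod.fst e)

/-- It suffices to check one choice of representatives, since two choices differ at most by sliding
along the edge marked by 1. -/
theorem of_section (hne : u.1 ≠ v.1) (hadj : A.circle.Adj u v) (hp : D.place u = D.place v)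
    {s : P → α × Bool} (hs : ∀ q, D.place (s q) = q) (H : D.circle.Sub A.circle s) :
    A.IsCollapse u v D :=
  ⟨hne, hadj, hp, fun _ ht => H.of_section
    (D.eq_or_of_place_eq (fun e => hne (congrArg Prod.fst e)) hp) hadj hs ht⟩

theorem symm (h : A.IsCollapse u v D) : A.IsCollapse v u D :=
  ⟨h.ne.symm, h.adj.symm, h.place.symm, h.sub⟩

theorem _root_.DegenerateDiagram.exists_section (D : DegenerateDiagram π P α) (u v : α × Bool)
    (huv : u ≠ v) (h : D.place u = D.place v) :
    ∃ s : P → α × Bool, (∀ q, D.place (s q) = q) ∧ (∀ q, s q ≠ v) ∧ ∀ x, x ≠ v → s (D.place x) = x := by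
  have hex : ∀ q, ∃ x, D.place x = q ∧ x ≠ v := by
    intro q
    obtain ⟨x, rfl⟩ := D.surj q
    by_cases hx : x = v
    · exact ⟨u, by rw [hx, h], huv⟩
    · exact ⟨x, rfl, hx⟩
  choose s hs hsv using hex
  refine ⟨s, hs, hsv, fun x hx => ?_⟩
  rcases D.eq_or_of_place_eq huv h _ _ (hs (D.place x)) with h1 | h1 | h1
  · exact h1
  · exact absurd h1.2 hx
  · exact absurd h1.1 (hsv _)

theorem map (h : A.IsCollapse u v D) (f : P ≃ P') (e : α ≃ β) :
    (A.map e).IsCollapse (e u.1, u.2) (e v.1, v.2) (D.map f e) := by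
  obtain ⟨s, hs, -⟩ := D.exists_section u v h.ne' h.place
  refine of_section (s := fun q => (e (s (f.symm q)).1, (s (f.symm q)).2)) ?_ ?_ ?_ ?_ ?_
  · simpa using h.ne
  · show (A.circle.map _).Adj _ _
    rw [MarkedCircle.adj_map]
    simpa using h.adj
  · rw [DegenerateDiagram.place_map, DegenerateDiagram.place_map, Prod.mk.eta, Prod.mk.eta, h.place]
  · intro q
    rw [DegenerateDiagram.place_map, Prod.mk.eta, hs, Equiv.apply_symm_apply]
  · exact ((h.sub s hs).map_left f).map_right _

theorem congr (h : A.IsCollapse u v D) {u' v' : α × Bool} (hu : u = u') (hv : v = v') :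
    A.IsCollapse u' v' D := by
  rwa [← hu, ← hv]

theorem flip (h : A.IsCollapse u v D) : (A.flip u v).IsCollapse u v D := by
  classical
  obtain ⟨s, hs, hsv, -⟩ := D.exists_section u v h.ne' h.place
  exact of_section h.ne (adj_flip_self h.adj) h.place hs
    ((h.sub s hs).of_map_swap h.adj (Or.inr fun ⟨q, hq⟩ => hsv q hq))

/-- A diagram is determined by a degenerate diagram and the order of the ends at the degenerate
point. -/
theorem unique (hA : A.IsCollapse u v D) (hB : B.IsCollapse u v D)
    (hAu : A.circle.next u = v ∧ A.circle.mark u = 1)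
    (hBu : B.circle.next u = v ∧ B.circle.mark u = 1) : A = B := by
  obtain ⟨s, hs, hsv, hsx⟩ := D.exists_section u v hA.ne' hA.place
  have key : ∀ {A : ArrowDiagram π α}, A.IsCollapse u v D →
      (A.circle.next u = v ∧ A.circle.mark u = 1) → ∀ x, x ≠ u →
      A.circle.next x = s (D.circle.next (D.place x)) ∧
        A.circle.mark x = D.circle.mark (D.place x) := by
    intro A hA hAu x hx
    have hmem : ∀ y, y ≠ v → y ∈ Set.range s := fun y hy => ⟨D.place y, hsx y hy⟩
    have hvr : v ∉ Set.range s := fun ⟨q, hq⟩ => hsv q hq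
    have hnx : A.circle.next x ≠ v := by
      rw [← hAu.1]
      exact fun h => hx (A.circle.next_injective h)
    have h1 : A.circle.Run (Set.range s) x (A.circle.mark x) (A.circle.next x) :=
      .last (hmem _ hnx)
    have h2 := (hA.sub s hs).run (D.place x)
    -- The section represents the degenerate point by `u`. The edge that leaves `v` is therefore
    -- read in `D` from `u`, through the edge marked by 1.
    by_cases hxv : x = v
    · rw [hxv, ← hA.place, hsx u hA.ne'] at h2
      have h3 : A.circle.Run (Set.range s) u (A.circle.mark u * A.circle.mark x)
          (A.circle.next x) := by
        refine .step (by rwa [hAu.1]) ?_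
        rwa [hAu.1, ← hxv]
      rw [hAu.2, one_mul] at h3
      rw [hxv, ← hA.place, ← hxv]
      exact ⟨(h3.unique h2).2, (h3.unique h2).1⟩
    · rw [hsx x hxv] at h2
      exact ⟨(h1.unique h2).2, (h1.unique h2).1⟩
  refine ext_of (MarkedCircle.ext_total (fun x => ?_) (fun x => ?_) ?_) fun _ => rfl
  · by_cases hx : x = u
    · rw [hx, hAu.1, hBu.1]
    · rw [(key hA hAu x hx).1, (key hB hBu x hx).1]
  · by_cases hx : x = u
    · rw [hx, hAu.2, hBu.2]
    · rw [(key hA hAu x hx).2, (key hB hBu x hx).2]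
  · rw [← (hA.sub s hs).total, ← (hB.sub s hs).total]

theorem exists_map_eq (h : A.IsCollapse u v D) (h' : A.IsCollapse u v D') :
    ∃ f : P ≃ P', D.map f (Equiv.refl α) = D' := by
  obtain ⟨s, hs, hsv, hsx⟩ := D.exists_section u v h.ne' h.place
  obtain ⟨s', hs', hsv', hsx'⟩ := D'.exists_section u v h'.ne' h'.place
  let f : P ≃ P' := ⟨fun q => D'.place (s q), fun q => D.place (s' q),
    fun q => by dsimp only; rw [hsx' _ (hsv q), hs], fun q => by dsimp only; rw [hsx _ (hsv' q), hs']⟩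
  refine ⟨f, DegenerateDiagram.ext_of ?_ ?_⟩
  · refine ((h.sub s hs).map_left f).unique (h'.sub _ fun q => ?_)
    exact f.apply_symm_apply q
  · funext x
    show D'.place (s (D.place x)) = D'.place x
    by_cases hx : x = v
    · rw [hx, ← h.place, hsx u h.ne', h'.place]
    · rw [hsx x hx]

end IsCollapse

theorem _root_.DegenerateDiagram.exists_isCollapse (D : DegenerateDiagram π P α) {u v : α × Bool}
    (hne : u.1 ≠ v.1) (h : D.place u = D.place v) : ∃ A : ArrowDiagram π α, A.IsCollapse u v D := by
  have huv : u ≠ v := fun e => hne (congrArg Prod.fst e)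
  obtain ⟨C, h1, h2, -, -, h3⟩ := D.circle.exists_split D.place D.surj huv h
    (D.eq_or_of_place_eq huv h)
  exact ⟨⟨C, fun _ => ()⟩, hne, Or.inl ⟨h1, h2⟩, h, h3⟩

theorem isCollapse_shrink (A : ArrowDiagram π α) {p : α × Bool} (h : A.IsNice p) :
    A.IsCollapse p (A.circle.next p) (A.shrink p h.2) := by
  have hne : A.circle.next p ≠ p := fun e => h.2 (congrArg Prod.fst e).symm
  refine IsCollapse.of_section h.2 (Or.inl ⟨rfl, h.1⟩) ?_ (s := Subtype.val) ?_
    (A.circle.sub_restrict _)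
  · simp [shrink, hne]
  · intro q
    simp [shrink, show (q : α × Bool) ≠ p from q.2]

theorem next_flip {A : ArrowDiagram π α} {u v : α × Bool}
    (h : A.circle.next u = v ∧ A.circle.mark u = 1) :
    (A.flip u v).circle.next v = u ∧ (A.flip u v).circle.mark v = 1 := by
  simp [flip, permute, MarkedCircle.map, h]

theorem next_map {A : ArrowDiagram π α} {u v : α × Bool} (e : α ≃ β)
    (h : A.circle.next u = v ∧ A.circle.mark u = 1) :
    (A.map e).circle.next (e u.1, u.2) = (e v.1, v.2) ∧ (A.map e).circle.mark (e u.1, u.2) = 1 := by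
  simp [map, MarkedCircle.map, h, Prod.map]

/-- The isomorphisms between `D` and the degenerate diagrams obtained from `B`. -/
theorem IsCollapse.exists_map_eq_shrink_iff {A : ArrowDiagram π α} {u v : α × Bool}
    {D : DegenerateDiagram π P α} (h : A.IsCollapse u v D)
    (hu : A.circle.next u = v ∧ A.circle.mark u = 1) (B : ArrowDiagram π β) (p : β × Bool)
    (e : α ≃ β) :
    (∃ (hp : B.IsNice p) (f : P ≃ {x : β × Bool | x ≠ p}), D.map f e = B.shrink p hp.2) ↔
      (p = (e u.1, u.2) ∧ A.map e = B) ∨ (p = (e v.1, v.2) ∧ (A.flip u v).map e = B) := by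
  constructor
  · rintro ⟨hp, f, hf⟩
    have hB := B.isCollapse_shrink hp
    rw [← hf] at hB
    have hBp := hp.1
    have hA := h.map f e
    rcases (D.map f e).eq_or_of_place_eq hA.ne' hA.place _ _ hB.place with h1 | h1 | h1
    · exact absurd h1 hB.ne'
    · rw [h1.1] at hBp
      exact Or.inl ⟨h1.1, hA.unique (hB.congr h1.1 h1.2) (next_map e hu)
        ⟨by rw [← h1.1]; exact h1.2, hBp⟩⟩
    · rw [h1.1] at hBp
      exact Or.inr ⟨h1.1, (h.flip.map f e).symm.unique (hB.congr h1.1 h1.2)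
        (next_map e (next_flip hu)) ⟨by rw [← h1.1]; exact h1.2, hBp⟩⟩
  · have key : ∀ {A : ArrowDiagram π α} {u v : α × Bool}, A.IsCollapse u v D →
        (A.circle.next u = v ∧ A.circle.mark u = 1) → p = (e u.1, u.2) → A.map e = B →
        ∃ (hp : B.IsNice p) (f : P ≃ {x : β × Bool | x ≠ p}), D.map f e = B.shrink p hp.2 := by
      rintro A u v h hu rfl rfl
      have h1 := next_map e hu
      have hp : (A.map e).IsNice (e u.1, u.2) := ⟨h1.2, by rw [h1.1]; simpa using h.ne⟩
      have h2 := ((A.map e).isCollapse_shrink hp).congr rfl h1.1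
      obtain ⟨f, hf⟩ := (h.map (Equiv.refl P) e).exists_map_eq h2
      exact ⟨hp, f, by rw [← hf, DegenerateDiagram.map_map]; rfl⟩
    rintro (⟨h1, h2⟩ | ⟨h1, h2⟩)
    · exact key h hu h1 h2
    · exact key h.flip.symm (next_flip hu) h1 h2

open Classical in
-- The isomorphisms from `A` to the chosen representative are either none or as many as its
-- automorphisms. This is how the factor |Aut A| of the pairing arises from d.
theorem card_map_eq (A : ArrowDiagram π α) [Finite α] (c : ArrowClass π) :
    (Nat.card {e : α ≃ Fin (Quotient.out c).1 // A.map e = (Quotient.out c).2}) =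
      if c = A.toClass then c.autCard else 0 := by
  have hc : (Quotient.out c).2.toClass = c := by
    conv_rhs => rw [← Quotient.out_eq c]
    exact Quotient.sound ⟨(Finite.equivFin _).symm, by rw [map_map, Equiv.self_trans_symm, map_refl]⟩
  have hcard : c.autCard = (Quotient.out c).2.autCard := by
    conv_lhs => rw [← Quotient.out_eq c]
    rfl
  split_ifs with h
  · rw [← hc, eq_comm, toClass_eq_iff] at h
    obtain ⟨e₀, he₀⟩ := h
    rw [hcard, autCard]
    refine Nat.card_congr (Equiv.subtypeEquiv (Equiv.equivCongr e₀ (Equiv.refl _)) fun e => ?_)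
    rw [← he₀, map_map]
    have : e₀.trans ((Equiv.equivCongr e₀ (Equiv.refl _)) e) = e := by
      ext x
      simp [Equiv.equivCongr]
    rw [this, he₀]
  · refine Nat.card_eq_zero.2 (Or.inl ⟨fun ⟨e, he⟩ => h ?_⟩)
    rw [← hc, eq_comm, toClass_eq_iff]
    exact ⟨e, he⟩

theorem IsCollapse.epsilon_map {A : ArrowDiagram π α} {u v : α × Bool}
    (hu : A.circle.next u = v ∧ A.circle.mark u = 1) (e : α ≃ β) :
    (A.map e).epsilon (e u.1, u.2) = A.edgeSign u v := by
  rw [epsilon_eq, (next_map e hu).1]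
  exact (A.sub_map e).edgeSign _ _ _ _

open Classical in
-- Since `D` has no symmetry, each edge of `B` whose shrinking gives `D` comes from a unique
-- renaming `e` of the arrows. This `e` maps `A`, or `A` with the two ends exchanged, onto `B`, so
-- that edges of `B` are counted by isomorphisms.
theorem IsCollapse.sum_basedDelta [Finite α] [Finite P] {A : ArrowDiagram π α} {u v : α × Bool}
    {D : DegenerateDiagram π P α} (h : A.IsCollapse u v D)
    (hu : A.circle.next u = v ∧ A.circle.mark u = 1) {n : ℕ} (B : ArrowDiagram π (Fin n)) :
    ∑ p, basedDelta B p D.toClass = A.edgeSign u v *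
      (Nat.card {e : α ≃ Fin n // A.map e = B} -
        Nat.card {e : α ≃ Fin n // (A.flip u v).map e = B} : ℚ) := by
  have := Fintype.ofFinite (α ≃ Fin n)
  have h1 : ∀ p, basedDelta B p D.toClass = ∑ e : α ≃ Fin n,
      if (p = (e u.1, u.2) ∧ A.map e = B) ∨ (p = (e v.1, v.2) ∧ (A.flip u v).map e = B) then
        (B.epsilon p : ℚ) else 0 := by
    intro p
    simp only [← h.exists_map_eq_shrink_iff hu]
    rw [basedDelta]
    split_ifs with hp
    · rw [Finsupp.single_apply]
      split_ifs with hD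
      · obtain ⟨f, e, hfe⟩ := DegenerateDiagram.toClass_eq_iff.1 hD.symm
        rw [Finset.sum_eq_single e, if_pos ⟨hp, f, hfe⟩]
        · rintro e' - hne
          rw [if_neg]
          rintro ⟨hp', f', hfe'⟩
          refine hne ?_
          have h2 : D.map (f.trans f'.symm) (e.trans e'.symm) = D := by
            rw [← DegenerateDiagram.map_map, hfe, ← hfe', DegenerateDiagram.map_map,
              Equiv.self_trans_symm, Equiv.self_trans_symm, DegenerateDiagram.map_refl]
          have h3 := (DegenerateDiagram.eq_refl_of_map_eq h2).2
          ext x : 1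
          have h4 := congrArg (fun g => e' (g x)) h3
          simpa using h4.symm
        · simp
      · refine (Finset.sum_eq_zero fun e _ => if_neg ?_).symm
        rintro ⟨hp', f, hfe⟩
        exact hD (DegenerateDiagram.toClass_eq_iff.2 ⟨f, e, hfe⟩).symm
    · refine (Finset.sum_eq_zero fun e _ => if_neg ?_).symm
      rintro ⟨hp', -⟩
      exact hp hp'
  have h2 : ∀ e : α ≃ Fin n, (∑ p, if (p = (e u.1, u.2) ∧ A.map e = B) ∨
      (p = (e v.1, v.2) ∧ (A.flip u v).map e = B) then (B.epsilon p : ℚ) else 0) =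
      (if A.map e = B then (A.edgeSign u v : ℚ) else 0) -
        if (A.flip u v).map e = B then (A.edgeSign u v : ℚ) else 0 := by
    intro e
    have hne : ((e u.1, u.2) : Fin n × Bool) ≠ (e v.1, v.2) := fun hh =>
      h.ne (e.injective (congrArg Prod.fst hh))
    have h3 : ∀ p, (if (p = (e u.1, u.2) ∧ A.map e = B) ∨
        (p = (e v.1, v.2) ∧ (A.flip u v).map e = B) then (B.epsilon p : ℚ) else 0) =
        (if p = (e u.1, u.2) then if A.map e = B then (A.edgeSign u v : ℚ) else 0 else 0) -
          if p = (e v.1, v.2) then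
            if (A.flip u v).map e = B then (A.edgeSign u v : ℚ) else 0 else 0 := by
      intro p
      by_cases hp : p = (e u.1, u.2)
      · subst hp
        by_cases hA : A.map e = B
        · rw [if_pos (Or.inl ⟨rfl, hA⟩), if_pos rfl, if_pos hA, if_neg hne, sub_zero, ← hA,
            epsilon_map hu]
        · simp [hA, hne]
      · by_cases hp' : p = (e v.1, v.2)
        · subst hp'
          by_cases hA : (A.flip u v).map e = B
          -- Exchanging the two ends reverses whether the arrows cross, hence the sign of the edge.
          · rw [if_pos (Or.inr ⟨rfl, hA⟩), if_pos rfl, if_pos hA, if_neg hne.symm, zero_sub, ← hA,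
              epsilon_map (next_flip hu), edgeSign_comm _ h.ne.symm, edgeSign_flip h.adj h.ne,
              Int.cast_neg]
          · simp [hA, hne.symm]
        · simp [hp, hp']
    simp only [h3, Finset.sum_sub_distrib, Finset.sum_ite_eq', Finset.mem_univ, if_true]
  rw [Finset.sum_congr rfl fun p _ => h1 p, Finset.sum_comm, Finset.sum_congr rfl fun e _ => h2 e,
    Finset.sum_sub_distrib]
  simp only [← Finset.sum_filter, Finset.sum_const, nsmul_eq_mul, Nat.card_eq_fintype_card,
    Fintype.card_subtype]
  ring

end Diagram

namespace DiagramSeries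

open Diagram

variable {π : Type*} [Group π] {P α : Type*}

/-- The coefficient of a degenerate diagram in `d(𝒜)`. -/
theorem seriesD_toClass (𝒜 : DiagramSeries Unit π) [Finite α] [Finite P] {A : ArrowDiagram π α}
    {u v : α × Bool} {D : DegenerateDiagram π P α} (h : A.IsCollapse u v D) :
    seriesD 𝒜 D.toClass = A.edgeSign u v * (𝒜.value A - 𝒜.value (A.flip u v)) := by
  classical
  have key : ∀ {u v : α × Bool}, A.IsCollapse u v D →
      (A.circle.next u = v ∧ A.circle.mark u = 1) →
      seriesD 𝒜 D.toClass = A.edgeSign u v * (𝒜.value A - 𝒜.value (A.flip u v)) := by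
    intro u v h hu
    have h1 : ∀ c : ArrowClass π, 𝒜.coeff c * diagramD c D.toClass =
        (if c = A.toClass then A.edgeSign u v * 𝒜.value A else 0) -
          if c = (A.flip u v).toClass then A.edgeSign u v * 𝒜.value (A.flip u v) else 0 := by
      intro c
      rw [diagramD, Finsupp.finsetSum_apply, h.sum_basedDelta hu, card_map_eq, card_map_eq]
      by_cases h2 : c = A.toClass <;> by_cases h3 : c = (A.flip u v).toClass
      · rw [if_pos h2, if_pos h3, if_pos h2, if_pos h3, value_eq, value_eq, ← h2, ← h3]
        ring
      · rw [if_pos h2, if_neg h3, if_pos h2, if_neg h3, value_eq, ← h2]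
        push_cast
        ring
      · rw [if_neg h2, if_pos h3, if_neg h2, if_pos h3, value_eq, ← h3]
        push_cast
        ring
      · simp [h2, h3]
    rw [seriesD, finsum_congr h1, finsum_sub_distrib, finsum_eq_single _ A.toClass,
      finsum_eq_single _ (A.flip u v).toClass, if_pos rfl, if_pos rfl, mul_sub]
    · exact fun c hc => if_neg hc
    · exact fun c hc => if_neg hc
    · exact (Set.finite_singleton A.toClass).subset fun c hc => by_contra fun hne => hc (if_neg hne)
    · exact (Set.finite_singleton (A.flip u v).toClass).subset fun c hc =>
        by_contra fun hne => hc (if_neg hne)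
  rcases h.adj with hu | hu
  · exact key h hu
  · rw [key h.symm hu, edgeSign_comm A h.ne.symm, flip_comm]

end DiagramSeries

/-! ### Triangle relations -/

namespace DegenerateDiagram

variable {π : Type*} [Group π] {P P' α β : Type*}

/-- Ends of type `i` of `a` and `b` meet at the degenerate point of `X`, and `D` is obtained by moving
this end of `b` to the other end of `a`. -/
structure IsSlide (X D : DegenerateDiagram π P α) (a b : α) (i : Bool) : Prop where
  ne : a ≠ b
  circle : X.circle = D.circle
  place : ∀ x, x ≠ (b, i) → X.place x = D.place x
  fork : X.place (a, i) = X.place (b, i)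
  mono : D.place (a, !i) = D.place (b, i)

theorem isSlide_slide (D : DegenerateDiagram π P α) {a b : α} {i : Bool} (hab : a ≠ b)
    (h : D.place (a, i) = D.place (b, i)) : D.IsSlide (D.slide a b i hab h) a b i := by
  refine ⟨hab, rfl, fun x hx => ?_, h, ?_⟩ <;> simp [slide, *]

namespace IsSlide

variable {X X' D D' : DegenerateDiagram π P α} {a b : α} {i : Bool}

theorem slide_eq (h : X.IsSlide D a b i) : X.slide a b i h.ne h.fork = D := by
  refine ext_of h.circle (funext fun x => ?_)
  by_cases hx : x = (b, i)
  · subst hx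
    simp [slide, h.place (a, !i) (by simp [h.ne]), h.mono]
  · simp [slide, hx, h.place x hx]

theorem unique_left (h : X.IsSlide D a b i) (h' : X'.IsSlide D a b i) : X = X' := by
  refine ext_of (h.circle.trans h'.circle.symm) (funext fun x => ?_)
  by_cases hx : x = (b, i)
  · subst hx
    have hne : ((a, i) : α × Bool) ≠ (b, i) := by simp [h.ne]
    rw [← h.fork, ← h'.fork, h.place _ hne, h'.place _ hne]
  · rw [h.place x hx, h'.place x hx]

theorem unique_right (h : X.IsSlide D a b i) (h' : X.IsSlide D' a b i) : D = D' := by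
  rw [← h.slide_eq, ← h'.slide_eq]

theorem map (h : X.IsSlide D a b i) (f : P ≃ P') (e : α ≃ β) :
    (X.map f e).IsSlide (D.map f e) (e a) (e b) i := by
  refine ⟨by simpa using h.ne, by simp [DegenerateDiagram.map, h.circle], fun x hx => ?_, ?_, ?_⟩
  · refine congrArg f (h.place _ fun hx' => hx ?_)
    simpa [Prod.ext_iff, Equiv.symm_apply_eq] using hx'
  · rw [place_map, place_map, h.fork]
  · rw [place_map, place_map, h.mono]

/-- The inverse of a slide: the end of type `i` of `b` goes from one end of `a` to the other one. -/
theorem exists_left (D : DegenerateDiagram π P α) (hab : a ≠ b) (h : D.place (a, !i) = D.place (b, i)) :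
    ∃ X : DegenerateDiagram π P α, X.IsSlide D a b i := by
  classical
  have huniq := D.eq_or_of_place_eq (by simp [hab]) h
  have hai : ((a, i) : α × Bool) ≠ (b, i) := by simp [hab]
  refine ⟨⟨D.circle, Function.update D.place (b, i) (D.place (a, i)), fun y => ?_,
    (a, i), (b, i), hab, ?_, fun u v huv => ?_⟩, hab, rfl, fun x hx => ?_, ?_, h⟩
  · obtain ⟨x, rfl⟩ := D.surj y
    by_cases hx : x = (b, i)
    · exact ⟨(a, !i), by rw [Function.update_of_ne (by simp [hab]), h, hx]⟩
    · exact ⟨x, Function.update_of_ne hx _ _⟩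
  · rw [Function.update_self, Function.update_of_ne hai]
  · by_cases hu : u = (b, i) <;> by_cases hv : v = (b, i)
    · exact Or.inl (hu.trans hv.symm)
    · rw [hu, Function.update_self, Function.update_of_ne hv] at huv
      rcases huniq _ _ huv with h1 | h1 | h1
      · exact Or.inr (Or.inr ⟨hu, h1.symm⟩)
      · simp at h1
      · exact absurd h1.1 hai
    · rw [hv, Function.update_self, Function.update_of_ne hu] at huv
      rcases huniq _ _ huv with h1 | h1 | h1
      · exact Or.inr (Or.inl ⟨h1, hv⟩)
      · exact absurd h1.2 hai
      · simp at h1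
    · rw [Function.update_of_ne hu, Function.update_of_ne hv] at huv
      rcases huniq _ _ huv with h1 | h1 | h1
      · exact Or.inl h1
      · exact absurd h1.2 hv
      · exact absurd h1.1 hu
  · exact Function.update_of_ne hx _ _
  · show Function.update D.place (b, i) (D.place (a, i)) (a, i) =
      Function.update D.place (b, i) (D.place (a, i)) (b, i)
    rw [Function.update_self, Function.update_of_ne hai]

end IsSlide

end DegenerateDiagram

/-- The equations satisfied by a series that is zero modulo the triangle relations: each monotonic
degenerate diagram `D` occurs in the relators of two non monotonic ones, `X` and `Z`. -/
def TriangleEquations {π : Type*} [Group π] (𝒟 : DegenerateClass π → ℚ) : Prop :=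
  ∀ {P α : Type} [Finite P] [Finite α] (D X Z : DegenerateDiagram π P α) (a b : α) (i : Bool),
    X.IsSlide D a b i → Z.IsSlide D b a (!i) → 𝒟 X.toClass + 𝒟 Z.toClass + 𝒟 D.toClass = 0

namespace DiagramSeries

open Diagram DegenerateDiagram

variable {π : Type*} [Group π]

/-- The slide is realized by letting `c` take the place of `b`. The end of `c` of type `!i` is
adjacent to that of `b`, while its end of type `i` is adjacent to the end of `a` of the same type.
So `A` without `b` resolves `X`, just as `A` without `c` resolves `D`. -/
theorem seriesD_of_isSlide {P α γ : Type*} [Finite P] [Finite α] [Finite γ]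
    (𝒜 : DiagramSeries Unit π) {A : ArrowDiagram π γ} {A₁ : ArrowDiagram π α}
    {D X : DegenerateDiagram π P α} {f : α → γ} (H : Diagram.Sub A₁ A f) {a b : α} {c : γ}
    {i : Bool} (hf : Set.range f = {y | y ≠ c}) (hD : A₁.IsCollapse (a, !i) (b, i) D)
    (hX : X.IsSlide D a b i) (hbc : A.circle.Adj (f b, !i) (c, !i))
    (hca : A.circle.Adj (c, i) (f a, i)) :
    seriesD 𝒜 X.toClass = 𝒜.edgeTerm A (f b) (c, i) (f a, i) := by
  classical
  have hfc : ∀ x, f x ≠ c := fun x => by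
    have : f x ∈ {y | y ≠ c} := hf ▸ ⟨x, rfl⟩
    exact this
  have hsw : ∀ x, x ≠ b → Equiv.swap (f b) c (f x) = f x := fun x hx =>
    Equiv.swap_apply_of_ne_of_ne (fun h => hx (H.injective h)) (hfc x)
  set g : α → γ := Equiv.swap (f b) c ∘ f with hg
  have hgb : g b = c := by simp [hg]
  have hga : g a = f a := hsw a hX.ne
  have hginj : Function.Injective g := (Equiv.injective _).comp H.injective
  have hgr : Set.range g = {y | y ≠ f b} := by
    rw [hg, Set.range_comp, hf]
    ext x
    rw [Set.mem_image_equiv, Equiv.symm_swap, Set.mem_ofPred_eq, Set.mem_ofPred_eq, ne_eq,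
      Equiv.swap_apply_eq_iff, Equiv.swap_apply_right]
  obtain ⟨C, hC⟩ := MarkedCircle.Sub.exists_sub A.circle (hginj.prodMap Function.injective_id)
  let A₂ : ArrowDiagram π α := ⟨C, fun _ => ()⟩
  have hA₂ : Diagram.Sub A₂ A g := ⟨hC, fun _ => rfl⟩
  -- The section avoids the end that is slid. What it keeps of `b` and of `c` is then a pair of
  -- adjacent ends, and one is replaced by the other.
  obtain ⟨t, ht, htb, -⟩ := D.exists_section _ _ hD.ne' hD.place
  have h1 := (hD.sub t ht).trans H.circle
  have h2 := h1.swap hbc (Or.inr (by rintro ⟨q, hq⟩; exact hfc _ (congrArg Prod.fst hq)))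
  have h3 : Equiv.swap (f b, !i) (c, !i) ∘ Prod.map f id ∘ t = Prod.map g id ∘ t := by
    funext q
    rcases hq : t q with ⟨x, k⟩
    simp only [Function.comp_apply, hq, Prod.map_apply, id]
    by_cases hx : x = b
    · subst hx
      have hk : k = !i := by
        rw [Bool.eq_not]
        rintro rfl
        exact htb q hq
      rw [hgb, hk, Equiv.swap_apply_left]
    · have hfx : f x ≠ f b := fun h => hx (H.injective h)
      rw [Equiv.swap_apply_of_ne_of_ne (by simp [hfx]) (by simp [hfc]), hg, Function.comp_apply,
        hsw x hx]
  rw [h3] at h2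
  have h4 := hC.cancel (hD.sub t ht).injective h2
  have hX₂ : A₂.IsCollapse (b, i) (a, i) X := by
    refine IsCollapse.of_section hX.ne.symm (hA₂.adj ?_) hX.fork.symm (s := t) (fun q => ?_) ?_
    · rwa [hgb, hga]
    · rw [hX.place _ (htb q), ht]
    · rw [hX.circle]
      exact h4
  have h5 := hA₂.flip (b, i) (a, i)
  simp only [Prod.map_apply, hgb, hga, id] at h5
  have h6 := hA₂.edgeSign b a i i
  rw [hgb, hga] at h6
  rw [𝒜.seriesD_toClass hX₂, edgeTerm, 𝒜.value_restrict hA₂ hgr, 𝒜.value_restrict h5 hgr, h6]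

theorem edgeTerm_comm {α : Type*} [Finite α] (𝒜 : DiagramSeries Unit π) (A : ArrowDiagram π α)
    (x : α) {u v : α × Bool} (h : u.1 ≠ v.1) : 𝒜.edgeTerm A x u v = 𝒜.edgeTerm A x v u := by
  rw [edgeTerm, edgeTerm, edgeSign_comm A h, flip_comm]

/-- Removing `b`, `a` or `c` from the triangle leaves a resolution of `X`, `Z` or `D`, respectively,
and the edge that remains is the one that is shrunk. -/
theorem sixTerm_eq_seriesD {P α γ : Type*} [Finite P] [Finite α] [Finite γ]
    (𝒜 : DiagramSeries Unit π) {A : ArrowDiagram π γ} {A₁ : ArrowDiagram π α}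
    {D X Z : DegenerateDiagram π P α} {f : α → γ} (H : Diagram.Sub A₁ A f) {a b : α} {c : γ}
    {i : Bool} (hf : Set.range f = {y | y ≠ c}) (hD : A₁.IsCollapse (a, !i) (b, i) D)
    (hX : X.IsSlide D a b i) (hZ : Z.IsSlide D b a (!i))
    (hT : A.Triangle (f a) (f b) c i i i) :
    𝒜.sixTerm A (f a) (f b) c i i i =
      seriesD 𝒜 X.toClass + seriesD 𝒜 Z.toClass + seriesD 𝒜 D.toClass := by
  have h1 := 𝒜.seriesD_of_isSlide H hf hD hX hT.adj_bc hT.adj_ca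
  have h2 := 𝒜.seriesD_of_isSlide H hf (i := !i) (by simpa using hD.symm) hZ
    (by simpa using hT.adj_ca.symm) hT.adj_bc.symm
  have h3 := H.flip (a, !i) (b, i)
  simp only [Prod.map_apply, id] at h3
  rw [h1, h2, 𝒜.seriesD_toClass hD, sixTerm, 𝒜.edgeTerm_comm A (f a) hT.ne_bc,
    edgeTerm.eq_def 𝒜 A c, 𝒜.value_restrict H hf, H.edgeSign,
    𝒜.value_restrict h3 hf]
  ring

theorem _root_.Diagram.exists_collapse {α : Type} [Finite α] (A : ArrowDiagram π α)
    {u v : α × Bool} (hne : u.1 ≠ v.1) (h : A.circle.Adj u v) :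
    ∃ (P : Type) (_ : Finite P) (D : DegenerateDiagram π P α), A.IsCollapse u v D := by
  have key : ∀ {u v : α × Bool}, u.1 ≠ v.1 → A.circle.next u = v ∧ A.circle.mark u = 1 →
      ∃ (P : Type) (_ : Finite P) (D : DegenerateDiagram π P α), A.IsCollapse u v D := by
    intro u v hne h
    have hu : A.IsNice u := ⟨h.2, by rwa [h.1]⟩
    exact ⟨_, inferInstance, _, (A.isCollapse_shrink hu).congr rfl h.1⟩
  rcases h with h | h
  · exact key hne h
  · obtain ⟨P, hP, D, hD⟩ := key hne.symm h
    exact ⟨P, hP, D, hD.symm⟩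

theorem sixTerm_rotate {α : Type*} [Finite α] (𝒜 : DiagramSeries Unit π) (A : ArrowDiagram π α)
    (a b c : α) (i j k : Bool) : 𝒜.sixTerm A b c a k (!i) (!j) = 𝒜.sixTerm A a b c i j k := by
  simp only [sixTerm, Bool.not_not]
  ring

/-- Any monotonic `D` comes from a triangle: resolve it and close the triangle with a new arrow.
Conversely, a triangle with distinct numbers of heads has exactly one monotonic edge, and after a
rotation its three labels are equal, so that `sixTerm_eq_seriesD` applies. -/
theorem sixTermRelations_iff (𝒜 : DiagramSeries Unit π) :
    𝒜.SixTermRelations ↔ TriangleEquations (seriesD 𝒜) := by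
  constructor
  · intro h P α _ _ D X Z a b i hX hZ
    obtain ⟨A, hA⟩ := D.exists_isCollapse (u := (a, !i)) (v := (b, i)) hX.ne hX.mono
    obtain ⟨E, hE, e1, e2, -, -, e3⟩ := ArrowDiagram.exists_insert A i (a, i) (b, !i) (a, i) (b, !i)
      (by simp [hX.ne]) (by simp [hX.ne]) (by simp [hX.ne.symm])
    have hr : Set.range (some : α → Option α) = {y | y ≠ none} := by
      ext x
      simp [Option.ne_none_iff_exists', eq_comm]
    have hT : E.Triangle (some a) (some b) none i i i :=
      ⟨by simp [hX.ne], by simp, by simp, e2, e1.symm,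
        e3 _ _ (by simp) (by simp [hX.ne]) (by simp [hX.ne.symm]) (by simp) hA.adj⟩
    rw [← 𝒜.sixTerm_eq_seriesD hE hr hA hX hZ hT]
    exact h _ _ _ _ _ _ _ (by cases i <;> simp [DistinctHeads]) hT
  · intro h
    have key : ∀ {α : Type} [Finite α] (A : ArrowDiagram π α) (a b c : α) (i : Bool),
        A.Triangle a b c i i i → 𝒜.sixTerm A a b c i i i = 0 := by
      intro α _ A a b c i hT
      let a' : {y | y ≠ c} := ⟨a, hT.ne_ca.symm⟩
      let b' : {y | y ≠ c} := ⟨b, hT.ne_bc⟩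
      have hab : a' ≠ b' := fun e => hT.ne_ab (congrArg Subtype.val e)
      have hs := A.sub_restrict {y | y ≠ c}
      obtain ⟨P, _, D, hD⟩ := (A.restrict {y | y ≠ c}).exists_collapse (u := (a', !i))
        (v := (b', i)) hab (hs.adj hT.adj_ab)
      obtain ⟨X, hX⟩ := IsSlide.exists_left D hab hD.place
      obtain ⟨Z, hZ⟩ := IsSlide.exists_left D (i := !i) hab.symm (by simpa using hD.place.symm)
      exact (𝒜.sixTerm_eq_seriesD hs Subtype.range_coe hD hX hZ hT).trans (h D X Z a' b' i hX hZ)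
    intro α _ A a b c i j k hd hT
    have h0 := key A a b c
    have h1 := key A b c a
    have h2 := key A c a b
    have r1 := 𝒜.sixTerm_rotate A a b c i j k
    have r2 := 𝒜.sixTerm_rotate A b c a k (!i) (!j)
    have t1 := hT.rotate
    have t2 := t1.rotate
    rw [r1] at r2
    rw [Bool.not_not] at r2 t2
    revert hd
    -- Six labellings are rotations of constant ones; in the other two, every edge has exactly one
    -- head.
    rcases i <;> rcases j <;> rcases k <;> intro hd
    exacts [h0 _ hT, r1 ▸ h1 _ t1, absurd hd (by simp [DistinctHeads]), r2 ▸ h2 _ t2,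
      r2 ▸ h2 _ t2, absurd hd (by simp [DistinctHeads]), r1 ▸ h1 _ t1, h0 _ hT]

end DiagramSeries

/-! ### Series of degenerate diagrams that are zero modulo the triangle relations -/

namespace DegenerateDiagram

variable {π : Type*} [Group π] {P P' α β : Type*}

theorem exists_fork_or_mono (D : DegenerateDiagram π P α) :
    ∃ (a b : α) (i : Bool), a ≠ b ∧
      (D.place (a, i) = D.place (b, i) ∨ D.place (a, !i) = D.place (b, i)) := by
  obtain ⟨⟨a, k⟩, ⟨b, i⟩, hab, h, -⟩ := D.degenerate
  refine ⟨a, b, i, hab, ?_⟩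
  by_cases hk : k = i
  · exact Or.inl (hk ▸ h)
  · exact Or.inr (Bool.eq_not.2 hk ▸ h)

variable [Finite P] [Finite α] [Finite P'] [Finite β]

theorem toClass_map (D : DegenerateDiagram π P α) (f : P ≃ P') (e : α ≃ β) :
    (D.map f e).toClass = D.toClass :=
  (toClass_eq_iff.2 ⟨f, e, rfl⟩).symm

theorem exists_toClass_eq (d : DegenerateClass π) :
    ∃ (m n : ℕ) (D : DegenerateDiagram π (Fin m) (Fin n)), D.toClass = d := by
  induction d using Quotient.inductionOn with
  | _ D =>
    refine ⟨_, _, D.2, Quotient.sound ⟨(Finite.equivFin _).symm, (Finite.equivFin _).symm, ?_⟩⟩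
    rw [map_map, Equiv.self_trans_symm, Equiv.self_trans_symm, map_refl]

/-- The combination of diagrams that occurs in a triangle relation. -/
def relator (X D D' : DegenerateDiagram π P α) : DegenerateClass π →₀ ℚ :=
  Finsupp.single X.toClass 1 - Finsupp.single D.toClass 1 - Finsupp.single D'.toClass 1

open Classical in
theorem relator_apply (X D D' : DegenerateDiagram π P α) (d : DegenerateClass π) :
    relator X D D' d = (if X.toClass = d then 1 else 0) - (if D.toClass = d then 1 else 0) -
      (if D'.toClass = d then 1 else 0) := by
  simp [relator, Finsupp.single_apply]

theorem mem_triangleRelators {r : DegenerateClass π →₀ ℚ} : r ∈ triangleRelators π ↔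
    ∃ (m n : ℕ) (X D D' : DegenerateDiagram π (Fin m) (Fin n)) (a b : Fin n) (i : Bool),
      X.IsSlide D a b i ∧ X.IsSlide D' b a i ∧ r = relator X D D' := by
  constructor
  · rintro ⟨m, n, X, a, b, i, hab, h, rfl⟩
    exact ⟨m, n, X, _, _, a, b, i, X.isSlide_slide hab h, X.isSlide_slide hab.symm h.symm, rfl⟩
  · rintro ⟨m, n, X, D, D', a, b, i, h, h', rfl⟩
    refine ⟨m, n, X, a, b, i, h.ne, h.fork, ?_⟩
    rw [h.slide_eq, h'.slide_eq, relator]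

variable {X Z D D' E : DegenerateDiagram π P α} {a b : α} {i : Bool}
  {X₁ D₁ D₁' : DegenerateDiagram π P' β} {a₁ b₁ : β} {i₁ j : Bool}

theorem relator_mem (h : X.IsSlide D a b i) (h' : X.IsSlide D' b a i) :
    relator X D D' ∈ triangleRelators π :=
  mem_triangleRelators.2 ⟨_, _, _, _, _, _, _, i, h.map (Finite.equivFin P) (Finite.equivFin α),
    h'.map (Finite.equivFin P) (Finite.equivFin α), by simp only [relator, toClass_map]⟩

/-- The two arrows meeting at the degenerate point are determined up to order, and the relator is
symmetric in them, so it depends only on the class of the non monotonic diagram. -/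
theorem relator_eq (h : X.IsSlide D a b i) (h' : X.IsSlide D' b a i)
    (h₁ : X₁.IsSlide D₁ a₁ b₁ i₁) (h₁' : X₁.IsSlide D₁' b₁ a₁ i₁) (hX : X₁.toClass = X.toClass) :
    relator X₁ D₁ D₁' = relator X D D' := by
  obtain ⟨f, e, rfl⟩ := toClass_eq_iff.1 hX
  have k := h₁.map f e
  have k' := h₁'.map f e
  rcases eq_or_of_place_eq _ (by simp [h.ne]) h.fork _ _ k.fork with h1 | ⟨h1, h2⟩ | ⟨h1, h2⟩
  · exact absurd (congrArg Prod.fst h1) k.ne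
  · obtain ⟨rfl, rfl⟩ := Prod.ext_iff.1 h1
    obtain ⟨rfl, -⟩ := Prod.ext_iff.1 h2
    rw [h.unique_right k, h'.unique_right k']
    simp only [relator, toClass_map]
  · obtain ⟨rfl, rfl⟩ := Prod.ext_iff.1 h1
    obtain ⟨rfl, -⟩ := Prod.ext_iff.1 h2
    rw [h.unique_right k', h'.unique_right k]
    simp only [relator, toClass_map]
    exact sub_right_comm _ _ _

/-- Monotonic degenerate diagrams are not isomorphic to non monotonic ones. -/
theorem IsSlide.toClass_ne (h : X.IsSlide D a b i) (h₁ : X₁.IsSlide D₁ a₁ b₁ i₁) :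
    D₁.toClass ≠ X.toClass := by
  intro hX
  obtain ⟨f, e, rfl⟩ := toClass_eq_iff.1 hX
  have k := h₁.map f e
  rcases eq_or_of_place_eq _ (by simp [h.ne]) h.fork _ _ k.mono with h1 | ⟨h1, h2⟩ | ⟨h1, h2⟩
  · exact absurd (congrArg Prod.fst h1) k.ne
  all_goals
    have h3 := (congrArg Prod.snd h1).trans (congrArg Prod.snd h2).symm
    simp at h3

/-- The two monotonic diagrams in a triangle relation are not isomorphic. -/
theorem IsSlide.toClass_ne_right (h : X.IsSlide D a b i) (h' : X.IsSlide D' b a i) :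
    D.toClass ≠ D'.toClass := by
  intro hD
  obtain ⟨f, e, rfl⟩ := toClass_eq_iff.1 hD
  have hpl : ∀ x k, (D.map f e).place (e x, k) = f (D.place (x, k)) := D.place_map f e
  -- Renaming preserves heads and tails and the degenerate point. The head there belongs to one
  -- arrow in `D` and to the other in `D'`, so the two arrows are exchanged.
  have h1 : e a = b ∧ e b = a := by
    have h2 := (hpl a (!i)).trans ((congrArg f h.mono).trans (hpl b i).symm)
    have hne := h.ne
    have hba : ((b, !i) : α × Bool) ≠ (a, i) := by simp
    rcases eq_or_of_place_eq _ hba h'.mono _ _ h2 with h3 | ⟨h3, h4⟩ | ⟨h3, h4⟩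
    · exact absurd (congrArg Prod.snd h3) (by simp)
    · exact ⟨congrArg Prod.fst h3, congrArg Prod.fst h4⟩
    · exact absurd (congrArg Prod.snd h3) (by simp)
  -- The isomorphism also fixes the point where the ends of type `i` met in `X`, hence every point.
  -- Then the other ends of `a` and `b` would meet as well.
  have hp : f (D.place (a, i)) = D.place (a, i) := by
    rw [← hpl, h1.1, ← h.place _ (by simp [h.ne]), h.fork, h'.place _ (by simp [h.ne.symm])]
  have hf : ∀ q, f q = q := by
    intro q
    obtain ⟨k, rfl⟩ := D.circle.connected (D.place (a, i)) q
    induction k with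
    | zero => exact hp
    | succ k ih =>
      rw [Function.iterate_succ_apply', ← D.next_map f e, ih, ← h'.circle, ← h.circle]
  have h2 : X.place (b, !i) = X.place (a, !i) := by
    rw [h'.place _ (by simp), h.place _ (by simp), ← h1.1, hpl, hf]
  rcases eq_or_of_place_eq _ (by simp [h.ne]) h.fork _ _ h2 with h3 | ⟨h3, -⟩ | ⟨h3, -⟩
  · exact h.ne.symm (congrArg Prod.fst h3)
  all_goals exact absurd (congrArg Prod.snd h3) (by simp)

/-- Ends of type `i` meet in `X`, ends of the opposite type in `Z`. -/
theorem IsSlide.toClass_ne_left (h : X.IsSlide D a b i) (k : Z.IsSlide D b a (!i)) :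
    X.toClass ≠ Z.toClass := by
  intro hX
  obtain ⟨f, e, rfl⟩ := toClass_eq_iff.1 hX
  have h2 : (X.map f e).place (e a, i) = (X.map f e).place (e b, i) := by
    rw [place_map, place_map, h.fork]
  rcases eq_or_of_place_eq _ (by simp [h.ne.symm]) k.fork _ _ h2 with h3 | ⟨h3, -⟩ | ⟨h3, -⟩
  · exact h.ne (e.injective (congrArg Prod.fst h3))
  all_goals exact absurd (congrArg Prod.snd h3) (by simp)

/-- A slide that leads to `D` is undone by moving back one of the two ends at the degenerate point:
that of `b`, which gives `X`, or that of `a`, which gives `Z`. -/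
theorem IsSlide.toClass_eq_or (h : X.IsSlide D a b i) (k : Z.IsSlide D b a (!i))
    (h₁ : X₁.IsSlide D₁ a₁ b₁ i₁) (hD : D₁.toClass = D.toClass) :
    X₁.toClass = X.toClass ∨ X₁.toClass = Z.toClass := by
  obtain ⟨f, e, rfl⟩ := toClass_eq_iff.1 hD
  have h₂ := h₁.map f e
  rcases eq_or_of_place_eq _ (by simp [h.ne]) h.mono _ _ h₂.mono with h1 | ⟨h1, h2⟩ | ⟨h1, h2⟩
  · exact absurd (congrArg Prod.fst h1) h₂.ne
  · obtain ⟨rfl, rfl⟩ := Prod.ext_iff.1 h2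
    obtain ⟨rfl, -⟩ := Prod.ext_iff.1 h1
    exact Or.inl (by rw [h.unique_left h₂, toClass_map])
  · simp only [Prod.mk.injEq] at h1 h2
    obtain ⟨rfl, rfl⟩ := h2
    obtain ⟨rfl, -⟩ := h1
    exact Or.inr (by rw [k.unique_left h₂, toClass_map])

theorem relator_apply_fork (h : X.IsSlide D a b i) (h' : X.IsSlide D' b a i)
    (h₁ : X₁.IsSlide D₁ a₁ b₁ i₁) (h₁' : X₁.IsSlide D₁' b₁ a₁ i₁) :
    (X₁.toClass = X.toClass ∧ relator X₁ D₁ D₁' = relator X D D' ∧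
      relator X₁ D₁ D₁' X.toClass = 1) ∨ relator X₁ D₁ D₁' X.toClass = 0 := by
  rw [relator_apply, if_neg (h.toClass_ne h₁), if_neg (h.toClass_ne h₁')]
  by_cases hX : X₁.toClass = X.toClass
  · exact Or.inl ⟨hX, relator_eq h h' h₁ h₁' hX, by simp [hX]⟩
  · exact Or.inr (by simp [hX])

/-- Only its own relator contains a non monotonic diagram, with coefficient 1. -/
theorem finsum_relator_fork (q : triangleRelators π → ℚ) (h : X.IsSlide D a b i)
    (h' : X.IsSlide D' b a i) :
    ∑ᶠ r : triangleRelators π, q r * (r : DegenerateClass π →₀ ℚ) X.toClass =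
      q ⟨relator X D D', relator_mem h h'⟩ := by
  rw [finsum_eq_single _ ⟨relator X D D', relator_mem h h'⟩]
  · rcases relator_apply_fork h h' h h' with h1 | h1
    · simp [h1.2.2]
    · rw [relator_apply, if_neg (h.toClass_ne h), if_neg (h.toClass_ne h')] at h1
      simp at h1
  · rintro ⟨r, hr⟩ hne
    obtain ⟨m, n, X₁, D₁, D₁', a₁, b₁, i₁, h₁, h₁', rfl⟩ := mem_triangleRelators.1 hr
    rcases relator_apply_fork h h' h₁ h₁' with h1 | h1
    · exact absurd (Subtype.ext h1.2.1) hne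
    · rw [h1, mul_zero]

theorem relator_apply_mono (h : X.IsSlide D a b i) (h' : X.IsSlide D' b a i) :
    relator X D D' D.toClass = -1 := by
  rw [relator_apply, if_neg (h.toClass_ne h).symm, if_pos rfl,
    if_neg (h.toClass_ne_right h').symm]
  norm_num

/-- `D` lies in the relators of `X` and `Z` only. They are distinct, and each contains `D` once,
with coefficient −1, because the two monotonic diagrams of a relator are not isomorphic. -/
theorem finsum_relator_mono (q : triangleRelators π → ℚ) (h : X.IsSlide D a b i)
    (h' : X.IsSlide D' b a i) (k : Z.IsSlide D b a (!i)) (k' : Z.IsSlide E a b (!i)) :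
    ∑ᶠ r : triangleRelators π, q r * (r : DegenerateClass π →₀ ℚ) D.toClass =
      -q ⟨relator X D D', relator_mem h h'⟩ - q ⟨relator Z D E, relator_mem k k'⟩ := by
  classical
  set rX : triangleRelators π := ⟨relator X D D', relator_mem h h'⟩ with hrX
  set rZ : triangleRelators π := ⟨relator Z D E, relator_mem k k'⟩ with hrZ
  have hne : rX ≠ rZ := by
    intro hr
    have h1 : relator X D D' X.toClass = relator Z D E X.toClass := by
      rw [show relator X D D' = relator Z D E from congrArg Subtype.val hr]
    rw [relator_apply, relator_apply, if_neg (h.toClass_ne h), if_neg (h.toClass_ne h'),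
      if_neg (h.toClass_ne k'), if_neg (h.toClass_ne_left k).symm] at h1
    simp at h1
  rw [finsum_eq_sum_of_support_subset (s := {rX, rZ}), Finset.sum_pair hne]
  · rw [show (rX : DegenerateClass π →₀ ℚ) D.toClass = -1 from relator_apply_mono h h',
      show (rZ : DegenerateClass π →₀ ℚ) D.toClass = -1 from relator_apply_mono k k']
    ring
  · rintro ⟨r, hr⟩ hmem
    by_contra hnot
    obtain ⟨m, n, X₁, D₁, D₁', a₁, b₁, i₁, h₁, h₁', rfl⟩ := mem_triangleRelators.1 hr
    have key : ¬ (X₁.toClass = X.toClass ∨ X₁.toClass = Z.toClass) := by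
      rintro (h1 | h1)
      · exact hnot (by simp [hrX, relator_eq h h' h₁ h₁' h1])
      · exact hnot (by simp [hrZ, relator_eq k k' h₁ h₁' h1])
    refine hmem ?_
    show _ * relator X₁ D₁ D₁' D.toClass = 0
    rw [relator_apply, if_neg (h₁.toClass_ne h).symm, if_neg fun hD => key (h.toClass_eq_or k h₁ hD),
      if_neg fun hD => key (h.toClass_eq_or k h₁' hD)]
    simp

end DegenerateDiagram

open DegenerateDiagram

/-- The coefficients of the relators are forced: each one is the value of 𝒟 at the non monotonic
diagram of the relator. The equations that remain are those at monotonic diagrams. -/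
theorem isZeroModTriangle_iff {π : Type*} [Group π] (𝒟 : DegenerateClass π → ℚ) :
    IsZeroModTriangle 𝒟 ↔ TriangleEquations 𝒟 := by
  constructor
  · rintro ⟨q, hq⟩ P α _ _ D X Z a b i h k
    have h' := X.isSlide_slide h.ne.symm h.fork.symm
    have k' := Z.isSlide_slide h.ne k.fork.symm
    rw [hq, hq, hq, finsum_relator_fork q h h', finsum_relator_fork q k k',
      finsum_relator_mono q h h' k k']
    ring
  · intro hT
    have hex : ∀ r : triangleRelators π, ∃ (m n : ℕ) (X D D' : DegenerateDiagram π (Fin m) (Fin n))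
      (a b : Fin n) (i : Bool), X.IsSlide D a b i ∧ X.IsSlide D' b a i ∧ r.1 = relator X D D' :=
      fun r => mem_triangleRelators.1 r.2
    choose m n X D D' a b i h h' hr using hex
    -- The diagram chosen for a relator is isomorphic to the given one, since it is the only class
    -- with coefficient 1.
    have hq : ∀ {P α : Type} [Finite P] [Finite α] {Y C C' : DegenerateDiagram π P α} {a b : α}
        {i : Bool} (hC : Y.IsSlide C a b i) (hC' : Y.IsSlide C' b a i),
        𝒟 (X ⟨relator Y C C', relator_mem hC hC'⟩).toClass = 𝒟 Y.toClass := by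
      intro P α _ _ Y C C' a b i hC hC'
      set r : triangleRelators π := ⟨relator Y C C', relator_mem hC hC'⟩
      congr 1
      rcases relator_apply_fork hC hC' (h r) (h' r) with h1 | h1
      · exact h1.1
      · rw [← hr r] at h1
        have h2 : relator Y C C' Y.toClass = 0 := h1
        rw [relator_apply, if_neg (hC.toClass_ne hC), if_neg (hC.toClass_ne hC')] at h2
        simp at h2
    refine ⟨fun r => 𝒟 (X r).toClass, fun d => ?_⟩
    obtain ⟨m, n, C, rfl⟩ := exists_toClass_eq d
    obtain ⟨a, b, i, hab, hC | hC⟩ := C.exists_fork_or_mono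
    · have h1 := C.isSlide_slide hab hC
      have h2 := C.isSlide_slide hab.symm hC.symm
      rw [finsum_relator_fork _ h1 h2, hq h1 h2]
    · obtain ⟨Y, hY⟩ := IsSlide.exists_left C hab hC
      obtain ⟨Z, hZ⟩ := IsSlide.exists_left C (i := !i) hab.symm (by simpa using hC.symm)
      have hY' := Y.isSlide_slide hab.symm hY.fork.symm
      have hZ' := Z.isSlide_slide hab hZ.fork.symm
      rw [finsum_relator_mono _ hY hY' hZ hZ', hq hY hY', hq hZ hZ']
      linarith [hT C Y Z a b i hY hZ]

end

/-! ### The equivalence of the three conditions -/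

theorem mainTheorem4 {π : Type*} [Group π] (𝒜 : DiagramSeries Unit π) (hR2 : SatisfiesR2 𝒜) :
    List.TFAE
      [IsR3Invariant 𝒜,
        IsZeroModTriangle (seriesD 𝒜),
        IsOrthogonalToA6T 𝒜] := by
  have h1 : IsR3Invariant 𝒜 ↔ 𝒜.SixTermRelations :=
    ⟨fun h => h.sixTermRelations, fun h => h.isR3Invariant hR2⟩
  have h2 : IsZeroModTriangle (seriesD 𝒜) ↔ 𝒜.SixTermRelations :=
    (isZeroModTriangle_iff _).trans 𝒜.sixTermRelations_iff.symm
  have h3 := 𝒜.isOrthogonalToA6T_iff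
  tfae_have 1 ↔ 2 := h1.trans h2.symm
  tfae_have 2 ↔ 3 := h2.trans h3.symm
  tfae_finish
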